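/- Let $I$ be a finite set and $A=(a_{ij})_{i,j\in I}$ an indecomposable symmetrizable generalized Cartan matrix. Let $\mathfrak g$ be the derived Kac–Moody algebra of $A$: the complex Lie algebra with generators $e_i,f_i,h_i$ ($i\in I$) and relations $[h_i,h_j]=0$, $[h_i,e_j]=a_{ij}e_j$, $[h_i,f_j]=-a_{ij}f_j$, $[e_i,f_j]=\delta_{ij}h_i$ for $i,j\in I$, and $\mathrm{ad}(e_i)^{1-a_{ij}}(e_j)=\mathrm{ad}(f_i)^{1-a_{ij}}(f_j)=0$ for $i\neq j$. Put $\mathfrak h=\sum_{i}\mathbb C h_i$ and let $\mathfrak n^-$ be the Lie subalgebra generated by all $f_i$. Let the Weyl group, generated by the simple reflections $r_i$, act on the root lattice $Q=\bigoplus_i\mathbb Z\alpha_i$ by $r_i(\alpha_j)=\alpha_j-a_{ij}\alpha_i$. Let $X\subseteq I$ be such that $A_X=(a_{ij})_{i,j\in X}$ is of finite type (all principal minors are positive), let $W_X=\langle r_i\rangle_{i\in X}$ and let $w_X$ be the longest element of $W_X$. Let $\tau$ be a permutation of $I$ with $\tau^2=\mathrm{id}$ and $a_{\tau(i)\tau(j)}=a_{ij}$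 for all $i,j$, such that $-w_X(\alpha_i)=\alpha_{\tau(i)}$ for all $i\in X$. Let $\theta$ act on $Q$ by $\theta(\alpha_j)=-w_X(\alpha_{\tau(j)})$, and assume that $(X,\tau)$ is a generalized Satake diagram: for all $i\in X$ and $j\in I\setminus X$, if $\theta(\alpha_j)=-(\alpha_i+\alpha_j)$ then $a_{ji}\neq-1$. Define the linear automorphism $\theta$ of $\mathfrak g$ by $\theta=\mathrm{Ad}(m_{i_1})\cdots\mathrm{Ad}(m_{i_\ell})\,\tau\,\omega$, where $w_X=r_{i_1}\cdots r_{i_\ell}$ is any reduced expression, $\mathrm{Ad}(m_i)=\exp(\mathrm{ad}\,e_i)\exp(-\mathrm{ad}\,f_i)\exp(\mathrm{ad}\,e_i)$, $\tau$ is the Lie algebra automorphism with $e_i\mapsto e_{\tau(i)}$, $f_i\mapsto f_{\tau(i)}$, $h_i\mapsto h_{\tau(i)}$, and $\omega$ is the Chevalley involution $e_i\mapsto-f_i$, $f_i\mapsto-e_i$, $h_i\mapsto-h_i$. Let $\mathfrak h^\theta=\{x\in\mathfrak h:\theta(x)=x\}$ and let $\mathfrak n^+_X$ be the Lie subalgebra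 generated by the $e_i$ with $i\in X$. A component of $X$ is a subset $Y\subseteq X$ with $a_{ik}=0$ for all $i\in Y$, $k\in X\setminus Y$. For $j\in I\setminus X$ let $X(j)$ be the smallest component of $X$ containing every $i\in X$ with $a_{ij}\ne0$. Let $\boldsymbol c=(c_j)_{j\in I\setminus X}$ be nonzero complex numbers such that, for all $j\in I\setminus X$, $$a_{j,\tau(j)}=0\ \text{ and }\ X(j)=\emptyset\quad\Longrightarrow\quad c_j=c_{\tau(j)}.$$ Put $g_i=f_i$ for $i\in X$ and $g_i=f_i+c_i\theta(f_i)$ for $i\in I\setminus X$, and let $\mathfrak k_{\boldsymbol c}$ be the Lie subalgebra of $\mathfrak g$ generated by $\mathfrak n^+_X$, $\mathfrak h^\theta$ and all $g_i$, $i\in I$. For a nonempty word $\boldsymbol i=(i_1,\dots,i_\ell)$ in $I$ put $f_{\boldsymbol i}=\mathrm{ad}(f_{i_1})\cdots\mathrm{ad}(f_{i_{\ell-1}})(f_{i_\ell})$ and $g_{\boldsymbol i}=\mathrm{ad}(g_{i_1})\cdots\mathrm{ad}(g_{i_{\ell-1}})(g_{i_\ell})$. Let $\mathcal J$ be any set of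 nonempty words such that $(f_{\boldsymbol j})_{\boldsymbol j\in\mathcal J}$ is a basis of $\mathfrak n^-$. Then, as vector spaces, $$\mathfrak k_{\boldsymbol c}=\mathfrak n^+_X\oplus\mathfrak h^\theta\oplus\bigoplus_{\boldsymbol j\in\mathcal J}\mathbb C\,g_{\boldsymbol j},$$ and $g_{\boldsymbol j}\neq0$ for every $\boldsymbol j\in\mathcal J$. -/

import Mathlib

noncomputable section

namespace KacMoody

/-! ### Generalized Cartan matrices -/

section CartanData

variable {I : Type*} [Fintype I] [DecidableEq I]

/-- `A` is a generalized Cartan matrix which is symmetrizable. -/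
structure IsSymmetrizableGCM (A : Matrix I I ℤ) : Prop where
  diag : ∀ i, A i i = 2
  offDiag : ∀ i j, i ≠ j → A i j ≤ 0
  symmetrizable : ∃ d : I → ℚ, (∀ i, 0 < d i) ∧ ∀ i j, d i * A i j = d j * A j i

/-- No proper nonempty subset of the nodes is disconnected from its complement. -/
def IsIndecomposable (A : Matrix I I ℤ) : Prop :=
  ∀ Y : Finset I, Y.Nonempty → Y ≠ Finset.univ → ∃ i ∈ Y, ∃ j ∉ Y, A i j ≠ 0

/-- The submatrix `A_X` is of finite type: all its principal minors are positive. -/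
def IsFiniteType (A : Matrix I I ℤ) (X : Finset I) : Prop :=
  ∀ Y ⊆ X, 0 < (A.submatrix (fun i : Y => (i : I)) (fun i : Y => (i : I))).det

/-- `σ` is a diagram automorphism of `A`. -/
def IsDiagramAut (A : Matrix I I ℤ) (σ : Equiv.Perm I) : Prop :=
  ∀ i j, A (σ i) (σ j) = A i j

/-! ### Components of a set of nodes -/

/-- `Y` is a (possibly empty or disconnected) component of `X`. -/
def IsComponent (A : Matrix I I ℤ) (X Y : Finset I) : Prop :=
  Y ⊆ X ∧ ∀ i ∈ Y, ∀ j ∈ X, j ∉ Y → A i j = 0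

/-- `X(j)`, the smallest component of `X` containing all `i ∈ X` with `a_{ij} ≠ 0`. -/
def neighbourComponent (A : Matrix I I ℤ) (X : Finset I) (j : I) : Set I :=
  {i | ∀ Y, IsComponent A X Y → (∀ k ∈ X, A k j ≠ 0 → k ∈ Y) → i ∈ Y}

/-! ### The root lattice and the Weyl group

The root lattice `Q = ⊕ ℤ α_i` is `I → ℤ`; the simple roots are its standard basis. -/

/-- The simple root `α_i`. -/
def simpleRoot (i : I) : I → ℤ := Pi.single i 1

/-- The simple reflection `r_i : μ ↦ μ - μ(h_i) α_i`, so that `r_i α_j = α_j - a_{ij} α_i`. -/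
def simpleReflection (A : Matrix I I ℤ) (i : I) : Module.End ℤ (I → ℤ) :=
  LinearMap.id - ((LinearMap.proj i).comp A.mulVecLin).smulRight (simpleRoot i)

/-- The product `r_{i_1} r_{i_2} ⋯ r_{i_ℓ}` of a word `(i_1, …, i_ℓ)`. The Weyl group is the set
of all such products, `W_X` the set of those with letters in `X`. -/
def weylProd (A : Matrix I I ℤ) (l : List I) : Module.End ℤ (I → ℤ) :=
  (l.map (simpleReflection A)).prod

/-- A word is reduced if its product is not the product of a shorter word. -/
def IsReducedWord (A : Matrix I I ℤ) (l : List I) : Prop :=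
  ∀ l' : List I, weylProd A l' = weylProd A l → l.length ≤ l'.length

/-- `l` is a reduced expression of the longest element `w_X` of `W_X`. -/
def IsLongestWord (A : Matrix I I ℤ) (X : Finset I) (l : List I) : Prop :=
  (∀ i ∈ l, i ∈ X) ∧ IsReducedWord A l ∧
    ∀ l' : List I, (∀ i ∈ l', i ∈ X) → IsReducedWord A l' → l'.length ≤ l.length

/-- The action of `θ = - w_X τ` on the root lattice, `l` being an expression of `w_X`. -/
def thetaRoot (A : Matrix I I ℤ) (τ : Equiv.Perm I) (l : List I) : Module.End ℤ (I → ℤ) :=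
  -(weylProd A l ∘ₗ LinearMap.funLeft ℤ ℤ τ.symm)

/-- `(X, τ)` is a generalized Satake diagram; since `A_X` is of finite type, `w_X` exists and is
unique, so the clauses about it are stated for its reduced expressions `l`. -/
structure IsGeneralizedSatake (A : Matrix I I ℤ) (X : Finset I) (τ : Equiv.Perm I) : Prop where
  finiteType : IsFiniteType A X
  diagramAut : IsDiagramAut A τ
  involutive : ∀ i, τ (τ i) = i
  neg_longest : ∀ l, IsLongestWord A X l →
    ∀ i ∈ X, -(weylProd A l (simpleRoot i)) = simpleRoot (τ i)
  no_obstruction : ∀ l, IsLongestWord A X l → ∀ i ∈ X, ∀ j ∉ X,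
    thetaRoot A τ l (simpleRoot j) = -(simpleRoot i + simpleRoot j) → A j i ≠ -1

end CartanData

/-! ### The derived Kac-Moody algebra -/

section Algebra

variable {I : Type*} [DecidableEq I] (A : Matrix I I ℤ)

/-- The derived Kac-Moody Lie algebra of `A` over `ℂ`, given by the Chevalley generators and the
Serre presentation. -/
abbrev KM := Matrix.ToLieAlgebra ℂ A

/-- The projection from the free Lie algebra on the Chevalley generators. -/
def proj : FreeLieAlgebra ℂ (CartanMatrix.Generators I) →ₗ⁅ℂ⁆ KM A where
  toLinearMap := (LieSubmodule.Quotient.mk' (CartanMatrix.Relations.toIdeal ℂ A)).toLinearMap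
  map_lie' := by intro x y; rfl

/-- The generator `e_i`. -/
def e (i : I) : KM A := proj A (FreeLieAlgebra.of ℂ (.E i))

/-- The generator `f_i`. -/
def f (i : I) : KM A := proj A (FreeLieAlgebra.of ℂ (.F i))

/-- The generator `h_i`. -/
def h (i : I) : KM A := proj A (FreeLieAlgebra.of ℂ (.H i))

theorem proj_surjective : Function.Surjective (proj A) :=
  LieSubmodule.Quotient.surjective_mk' _

theorem proj_eq_zero {x : FreeLieAlgebra ℂ (CartanMatrix.Generators I)}
    (hx : x ∈ CartanMatrix.Relations.toSet ℂ A) : proj A x = 0 :=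
  (LieSubmodule.Quotient.mk_eq_zero (N := CartanMatrix.Relations.toIdeal ℂ A)).2
    (LieSubmodule.subset_lieSpan hx)

theorem map_ad_pow {L L' : Type*} [LieRing L] [LieAlgebra ℂ L] [LieRing L'] [LieAlgebra ℂ L']
    (ψ : L →ₗ⁅ℂ⁆ L') (x y : L) (n : ℕ) :
    ψ (((LieAlgebra.ad ℂ L x) ^ n) y) = ((LieAlgebra.ad ℂ L' (ψ x)) ^ n) (ψ y) := by
  induction n with
  | zero => simp
  | succ n ih => simp [pow_succ', ih]

theorem lie_h_h (i j : I) : ⁅h A i, h A j⁆ = 0 := by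
  have := proj_eq_zero A (x := CartanMatrix.Relations.HH ℂ (i, j))
    (by simp [CartanMatrix.Relations.toSet])
  simpa [CartanMatrix.Relations.HH, h] using this

theorem lie_e_f_same (i : I) : ⁅e A i, f A i⁆ = h A i := by
  have := proj_eq_zero A (x := CartanMatrix.Relations.EF ℂ (i, i))
    (Or.inl (Or.inl (Or.inl (Or.inl (Or.inr ⟨_, rfl⟩)))))
  simpa [CartanMatrix.Relations.EF, e, f, h, sub_eq_zero] using this

theorem lie_e_f_ne {i j : I} (hij : i ≠ j) : ⁅e A i, f A j⁆ = 0 := by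
  have := proj_eq_zero A (x := CartanMatrix.Relations.EF ℂ (i, j))
    (Or.inl (Or.inl (Or.inl (Or.inl (Or.inr ⟨_, rfl⟩)))))
  simpa [CartanMatrix.Relations.EF, e, f, hij] using this

theorem lie_h_e (i j : I) : ⁅h A i, e A j⁆ = A i j • e A j := by
  have := proj_eq_zero A (x := CartanMatrix.Relations.HE ℂ A (i, j))
    (Or.inl (Or.inl (Or.inl (Or.inr ⟨_, rfl⟩))))
  simpa [CartanMatrix.Relations.HE, e, h, sub_eq_zero] using this

theorem lie_h_f (i j : I) : ⁅h A i, f A j⁆ = -(A i j • f A j) := by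
  have := proj_eq_zero A (x := CartanMatrix.Relations.HF ℂ A (i, j))
    (Or.inl (Or.inl (Or.inr ⟨_, rfl⟩)))
  simpa [CartanMatrix.Relations.HF, f, h, add_eq_zero_iff_eq_neg] using this

theorem serre_e (i j : I) :
    ((LieAlgebra.ad ℂ (KM A) (e A i)) ^ (-A i j).toNat) ⁅e A i, e A j⁆ = 0 := by
  have := proj_eq_zero A (x := CartanMatrix.Relations.adE ℂ A (i, j))
    (Or.inl (Or.inr ⟨_, rfl⟩))
  simpa only [CartanMatrix.Relations.adE, e, Function.uncurry, Function.comp, map_ad_pow,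
    LieHom.map_lie] using this

theorem serre_f (i j : I) :
    ((LieAlgebra.ad ℂ (KM A) (f A i)) ^ (-A i j).toNat) ⁅f A i, f A j⁆ = 0 := by
  have := proj_eq_zero A (x := CartanMatrix.Relations.adF ℂ A (i, j))
    (Or.inr ⟨_, rfl⟩)
  simpa only [CartanMatrix.Relations.adF, f, Function.uncurry, Function.comp, map_ad_pow,
    LieHom.map_lie] using this

/-- A Lie subalgebra containing the Chevalley generators is everything. -/
theorem mem_of_generators (S : LieSubalgebra ℂ (KM A)) (he : ∀ i, e A i ∈ S) (hf : ∀ i, f A i ∈ S)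
    (hh : ∀ i, h A i ∈ S) (x : KM A) : x ∈ S := by
  let ψ : FreeLieAlgebra ℂ (CartanMatrix.Generators I) →ₗ⁅ℂ⁆ S :=
    FreeLieAlgebra.lift ℂ fun g => match g with
      | .H i => ⟨h A i, hh i⟩
      | .E i => ⟨e A i, he i⟩
      | .F i => ⟨f A i, hf i⟩
  have hψ : S.incl.comp ψ = proj A := by
    apply FreeLieAlgebra.hom_ext
    rintro (i | i | i) <;> simp [ψ, e, f, h]
  obtain ⟨y, rfl⟩ := proj_surjective A x
  rw [← hψ]
  exact (ψ y).2

/-- The universal property of the Serre presentation. -/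
def lift {L : Type*} [LieRing L] [LieAlgebra ℂ L] (e' f' h' : I → L)
    (hhh : ∀ i j, ⁅h' i, h' j⁆ = 0)
    (hef : ∀ i, ⁅e' i, f' i⁆ = h' i)
    (hef' : ∀ i j, i ≠ j → ⁅e' i, f' j⁆ = 0)
    (hhe : ∀ i j, ⁅h' i, e' j⁆ = A i j • e' j)
    (hhf : ∀ i j, ⁅h' i, f' j⁆ = -(A i j • f' j))
    (hse : ∀ i j, ((LieAlgebra.ad ℂ L (e' i)) ^ (-A i j).toNat) ⁅e' i, e' j⁆ = 0)
    (hsf : ∀ i j, ((LieAlgebra.ad ℂ L (f' i)) ^ (-A i j).toNat) ⁅f' i, f' j⁆ = 0) :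
    KM A →ₗ⁅ℂ⁆ L :=
  let ψ : FreeLieAlgebra ℂ (CartanMatrix.Generators I) →ₗ⁅ℂ⁆ L :=
    FreeLieAlgebra.lift ℂ fun g => match g with
      | .H i => h' i
      | .E i => e' i
      | .F i => f' i
  have hψ : CartanMatrix.Relations.toIdeal ℂ A ≤ ψ.ker := by
    refine LieSubmodule.lieSpan_le.2 ?_
    rintro x (((((⟨⟨i, j⟩, rfl⟩ | ⟨⟨i, j⟩, rfl⟩) | ⟨⟨i, j⟩, rfl⟩) | ⟨⟨i, j⟩, rfl⟩) |
      ⟨⟨i, j⟩, rfl⟩) | ⟨⟨i, j⟩, rfl⟩)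
    · simp [CartanMatrix.Relations.HH, ψ, hhh]
    · by_cases hij : i = j
      · subst hij
        simp [CartanMatrix.Relations.EF, ψ, hef]
      · simp [CartanMatrix.Relations.EF, ψ, hij, hef' i j hij]
    · simp [CartanMatrix.Relations.HE, ψ, hhe]
    · simp [CartanMatrix.Relations.HF, ψ, hhf]
    · simpa [CartanMatrix.Relations.adE, ψ, map_ad_pow] using hse i j
    · simpa [CartanMatrix.Relations.adF, ψ, map_ad_pow] using hsf i j
  { toLinearMap := Submodule.liftQ (CartanMatrix.Relations.toIdeal ℂ A).toSubmodule
      (ψ : FreeLieAlgebra ℂ (CartanMatrix.Generators I) →ₗ[ℂ] L) hψ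
    map_lie' := by
      intro x y
      obtain ⟨x, rfl⟩ := proj_surjective A x
      obtain ⟨y, rfl⟩ := proj_surjective A y
      exact ψ.map_lie x y }

theorem ad_neg_pow {L : Type*} [LieRing L] [LieAlgebra ℂ L] {x y : L} {n : ℕ}
    (hxy : ((LieAlgebra.ad ℂ L x) ^ n) y = 0) : ((LieAlgebra.ad ℂ L (-x)) ^ n) y = 0 := by
  rw [map_neg, neg_pow]
  rcases neg_one_pow_eq_or (Module.End ℂ L) n with hn | hn <;> simp [hn, hxy]

/-- The Chevalley involution: `e_i ↦ -f_i`, `f_i ↦ -e_i`, `h_i ↦ -h_i`. -/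
def chevalley : KM A →ₗ⁅ℂ⁆ KM A :=
  lift A (fun i => -f A i) (fun i => -e A i) (fun i => -h A i)
    (by intro i j; simp [lie_h_h])
    (by intro i; rw [neg_lie, lie_neg, neg_neg, ← lie_skew, lie_e_f_same])
    (by intro i j hij; rw [neg_lie, lie_neg, neg_neg, ← lie_skew, lie_e_f_ne A hij.symm, neg_zero])
    (by intro i j; simp [lie_h_f])
    (by intro i j; simp [lie_h_e])
    (by intro i j; exact ad_neg_pow (by simpa using serre_f A i j))
    (by intro i j; exact ad_neg_pow (by simpa using serre_e A i j))

/-- The automorphism of the Kac-Moody algebra induced by a diagram automorphism `σ`: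
`e_i ↦ e_{σ(i)}`, `f_i ↦ f_{σ(i)}`, `h_i ↦ h_{σ(i)}`. -/
def diagramHom (σ : Equiv.Perm I) (hσ : IsDiagramAut A σ) : KM A →ₗ⁅ℂ⁆ KM A :=
  lift A (fun i => e A (σ i)) (fun i => f A (σ i)) (fun i => h A (σ i))
    (by intro i j; exact lie_h_h A _ _)
    (by intro i; exact lie_e_f_same A _)
    (by intro i j hij; exact lie_e_f_ne A (fun H => hij (σ.injective H)))
    (by intro i j; rw [← hσ i j]; exact lie_h_e A _ _)
    (by intro i j; rw [← hσ i j]; exact lie_h_f A _ _)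
    (by intro i j; rw [← hσ i j]; exact serre_e A _ _)
    (by intro i j; rw [← hσ i j]; exact serre_f A _ _)

/-! ### Exponentials of locally nilpotent endomorphisms -/

/-- `exp(D) = ∑ Dⁿ / n!` for a locally nilpotent endomorphism `D`: on each vector the sum has only
finitely many nonzero terms. -/
def expLocNilp {V : Type*} [AddCommGroup V] [Module ℂ V] (D : Module.End ℂ V)
    (hD : ∀ x, ∃ n : ℕ, (D ^ n) x = 0) : Module.End ℂ V :=
  have hfin : ∀ x, (Function.support fun n : ℕ => ((n.factorial : ℂ)⁻¹) • (D ^ n) x).Finite := by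
    intro x
    obtain ⟨n, hn⟩ := hD x
    refine (Set.finite_lt_nat n).subset fun m hm => ?_
    by_contra hlt
    obtain ⟨k, rfl⟩ := Nat.exists_eq_add_of_le (not_lt.1 hlt)
    apply hm
    simp [add_comm n k, pow_add, hn]
  { toFun := fun x => ∑ᶠ n : ℕ, ((n.factorial : ℂ)⁻¹) • (D ^ n) x
    map_add' := by
      intro x y
      rw [← finsum_add_distrib (hfin x) (hfin y)]
      simp
    map_smul' := by
      intro c x
      rw [RingHom.id_apply, smul_finsum' c (hfin x)]
      refine finsum_congr fun n => ?_
      rw [map_smul, smul_comm] }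

theorem ad_e_locNilp (i : I) (x : KM A) : ∃ n : ℕ, ((LieAlgebra.ad ℂ (KM A) (e A i)) ^ n) x = 0 := by
  have hh : ∀ j, h A j ∈ LieSubalgebra.engel ℂ (e A i) := by
    intro j
    refine (LieSubalgebra.mem_engel_iff ℂ _ _).2 ⟨2, ?_⟩
    rw [pow_two, Module.End.mul_apply, LieAlgebra.ad_apply, LieAlgebra.ad_apply,
      ← lie_skew _ (h A j), lie_h_e]
    simp
  refine (LieSubalgebra.mem_engel_iff ℂ _ _).1
    (mem_of_generators A (LieSubalgebra.engel ℂ (e A i)) ?_ ?_ hh x)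
  · intro j
    exact (LieSubalgebra.mem_engel_iff ℂ _ _).2 ⟨(-A i j).toNat + 1, by
      simpa [pow_succ] using serre_e A i j⟩
  · intro j
    by_cases hij : i = j
    · subst hij
      obtain ⟨n, hn⟩ := (LieSubalgebra.mem_engel_iff ℂ _ _).1 (hh i)
      exact (LieSubalgebra.mem_engel_iff ℂ _ _).2 ⟨n + 1, by simpa [pow_succ, lie_e_f_same] using hn⟩
    · exact (LieSubalgebra.mem_engel_iff ℂ _ _).2 ⟨1, by simpa using lie_e_f_ne A hij⟩

theorem ad_f_locNilp (i : I) (x : KM A) : ∃ n : ℕ, ((LieAlgebra.ad ℂ (KM A) (f A i)) ^ n) x = 0 := by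
  have hh : ∀ j, h A j ∈ LieSubalgebra.engel ℂ (f A i) := by
    intro j
    refine (LieSubalgebra.mem_engel_iff ℂ _ _).2 ⟨2, ?_⟩
    rw [pow_two, Module.End.mul_apply, LieAlgebra.ad_apply, LieAlgebra.ad_apply,
      ← lie_skew _ (h A j), lie_h_f]
    simp
  refine (LieSubalgebra.mem_engel_iff ℂ _ _).1
    (mem_of_generators A (LieSubalgebra.engel ℂ (f A i)) ?_ ?_ hh x)
  · intro j
    by_cases hij : j = i
    · subst hij
      obtain ⟨n, hn⟩ := (LieSubalgebra.mem_engel_iff ℂ _ _).1 (hh j)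
      refine (LieSubalgebra.mem_engel_iff ℂ _ _).2 ⟨n + 1, ?_⟩
      rw [pow_succ, Module.End.mul_apply, LieAlgebra.ad_apply, ← lie_skew, lie_e_f_same, map_neg, hn,
        neg_zero]
    · refine (LieSubalgebra.mem_engel_iff ℂ _ _).2 ⟨1, ?_⟩
      rw [pow_one, LieAlgebra.ad_apply, ← lie_skew, lie_e_f_ne A hij, neg_zero]
  · intro j
    exact (LieSubalgebra.mem_engel_iff ℂ _ _).2 ⟨(-A i j).toNat + 1, by
      simpa [pow_succ] using serre_f A i j⟩

theorem ad_neg_f_locNilp (i : I) (x : KM A) :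
    ∃ n : ℕ, ((LieAlgebra.ad ℂ (KM A) (-f A i)) ^ n) x = 0 :=
  (ad_f_locNilp A i x).imp fun _ hn => ad_neg_pow hn

/-- `Ad(m_i) = exp(ad e_i) exp(ad (-f_i)) exp(ad e_i)`. -/
def AdM (i : I) : Module.End ℂ (KM A) :=
  expLocNilp (LieAlgebra.ad ℂ (KM A) (e A i)) (ad_e_locNilp A i) *
    expLocNilp (LieAlgebra.ad ℂ (KM A) (-f A i)) (ad_neg_f_locNilp A i) *
    expLocNilp (LieAlgebra.ad ℂ (KM A) (e A i)) (ad_e_locNilp A i)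

/-- `Ad(m_w) = Ad(m_{i_1}) ⋯ Ad(m_{i_ℓ})` for a reduced word `(i_1, …, i_ℓ)` of `w`. -/
def AdWord (l : List I) : Module.End ℂ (KM A) := (l.map (AdM A)).prod

/-- `θ = Ad(m_{w_X}) τ ω`, where `l` is a reduced expression of `w_X`. -/
def theta (τ : Equiv.Perm I) (hτ : IsDiagramAut A τ) (l : List I) : KM A →ₗ[ℂ] KM A :=
  AdWord A l ∘ₗ (diagramHom A τ hτ : KM A →ₗ[ℂ] KM A) ∘ₗ (chevalley A : KM A →ₗ[ℂ] KM A)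

/-! ### The subalgebras -/

/-- `𝔫⁻ = ⟨f_i⟩_{i ∈ I}`. -/
def nMinus : LieSubalgebra ℂ (KM A) := LieSubalgebra.lieSpan ℂ (KM A) (Set.range (f A))

/-- `𝔫⁺_X = ⟨e_i⟩_{i ∈ X}`. -/
def nPlus (X : Finset I) : LieSubalgebra ℂ (KM A) :=
  LieSubalgebra.lieSpan ℂ (KM A) (e A '' (X : Set I))

/-- The Cartan subalgebra `𝔥`, spanned by the `h_i`. -/
def cartan : Submodule ℂ (KM A) := Submodule.span ℂ (Set.range (h A))

/-- The fixed points `V^θ` of a linear map `θ` in a subspace `V`. -/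
def fixedIn {V : Type*} [AddCommGroup V] [Module ℂ V] (U : Submodule ℂ V) (θ : V →ₗ[ℂ] V) :
    Submodule ℂ V :=
  U ⊓ LinearMap.eqLocus θ LinearMap.id

/-- The generators `g_i`: `f_i` for `i ∈ X` and `f_i + c_i θ(f_i)` otherwise. -/
def gGen (X : Finset I) (θ : KM A →ₗ[ℂ] KM A) (c : I → ℂ) (i : I) : KM A :=
  if i ∈ X then f A i else f A i + c i • θ (f A i)

/-- `𝔨_c = ⟨𝔫⁺_X, 𝔥^θ, g_i (i ∈ I)⟩`. -/
def kSub (X : Finset I) (θ : KM A →ₗ[ℂ] KM A) (c : I → ℂ) : LieSubalgebra ℂ (KM A) :=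
  LieSubalgebra.lieSpan ℂ (KM A)
    ((nPlus A X : Set (KM A)) ∪ (fixedIn (cartan A) θ : Set (KM A)) ∪ Set.range (gGen A X θ c))

/-- The iterated bracket `[x_{i_1}, [x_{i_2}, …, [x_{i_{ℓ-1}}, x_{i_ℓ}]…]]` of a nonempty word
(the value at the empty word is irrelevant). -/
def iterBracket {L : Type*} [LieRing L] (x : I → L) : List I → L
  | [] => 0
  | [i] => x i
  | i :: j :: l => ⁅x i, iterBracket x (j :: l)⁆

/-- The family of subspaces `𝔫⁺_X`, `𝔥^θ` and `ℂ g_w` for `w ∈ J`. -/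
def summand (X : Finset I) (θ : KM A →ₗ[ℂ] KM A) (c : I → ℂ) (J : Set (List I)) :
    Fin 2 ⊕ J → Submodule ℂ (KM A) :=
  Sum.elim ![(nPlus A X).toSubmodule, fixedIn (cartan A) θ]
    fun w => Submodule.span ℂ {iterBracket (gGen A X θ c) w}

end Algebra

end KacMoody

end

/-! For `j ∉ X` the element `θ(f_j)` has weight `α_{τ(j)} + γ_j`, with `γ_j` a nonnegative sum
of roots `α_k`, `k ∈ X`, so `g_j` is `f_j` plus a term of positive height. Hence the leading term of
`g_w` with respect to height is `f_w`, and the `g_w` with `w ∈ J` are linearly independent modulo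
`𝔫⁺_X + 𝔥`.

For the spanning property, filter `𝔨_c` by the length of words in the `g_i`, with `𝔫⁺_X + 𝔥^θ` in
degree `0`. The conditions on `(X, τ)` and `c` force `ad(g_i)^{1 - a_ij}(g_j)` into degree
`1 - a_ij`, one less than the length of the words in it. All relations between the `f_i` follow from
the Serre relations, so every linear relation between words in the `f_i` holds for the `g_i` up to
shorter words. -/

noncomputable section

namespace KacMoody

/-! ### Generation and grading in Lie algebras -/

section LieSpan

variable {R L : Type*} [CommRing R] [LieRing L] [LieAlgebra R L]

theorem lieSpan_le_of_stable {S : Set L} {V : Submodule R L} (hS : S ⊆ V)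
    (hV : ∀ s ∈ S, V ≤ V.comap (LieAlgebra.ad R L s)) :
    (LieSubalgebra.lieSpan R L S).toSubmodule ≤ V := by
  suffices key : ∀ x ∈ LieSubalgebra.lieSpan R L S, x ∈ V ∧ ∀ v ∈ V, ⁅x, v⁆ ∈ V from
    fun x hx => (key x hx).1
  intro x hx
  induction hx using LieSubalgebra.lieSpan_induction with
  | mem x hx => exact ⟨hS hx, hV x hx⟩
  | zero => exact ⟨V.zero_mem, fun v _ => by rw [zero_lie]; exact V.zero_mem⟩
  | add x y _ _ hx hy =>
    exact ⟨V.add_mem hx.1 hy.1, fun v hv => by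
      rw [add_lie]; exact V.add_mem (hx.2 v hv) (hy.2 v hv)⟩
  | smul a x _ hx =>
    exact ⟨V.smul_mem a hx.1, fun v hv => by rw [smul_lie]; exact V.smul_mem a (hx.2 v hv)⟩
  | lie x y _ _ hx hy =>
    exact ⟨hx.2 y hy.1, fun v hv => by
      rw [lie_lie]; exact V.sub_mem (hx.2 _ (hy.2 v hv)) (hy.2 _ (hx.2 v hv))⟩

theorem lie_mem_of_mem_span {x v : L} {s : Set L} {V : Submodule R L}
    (hs : ∀ v ∈ s, ⁅x, v⁆ ∈ V) (hv : v ∈ Submodule.span R s) : ⁅x, v⁆ ∈ V :=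
  (Submodule.span_le (p := V.comap (LieAlgebra.ad R L x))).2 hs hv

theorem lie_mem_lieSpan {S : Set L} {t y : L} (hS : ∀ s ∈ S, ⁅t, s⁆ ∈ LieSubalgebra.lieSpan R L S)
    (hy : y ∈ LieSubalgebra.lieSpan R L S) : ⁅t, y⁆ ∈ LieSubalgebra.lieSpan R L S := by
  induction hy using LieSubalgebra.lieSpan_induction with
  | mem s hs => exact hS s hs
  | zero => rw [lie_zero]; exact LieSubalgebra.zero_mem _
  | add y z _ _ hy hz => rw [lie_add]; exact LieSubalgebra.add_mem _ hy hz
  | smul a y _ hy => rw [lie_smul]; exact LieSubalgebra.smul_mem _ a hy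
  | lie y z hy hz hy' hz' =>
    rw [leibniz_lie]
    exact LieSubalgebra.add_mem _ (LieSubalgebra.lie_mem _ hy' hz) (LieSubalgebra.lie_mem _ hy hz')

theorem lie_mem_sup_lieSpan {S : Set L} {H : Submodule R L} {x y : L}
    (hH : ∀ t ∈ H, ∀ s ∈ S, ⁅t, s⁆ ∈ LieSubalgebra.lieSpan R L S) (hx : ∀ s ∈ S, ⁅x, s⁆ ∈ H)
    (hy : y ∈ LieSubalgebra.lieSpan R L S) :
    ⁅x, y⁆ ∈ H ⊔ (LieSubalgebra.lieSpan R L S).toSubmodule := by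
  have absorb : ∀ u ∈ H ⊔ (LieSubalgebra.lieSpan R L S).toSubmodule,
      ∀ z ∈ LieSubalgebra.lieSpan R L S, ⁅u, z⁆ ∈ LieSubalgebra.lieSpan R L S := by
    intro u hu z hz
    obtain ⟨t, ht, v, hv, rfl⟩ := Submodule.mem_sup.1 hu
    rw [add_lie]
    exact LieSubalgebra.add_mem _ (lie_mem_lieSpan (hH t ht) hz) (LieSubalgebra.lie_mem _ hv hz)
  induction hy using LieSubalgebra.lieSpan_induction with
  | mem s hs => exact Submodule.mem_sup_left (hx s hs)
  | zero => rw [lie_zero]; exact Submodule.zero_mem _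
  | add y z _ _ hy hz => rw [lie_add]; exact Submodule.add_mem _ hy hz
  | smul a y _ hy => rw [lie_smul]; exact Submodule.smul_mem _ a hy
  | lie y z hy hz hy' hz' =>
    rw [leibniz_lie, ← lie_skew y]
    exact Submodule.mem_sup_right <| Submodule.add_mem _ (absorb _ hy' z hz)
      (Submodule.neg_mem _ (absorb _ hz' y hy))

theorem ad_smul_pow_apply (a : R) (x y : L) (n : ℕ) :
    (LieAlgebra.ad R L (a • x) ^ n) y = a ^ n • (LieAlgebra.ad R L x ^ n) y := by
  rw [map_smul, smul_pow, LinearMap.smul_apply]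

theorem lie_mem_comm {V : Submodule R L} {x y : L} : ⁅x, y⁆ ∈ V ↔ ⁅y, x⁆ ∈ V := by
  rw [← lie_skew, neg_mem_iff]

theorem lie_eq_zero_of_mem_lieSpan {S : Set L} {x y : L} (hS : ∀ s ∈ S, ⁅s, y⁆ = 0)
    (hx : x ∈ LieSubalgebra.lieSpan R L S) : ⁅x, y⁆ = 0 := by
  induction hx using LieSubalgebra.lieSpan_induction with
  | mem x hx => exact hS x hx
  | zero => exact zero_lie _
  | add x z _ _ hx hz => rw [add_lie, hx, hz, add_zero]
  | smul a x _ hx => rw [smul_lie, hx, smul_zero]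
  | lie x z _ _ hx hz => rw [lie_lie, hx, hz, lie_zero, lie_zero, sub_zero]

end LieSpan

section IterBracket

variable {I R L : Type*} [CommRing R] [LieRing L]

theorem iterBracket_cons (x : I → L) (i : I) {w : List I} (hw : w ≠ []) :
    iterBracket x (i :: w) = ⁅x i, iterBracket x w⁆ := by
  cases w with
  | nil => exact absurd rfl hw
  | cons j w => rfl

theorem map_iterBracket {L' : Type*} [LieRing L'] {ψ : L → L'}
    (hψ : ∀ x y, ψ ⁅x, y⁆ = ⁅ψ x, ψ y⁆) (x : I → L) {w : List I} (hw : w ≠ []) :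
    ψ (iterBracket x w) = iterBracket (fun i => ψ (x i)) w := by
  induction w, hw using List.recNeNil with
  | singleton i => rfl
  | cons i w hw ih => rw [iterBracket_cons _ _ hw, iterBracket_cons _ _ hw, hψ, ih]

theorem iterBracket_mem_lieSubalgebra [LieAlgebra R L] {x : I → L} {S : LieSubalgebra R L}
    {w : List I} (hw : w ≠ []) (hx : ∀ i ∈ w, x i ∈ S) : iterBracket x w ∈ S := by
  induction w, hw using List.recNeNil with
  | singleton i => exact hx i (List.mem_singleton_self i)
  | cons i w hw ih =>
    rw [iterBracket_cons _ _ hw]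
    exact S.lie_mem (hx i List.mem_cons_self) (ih fun j hj => hx j (List.mem_cons_of_mem i hj))

theorem lieSpan_image_eq_span_iterBracket [LieAlgebra R L] (x : I → L) (Y : Set I) :
    (LieSubalgebra.lieSpan R L (x '' Y)).toSubmodule =
      Submodule.span R (iterBracket x '' {w | w ≠ [] ∧ ∀ i ∈ w, i ∈ Y}) := by
  apply le_antisymm
  · refine lieSpan_le_of_stable ?_ ?_
    · rintro _ ⟨i, hi, rfl⟩
      exact Submodule.subset_span ⟨[i], by simpa using hi, rfl⟩
    · rintro _ ⟨i, hi, rfl⟩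
      refine Submodule.span_le.2 ?_
      rintro _ ⟨w, ⟨hw, hwY⟩, rfl⟩
      rw [SetLike.mem_coe, Submodule.mem_comap, LieAlgebra.ad_apply, ← iterBracket_cons x i hw]
      exact Submodule.subset_span
        ⟨i :: w, ⟨List.cons_ne_nil i w, List.forall_mem_cons.2 ⟨hi, hwY⟩⟩, rfl⟩
  · refine Submodule.span_le.2 ?_
    rintro _ ⟨w, ⟨hw, hwY⟩, rfl⟩
    exact iterBracket_mem_lieSubalgebra hw fun i hi =>
      LieSubalgebra.subset_lieSpan ⟨i, hwY i hi, rfl⟩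

theorem lieSpan_range_eq_span_iterBracket [LieAlgebra R L] (x : I → L) :
    (LieSubalgebra.lieSpan R L (Set.range x)).toSubmodule =
      Submodule.span R (iterBracket x '' {w | w ≠ []}) := by
  simpa using lieSpan_image_eq_span_iterBracket (R := R) x Set.univ

theorem lie_iterBracket_of_lie_eq_smul [LieAlgebra R L] {x : I → L} {t : L} {a : I → R}
    (hx : ∀ i, ⁅t, x i⁆ = a i • x i) {w : List I} (hw : w ≠ []) :
    ⁅t, iterBracket x w⁆ = (w.map a).sum • iterBracket x w := by
  induction w, hw using List.recNeNil with
  | singleton i => simpa [iterBracket] using hx i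
  | cons i w hw ih =>
    rw [iterBracket_cons _ _ hw, leibniz_lie, hx, ih, smul_lie, lie_smul, ← add_smul,
      List.map_cons, List.sum_cons]

theorem iterBracket_replicate_eq_zero (x : I → L) (j : I) (n : ℕ) :
    iterBracket x (List.replicate (n + 2) j) = 0 := by
  induction n with
  | zero => exact lie_self (x j)
  | succ n ih => rw [List.replicate_succ, iterBracket_cons _ _ (by simp), ih, lie_zero]

end IterBracket

theorem inf_iSup_eq_of_iSupIndep {α ι : Type*} [CompleteLattice α] [IsModularLattice α]
    {E V : ι → α} (hE : iSupIndep E) (hV : V ≤ E) (k : ι) : E k ⊓ ⨆ j, V j = V k := by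
  apply le_antisymm _ (le_inf (hV k) (le_iSup V k))
  have split : ⨆ j, V j ≤ V k ⊔ ⨆ (j) (_ : j ≠ k), E j := by
    refine iSup_le fun j => ?_
    obtain rfl | hj := eq_or_ne j k
    · exact le_sup_left
    · exact le_sup_of_le_right (le_iSup₂_of_le j hj (hV j))
  calc E k ⊓ ⨆ j, V j ≤ (V k ⊔ ⨆ (j) (_ : j ≠ k), E j) ⊓ E k := by
        rw [inf_comm]; exact inf_le_inf_right _ split
    _ = V k := by rw [sup_inf_assoc_of_le _ (hV k), (hE k).symm.eq_bot, sup_bot_eq]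

/-! ### The Kac-Moody algebra and its root spaces -/

section Generators

variable {I : Type*} [DecidableEq I]

section Lift

variable {A : Matrix I I ℤ} {L : Type*} [LieRing L] [LieAlgebra ℂ L] {e' f' h' : I → L}
  (hhh : ∀ i j, ⁅h' i, h' j⁆ = 0)
  (hef : ∀ i, ⁅e' i, f' i⁆ = h' i)
  (hef' : ∀ i j, i ≠ j → ⁅e' i, f' j⁆ = 0)
  (hhe : ∀ i j, ⁅h' i, e' j⁆ = A i j • e' j)
  (hhf : ∀ i j, ⁅h' i, f' j⁆ = -(A i j • f' j))
  (hse : ∀ i j, ((LieAlgebra.ad ℂ L (e' i)) ^ (-A i j).toNat) ⁅e' i, e' j⁆ = 0)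
  (hsf : ∀ i j, ((LieAlgebra.ad ℂ L (f' i)) ^ (-A i j).toNat) ⁅f' i, f' j⁆ = 0)

theorem lift_e (i : I) : lift A e' f' h' hhh hef hef' hhe hhf hse hsf (e A i) = e' i :=
  FreeLieAlgebra.lift_of_apply ..

theorem lift_f (i : I) : lift A e' f' h' hhh hef hef' hhe hhf hse hsf (f A i) = f' i :=
  FreeLieAlgebra.lift_of_apply ..

theorem lift_h (i : I) : lift A e' f' h' hhh hef hef' hhe hhf hse hsf (h A i) = h' i :=
  FreeLieAlgebra.lift_of_apply ..

theorem hom_ext {φ ψ : KM A →ₗ⁅ℂ⁆ L} (he : ∀ i, φ (e A i) = ψ (e A i))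
    (hf : ∀ i, φ (f A i) = ψ (f A i)) (hh : ∀ i, φ (h A i) = ψ (h A i)) : φ = ψ := by
  let S : LieSubalgebra ℂ (KM A) :=
    { LinearMap.eqLocus (φ : KM A →ₗ[ℂ] L) (ψ : KM A →ₗ[ℂ] L) with
      lie_mem' := by
        intro x y (hx : φ x = ψ x) (hy : φ y = ψ y)
        change φ ⁅x, y⁆ = ψ ⁅x, y⁆
        rw [LieHom.map_lie, LieHom.map_lie, hx, hy] }
  ext x
  exact mem_of_generators A S he hf hh x

end Lift

variable (A : Matrix I I ℤ)

theorem chevalley_e (i : I) : chevalley A (e A i) = -f A i := lift_e ..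

theorem chevalley_f (i : I) : chevalley A (f A i) = -e A i := lift_f ..

theorem chevalley_h (i : I) : chevalley A (h A i) = -h A i := lift_h ..

theorem chevalley_chevalley (x : KM A) : chevalley A (chevalley A x) = x :=
  LieHom.congr_fun (f := (chevalley A).comp (chevalley A)) (g := LieHom.id)
    (hom_ext (fun i => by simp [chevalley_e, chevalley_f])
      (fun i => by simp [chevalley_e, chevalley_f]) (fun i => by simp [chevalley_h])) x

theorem diagramHom_e (σ : Equiv.Perm I) (hσ : IsDiagramAut A σ) (i : I) :
    diagramHom A σ hσ (e A i) = e A (σ i) := lift_e ..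

theorem diagramHom_f (σ : Equiv.Perm I) (hσ : IsDiagramAut A σ) (i : I) :
    diagramHom A σ hσ (f A i) = f A (σ i) := lift_f ..

theorem diagramHom_h (σ : Equiv.Perm I) (hσ : IsDiagramAut A σ) (i : I) :
    diagramHom A σ hσ (h A i) = h A (σ i) := lift_h ..

theorem lie_h_e_eq_smul (i j : I) : ⁅h A i, e A j⁆ = (A i j : ℂ) • e A j := by
  rw [lie_h_e, Int.cast_smul_eq_zsmul]

theorem lie_h_f_eq_smul (i j : I) : ⁅h A i, f A j⁆ = (-A i j : ℂ) • f A j := by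
  rw [lie_h_f, neg_smul, Int.cast_smul_eq_zsmul]

theorem lie_e_h_eq_smul (i j : I) : ⁅e A i, h A j⁆ = (-A j i : ℂ) • e A i := by
  rw [← lie_skew, lie_h_e_eq_smul, neg_smul]

theorem lie_f_h_eq_smul (i j : I) : ⁅f A i, h A j⁆ = (A j i : ℂ) • f A i := by
  rw [← lie_skew, lie_h_f_eq_smul, neg_smul, neg_neg]

theorem lie_e_f (i j : I) : ⁅e A i, f A j⁆ = if i = j then h A i else 0 := by
  split_ifs with hij
  · rw [← hij, lie_e_f_same]
  · rw [lie_e_f_ne A hij]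

theorem lie_f_e (i j : I) : ⁅f A i, e A j⁆ = if i = j then -h A i else 0 := by
  rw [← lie_skew, lie_e_f]
  split_ifs with hji hij hij
  · rw [hij]
  · exact absurd hji.symm hij
  · exact absurd hij.symm hji
  · exact neg_zero

theorem h_mem_cartan (i : I) : h A i ∈ cartan A := Submodule.subset_span ⟨i, rfl⟩

theorem f_mem_nMinus (i : I) : f A i ∈ nMinus A := LieSubalgebra.subset_lieSpan ⟨i, rfl⟩

variable {A} in
theorem e_mem_nPlus {X : Finset I} {i : I} (hi : i ∈ X) : e A i ∈ nPlus A X :=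
  LieSubalgebra.subset_lieSpan ⟨i, hi, rfl⟩

theorem lie_e_mem_cartan (i j : I) : ⁅e A i, f A j⁆ ∈ cartan A := by
  rw [lie_e_f]
  split_ifs
  exacts [h_mem_cartan A i, zero_mem _]

theorem lie_f_mem_cartan (i j : I) : ⁅f A i, e A j⁆ ∈ cartan A := by
  rw [← lie_skew]
  exact neg_mem (lie_e_mem_cartan A j i)

variable {A} in
theorem lie_mem_of_mem_cartan {t x : KM A} {V : Submodule ℂ (KM A)} (ht : t ∈ cartan A)
    (hV : ∀ i, ⁅h A i, x⁆ ∈ V) : ⁅t, x⁆ ∈ V := by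
  rw [← lie_skew]
  refine V.neg_mem (lie_mem_of_mem_span ?_ ht)
  rintro _ ⟨i, rfl⟩
  rw [← lie_skew]
  exact V.neg_mem (hV i)

variable {A} in
theorem lie_eq_zero_of_mem_cartan {s t : KM A} (hs : s ∈ cartan A) (ht : t ∈ cartan A) :
    ⁅s, t⁆ = 0 := by
  rw [← Submodule.mem_bot ℂ]
  refine lie_mem_of_mem_cartan hs fun i => lie_mem_of_mem_span ?_ ht
  rintro _ ⟨j, rfl⟩
  exact lie_h_h A i j

variable {A} in
theorem lie_e_mem_lieSpan_of_mem_cartan {t : KM A} (ht : t ∈ cartan A) {Y : Set I} {i : I}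
    (hi : i ∈ Y) : ⁅t, e A i⁆ ∈ LieSubalgebra.lieSpan ℂ (KM A) (e A '' Y) :=
  lie_mem_of_mem_cartan (V := (LieSubalgebra.lieSpan ℂ (KM A) (e A '' Y)).toSubmodule) ht
    fun k => by
      rw [lie_h_e_eq_smul]
      exact Submodule.smul_mem _ _ (LieSubalgebra.subset_lieSpan ⟨i, hi, rfl⟩)

variable {A} in
theorem lie_f_mem_nMinus_of_mem_cartan {t : KM A} (ht : t ∈ cartan A) (i : I) :
    ⁅t, f A i⁆ ∈ nMinus A :=
  lie_mem_of_mem_cartan (V := (nMinus A).toSubmodule) ht fun k => by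
    rw [lie_h_f_eq_smul]
    exact Submodule.smul_mem _ _ (f_mem_nMinus A i)

theorem mem_lieSpan_e_union_f (x : KM A) :
    x ∈ LieSubalgebra.lieSpan ℂ (KM A) (Set.range (e A) ∪ Set.range (f A)) := by
  have he (i : I) : e A i ∈ LieSubalgebra.lieSpan ℂ (KM A) (Set.range (e A) ∪ Set.range (f A)) :=
    LieSubalgebra.subset_lieSpan (.inl ⟨i, rfl⟩)
  have hf (i : I) : f A i ∈ LieSubalgebra.lieSpan ℂ (KM A) (Set.range (e A) ∪ Set.range (f A)) :=
    LieSubalgebra.subset_lieSpan (.inr ⟨i, rfl⟩)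
  refine mem_of_generators A _ he hf (fun i => ?_) x
  rw [← lie_e_f_same]
  exact LieSubalgebra.lie_mem _ (he i) (hf i)

theorem lieSpan_e_sup_cartan_sup_nMinus :
    (LieSubalgebra.lieSpan ℂ (KM A) (Set.range (e A))).toSubmodule ⊔ cartan A ⊔
      (nMinus A).toSubmodule = ⊤ := by
  set N := LieSubalgebra.lieSpan ℂ (KM A) (Set.range (e A)) with hN
  have he (i : I) : e A i ∈ N := LieSubalgebra.subset_lieSpan ⟨i, rfl⟩
  have lie_cartan_e : ∀ t ∈ cartan A, ∀ s ∈ Set.range (e A), ⁅t, s⁆ ∈ N := by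
    rintro t ht _ ⟨i, rfl⟩
    rw [hN, ← Set.image_univ]
    exact lie_e_mem_lieSpan_of_mem_cartan ht (Set.mem_univ i)
  have lie_cartan_f : ∀ t ∈ cartan A, ∀ s ∈ Set.range (f A), ⁅t, s⁆ ∈ nMinus A := by
    rintro t ht _ ⟨i, rfl⟩
    exact lie_f_mem_nMinus_of_mem_cartan ht i
  set V := N.toSubmodule ⊔ cartan A ⊔ (nMinus A).toSubmodule
  have hNV : N.toSubmodule ≤ V := le_sup_of_le_left le_sup_left
  have hcartanV : cartan A ≤ V := le_sup_of_le_left le_sup_right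
  have hnMinusV : (nMinus A).toSubmodule ≤ V := le_sup_right
  have lieSpan_le : (LieSubalgebra.lieSpan ℂ (KM A)
      (Set.range (e A) ∪ Set.range (f A))).toSubmodule ≤ V := by
    refine lieSpan_le_of_stable ?_ ?_
    · rintro _ (⟨i, rfl⟩ | ⟨i, rfl⟩)
      exacts [hNV (he i), hnMinusV (f_mem_nMinus A i)]
    · rintro _ (⟨i, rfl⟩ | ⟨i, rfl⟩) <;>
        refine sup_le (sup_le (fun y hy => ?_) fun t ht => ?_) fun z hz => ?_
      · exact hNV (N.lie_mem (he i) hy)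
      · rw [Submodule.mem_comap, LieAlgebra.ad_apply, ← lie_skew]
        exact V.neg_mem (hNV (lie_cartan_e t ht _ ⟨i, rfl⟩))
      · refine sup_le hcartanV hnMinusV (lie_mem_sup_lieSpan (x := e A i) lie_cartan_f ?_ hz)
        exact Set.forall_mem_range.2 (lie_e_mem_cartan A i)
      · refine sup_le hcartanV hNV (lie_mem_sup_lieSpan (x := f A i) lie_cartan_e ?_ hy)
        exact Set.forall_mem_range.2 (lie_f_mem_cartan A i)
      · rw [Submodule.mem_comap, LieAlgebra.ad_apply, ← lie_skew]
        exact V.neg_mem (hnMinusV (lie_f_mem_nMinus_of_mem_cartan ht i))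
      · exact hnMinusV ((nMinus A).lie_mem (f_mem_nMinus A i) hz)
  exact eq_top_iff.2 fun x _ => lieSpan_le (mem_lieSpan_e_union_f A x)

end Generators

theorem two_zpow_injective {I : Type*} :
    Function.Injective fun (β : I → ℤ) (k : I) => (2 : ℂ) ^ β k := by
  intro β γ hβγ
  funext k
  have hnorm : (2 : ℝ) ^ β k = (2 : ℝ) ^ γ k := by
    simpa only [norm_zpow, Complex.norm_ofNat] using congrArg norm (congrFun hβγ k)
  exact zpow_right_injective₀ (by norm_num) (by norm_num) hnorm

section RootSpaces

variable {I : Type*} [DecidableEq I] (A : Matrix I I ℤ)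

/-- The automorphism multiplying the root space of `β` by `2 ^ β k`. As `2` has infinite order, the
eigenvalues of these automorphisms determine `β`, while those of the `ad h_i` need not, since `A`
may be singular. -/
def scale (k : I) : KM A →ₗ⁅ℂ⁆ KM A :=
  lift A (fun j => (2 : ℂ) ^ (simpleRoot j k) • e A j)
    (fun j => (2 : ℂ) ^ (-simpleRoot j k) • f A j) (h A)
    (lie_h_h A)
    (by
      intro i
      rw [smul_lie, lie_smul, smul_smul, ← zpow_add₀ two_ne_zero, add_neg_cancel, zpow_zero,
        one_smul, lie_e_f_same])
    (by intro i j hij; rw [smul_lie, lie_smul, lie_e_f_ne A hij, smul_zero, smul_zero])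
    (by intro i j; rw [lie_smul, lie_h_e, smul_comm])
    (by intro i j; rw [lie_smul, lie_h_f, smul_neg, smul_comm])
    (by
      intro i j
      rw [smul_lie, lie_smul, map_smul, map_smul, ad_smul_pow_apply, serre_e, smul_zero, smul_zero,
        smul_zero])
    (by
      intro i j
      rw [smul_lie, lie_smul, map_smul, map_smul, ad_smul_pow_apply, serre_f, smul_zero, smul_zero,
        smul_zero])

/-- The root space of weight `β`, as a joint eigenspace of the automorphisms `scale`; the root
space of weight `0` is the Cartan subalgebra. -/
def rootSpace (β : I → ℤ) : Submodule ℂ (KM A) :=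
  ⨅ k, Module.End.eigenspace (scale A k : KM A →ₗ[ℂ] KM A) ((2 : ℂ) ^ β k)

theorem scale_e (k j : I) : scale A k (e A j) = (2 : ℂ) ^ simpleRoot j k • e A j := lift_e ..

theorem scale_f (k j : I) : scale A k (f A j) = (2 : ℂ) ^ (-simpleRoot j k) • f A j := lift_f ..

theorem scale_h (k j : I) : scale A k (h A j) = h A j := lift_h ..

variable {A}

theorem mem_rootSpace {β : I → ℤ} {x : KM A} :
    x ∈ rootSpace A β ↔ ∀ k, scale A k x = (2 : ℂ) ^ β k • x := by
  simp [rootSpace, Submodule.mem_iInf]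

theorem lie_mem_rootSpace {β γ : I → ℤ} {x y : KM A} (hx : x ∈ rootSpace A β)
    (hy : y ∈ rootSpace A γ) : ⁅x, y⁆ ∈ rootSpace A (β + γ) := by
  rw [mem_rootSpace] at *
  intro k
  rw [LieHom.map_lie, hx, hy, smul_lie, lie_smul, smul_smul, ← zpow_add₀ two_ne_zero, Pi.add_apply]

variable (A) in
theorem e_mem_rootSpace (j : I) : e A j ∈ rootSpace A (simpleRoot j) :=
  mem_rootSpace.2 fun k => scale_e A k j

variable (A) in
theorem f_mem_rootSpace (j : I) : f A j ∈ rootSpace A (-simpleRoot j) :=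
  mem_rootSpace.2 fun k => scale_f A k j

variable (A) in
theorem h_mem_rootSpace (j : I) : h A j ∈ rootSpace A 0 :=
  mem_rootSpace.2 fun k => by rw [scale_h, Pi.zero_apply, zpow_zero, one_smul]

variable (A) in
theorem cartan_le_rootSpace_zero : cartan A ≤ rootSpace A 0 :=
  Submodule.span_le.2 (Set.range_subset_iff.2 (h_mem_rootSpace A))

variable (A) in
theorem commute_scale (i j : I) :
    Commute (scale A i : KM A →ₗ[ℂ] KM A) (scale A j : KM A →ₗ[ℂ] KM A) := by
  have : (scale A i).comp (scale A j) = (scale A j).comp (scale A i) := by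
    refine hom_ext (fun k => ?_) (fun k => ?_) (fun k => ?_)
    · simp only [LieHom.comp_apply, scale_e, map_smul]
      rw [smul_comm]
    · simp only [LieHom.comp_apply, scale_f, map_smul]
      rw [smul_comm]
    · simp only [LieHom.comp_apply, scale_h]
  exact LinearMap.ext fun x => LieHom.congr_fun this x

variable (A) in
theorem iSupIndep_rootSpace : iSupIndep (rootSpace A) := by
  have indep := Module.End.independent_iInf_maxGenEigenspace_of_forall_mapsTo
    (fun k => (scale A k : KM A →ₗ[ℂ] KM A))
    (fun i j φ => Module.End.mapsTo_maxGenEigenspace_of_comm (commute_scale A j i) φ)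
  exact (indep.comp two_zpow_injective).mono fun β =>
    iInf_mono fun k => Module.End.eigenspace_le_maxGenEigenspace

end RootSpaces

section Words

variable {I : Type*} [DecidableEq I]

/-- The weight `α_{i_1} + ⋯ + α_{i_ℓ}` of a word `(i_1, …, i_ℓ)`. -/
def wordWeight (w : List I) : I → ℤ := (w.map simpleRoot).sum

theorem wordWeight_cons (i : I) (w : List I) :
    wordWeight (i :: w) = simpleRoot i + wordWeight w := by
  simp [wordWeight]

theorem wordWeight_singleton (i : I) : wordWeight [i] = simpleRoot i := by
  simp [wordWeight]

theorem wordWeight_apply (w : List I) (k : I) : wordWeight w k = w.count k := by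
  induction w with
  | nil => simp [wordWeight]
  | cons i w ih =>
    rw [wordWeight_cons, Pi.add_apply, ih, List.count_cons, simpleRoot, Pi.single_apply]
    by_cases hik : i = k
    · subst hik; simp [add_comm]
    · simp [hik, Ne.symm hik]

theorem wordWeight_nonneg (w : List I) : 0 ≤ wordWeight w := by
  intro k
  rw [wordWeight_apply]
  exact Int.natCast_nonneg _

theorem wordWeight_eq_iff_perm {w w' : List I} : wordWeight w = wordWeight w' ↔ w.Perm w' := by
  simp only [funext_iff, wordWeight_apply, Nat.cast_inj, List.perm_iff_count]

theorem wordWeight_ne_zero {w : List I} (hw : w ≠ []) : wordWeight w ≠ 0 := fun h0 =>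
  hw (List.perm_nil.1 (wordWeight_eq_iff_perm.1 (h0.trans (by simp [wordWeight]))))

theorem notMem_of_wordWeight_eq_zero {w : List I} {k : I} (hk : wordWeight w k = 0) : k ∉ w := by
  rwa [wordWeight_apply, Nat.cast_eq_zero, List.count_eq_zero] at hk

variable {A : Matrix I I ℤ}

theorem iterBracket_mem_rootSpace {x : I → KM A} (φ : (I → ℤ) →+ (I → ℤ))
    (hx : ∀ i, x i ∈ rootSpace A (φ (simpleRoot i))) {w : List I} (hw : w ≠ []) :
    iterBracket x w ∈ rootSpace A (φ (wordWeight w)) := by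
  induction w, hw using List.recNeNil with
  | singleton i => rw [wordWeight_singleton]; exact hx i
  | cons i w hw ih =>
    rw [iterBracket_cons _ _ hw, wordWeight_cons, map_add]
    exact lie_mem_rootSpace (hx i) ih

theorem iterBracket_e_mem_rootSpace {w : List I} (hw : w ≠ []) :
    iterBracket (e A) w ∈ rootSpace A (wordWeight w) :=
  iterBracket_mem_rootSpace (AddMonoidHom.id _) (e_mem_rootSpace A) hw

theorem iterBracket_f_mem_rootSpace {w : List I} (hw : w ≠ []) :
    iterBracket (f A) w ∈ rootSpace A (-wordWeight w) :=
  iterBracket_mem_rootSpace (-AddMonoidHom.id _) (f_mem_rootSpace A) hw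

variable (A) in
/-- The monomials `e_w`, `h_i`, `f_w` of weight `μ`, which span the root space of weight `μ`. -/
def monomials (μ : I → ℤ) : Set (KM A) :=
  {x | (∃ w, w ≠ [] ∧ wordWeight w = μ ∧ iterBracket (e A) w = x) ∨
    (μ = 0 ∧ x ∈ Set.range (h A)) ∨
    (∃ w, w ≠ [] ∧ -wordWeight w = μ ∧ iterBracket (f A) w = x)}

variable (A) in
theorem iSup_span_monomials : ⨆ μ, Submodule.span ℂ (monomials A μ) = ⊤ := by
  have mem_iSup {μ : I → ℤ} {x : KM A} (hx : x ∈ monomials A μ) :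
      x ∈ ⨆ μ, Submodule.span ℂ (monomials A μ) :=
    Submodule.mem_iSup_of_mem μ (Submodule.subset_span hx)
  rw [eq_top_iff, ← lieSpan_e_sup_cartan_sup_nMinus A, nMinus, lieSpan_range_eq_span_iterBracket,
    lieSpan_range_eq_span_iterBracket]
  refine sup_le (sup_le ?_ ?_) ?_ <;> refine Submodule.span_le.2 ?_
  · rintro _ ⟨w, hw, rfl⟩
    exact mem_iSup (.inl ⟨w, hw, rfl, rfl⟩)
  · exact fun x hx => mem_iSup (.inr (.inl ⟨rfl, hx⟩))
  · rintro _ ⟨w, hw, rfl⟩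
    exact mem_iSup (.inr (.inr ⟨w, hw, rfl, rfl⟩))

theorem span_monomials_le_rootSpace (μ : I → ℤ) :
    Submodule.span ℂ (monomials A μ) ≤ rootSpace A μ := by
  refine Submodule.span_le.2 ?_
  rintro x (⟨w, hw, rfl, rfl⟩ | ⟨rfl, i, rfl⟩ | ⟨w, hw, rfl, rfl⟩)
  exacts [iterBracket_e_mem_rootSpace hw, h_mem_rootSpace A i, iterBracket_f_mem_rootSpace hw]

theorem rootSpace_eq_span_monomials (μ : I → ℤ) :
    rootSpace A μ = Submodule.span ℂ (monomials A μ) := by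
  simpa only [iSup_span_monomials, inf_top_eq] using
    inf_iSup_eq_of_iSupIndep (iSupIndep_rootSpace A) span_monomials_le_rootSpace μ

theorem map_mem_rootSpace (ψ : KM A →ₗ⁅ℂ⁆ KM A) (φ : (I → ℤ) →+ (I → ℤ))
    (he : ∀ i, ψ (e A i) ∈ rootSpace A (φ (simpleRoot i)))
    (hf : ∀ i, ψ (f A i) ∈ rootSpace A (-φ (simpleRoot i)))
    (hh : ∀ i, ψ (h A i) ∈ rootSpace A 0) {μ : I → ℤ} {x : KM A} (hx : x ∈ rootSpace A μ) :
    ψ x ∈ rootSpace A (φ μ) := by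
  rw [rootSpace_eq_span_monomials] at hx
  suffices monomials A μ ⊆ (rootSpace A (φ μ)).comap (ψ : KM A →ₗ[ℂ] KM A) from
    Submodule.span_le.2 this hx
  rintro _ (⟨w, hw, rfl, rfl⟩ | ⟨rfl, j, rfl⟩ | ⟨w, hw, rfl, rfl⟩)
  · change ψ (iterBracket _ w) ∈ rootSpace A _
    rw [map_iterBracket (LieHom.map_lie ψ) _ hw]
    exact iterBracket_mem_rootSpace φ he hw
  · rw [map_zero]
    exact hh j
  · change ψ (iterBracket _ w) ∈ rootSpace A _
    rw [map_iterBracket (LieHom.map_lie ψ) _ hw, map_neg]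
    exact iterBracket_mem_rootSpace (-φ) hf hw

theorem chevalley_mem_rootSpace {μ : I → ℤ} {x : KM A} (hx : x ∈ rootSpace A μ) :
    chevalley A x ∈ rootSpace A (-μ) :=
  map_mem_rootSpace (chevalley A) (-AddMonoidHom.id (I → ℤ))
    (fun i => by rw [chevalley_e]; exact neg_mem (f_mem_rootSpace A i))
    (fun i => by
      rw [chevalley_f, AddMonoidHom.neg_apply, AddMonoidHom.id_apply, neg_neg]
      exact neg_mem (e_mem_rootSpace A i))
    (fun i => by rw [chevalley_h]; exact neg_mem (h_mem_rootSpace A i)) hx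

theorem mem_span_iterBracket_e_of_pos {μ : I → ℤ} {x : KM A} (hx : x ∈ rootSpace A μ) {i : I}
    (hi : 0 < μ i) :
    x ∈ Submodule.span ℂ (iterBracket (e A) '' {w | w ≠ [] ∧ wordWeight w = μ}) := by
  rw [rootSpace_eq_span_monomials] at hx
  refine Submodule.span_mono ?_ hx
  rintro _ (⟨w, hw, hwμ, rfl⟩ | ⟨rfl, -⟩ | ⟨w, -, rfl, rfl⟩)
  · exact ⟨w, ⟨hw, hwμ⟩, rfl⟩
  · exact absurd hi (lt_irrefl _)
  · exact absurd (wordWeight_nonneg w i) (not_le.2 (neg_pos.1 hi))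

theorem eq_zero_of_mem_rootSpace_of_pos_of_neg {μ : I → ℤ} {x : KM A} (hx : x ∈ rootSpace A μ)
    {i j : I} (hi : 0 < μ i) (hj : μ j < 0) : x = 0 := by
  have noWords : {w : List I | w ≠ [] ∧ wordWeight w = μ} = ∅ := by
    refine Set.eq_empty_iff_forall_notMem.2 ?_
    rintro w ⟨-, rfl⟩
    exact absurd (wordWeight_nonneg w j) (not_le.2 hj)
  simpa [noWords] using mem_span_iterBracket_e_of_pos hx hi

theorem nPlus_eq_span_iterBracket (X : Finset I) : (nPlus A X).toSubmodule =
    Submodule.span ℂ (iterBracket (e A) '' {w | w ≠ [] ∧ ∀ i ∈ w, i ∈ (X : Set I)}) :=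
  lieSpan_image_eq_span_iterBracket _ _

theorem mem_nPlus_of_mem_rootSpace {μ : I → ℤ} {x : KM A} (hx : x ∈ rootSpace A μ) {i : I}
    (hi : 0 < μ i) {X : Finset I} (hX : ∀ k ∉ X, μ k = 0) : x ∈ nPlus A X := by
  rw [← LieSubalgebra.mem_toSubmodule, nPlus_eq_span_iterBracket]
  refine Submodule.span_mono (Set.image_mono ?_) (mem_span_iterBracket_e_of_pos hx hi)
  rintro w ⟨hw, rfl⟩
  refine ⟨hw, fun k hk => ?_⟩
  by_contra hkX
  exact notMem_of_wordWeight_eq_zero (hX k hkX) hk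

theorem mem_rootSpace_simpleRoot {x : KM A} {j : I} (hx : x ∈ rootSpace A (simpleRoot j)) :
    ∃ a : ℂ, a • e A j = x := by
  refine Submodule.mem_span_singleton.1 (Submodule.span_mono ?_
    (mem_span_iterBracket_e_of_pos hx (i := j) (by simp [simpleRoot])))
  rintro _ ⟨w, ⟨-, hwj⟩, rfl⟩
  rw [← wordWeight_singleton, wordWeight_eq_iff_perm, List.perm_singleton] at hwj
  rw [hwj]
  rfl

theorem mem_rootSpace_neg_simpleRoot {x : KM A} {j : I} (hx : x ∈ rootSpace A (-simpleRoot j)) :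
    ∃ a : ℂ, a • f A j = x := by
  have hωx := chevalley_mem_rootSpace hx
  rw [neg_neg] at hωx
  obtain ⟨a, ha⟩ := mem_rootSpace_simpleRoot hωx
  refine ⟨-a, ?_⟩
  rw [← chevalley_chevalley A x, ← ha, map_smul, chevalley_e, smul_neg, neg_smul]

theorem eq_zero_of_mem_rootSpace_of_two_le {μ : I → ℤ} {x : KM A} {j : I}
    (hx : x ∈ rootSpace A μ) (hμ : ∀ k, k ≠ j → μ k = 0) (hj : 2 ≤ μ j) : x = 0 := by
  rw [← Submodule.mem_bot ℂ, ← Submodule.span_zero_singleton]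
  refine Submodule.span_mono ?_ (mem_span_iterBracket_e_of_pos hx (i := j) (by omega))
  rintro _ ⟨w, ⟨-, rfl⟩, rfl⟩
  have hw : w = List.replicate w.length j := List.eq_replicate_iff.2 ⟨rfl, fun k hk => by
    by_contra hkj
    exact notMem_of_wordWeight_eq_zero (hμ k hkj) hk⟩
  rw [wordWeight_apply, hw, List.count_replicate_self] at hj
  obtain ⟨n, hn⟩ := Nat.exists_eq_add_of_le' (show 2 ≤ w.length by omega)
  rw [hw, hn]
  exact iterBracket_replicate_eq_zero _ _ _

theorem eq_zero_of_mem_rootSpace_of_le_neg_two {μ : I → ℤ} {x : KM A} {j : I}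
    (hx : x ∈ rootSpace A μ) (hμ : ∀ k, k ≠ j → μ k = 0) (hj : μ j ≤ -2) : x = 0 := by
  have hωx : chevalley A x = 0 :=
    eq_zero_of_mem_rootSpace_of_two_le (chevalley_mem_rootSpace hx) (j := j)
      (fun k hk => by rw [Pi.neg_apply, hμ k hk, neg_zero]) (by rw [Pi.neg_apply]; omega)
  rw [← chevalley_chevalley A x, hωx, map_zero]

theorem mem_rootSpace_simpleRoot_add_simpleRoot {x : KM A} {i j : I} (hij : i ≠ j)
    (hx : x ∈ rootSpace A (simpleRoot i + simpleRoot j)) : ∃ a : ℂ, a • ⁅e A j, e A i⁆ = x := by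
  refine Submodule.mem_span_singleton.1 (Submodule.span_le.2 ?_
    (mem_span_iterBracket_e_of_pos hx (i := i) (by simp [simpleRoot, hij])))
  rintro _ ⟨w, ⟨-, hw⟩, rfl⟩
  rw [← wordWeight_singleton j, ← wordWeight_cons, wordWeight_eq_iff_perm] at hw
  have hw' : w = [i, j] ∨ w = [j, i] := by
    simpa [List.permutations] using List.mem_permutations.2 hw
  rcases hw' with rfl | rfl
  · change ⁅e A i, e A j⁆ ∈ Submodule.span ℂ {⁅e A j, e A i⁆}
    rw [← lie_skew (e A i) (e A j)]
    exact neg_mem (Submodule.mem_span_singleton_self ⁅e A j, e A i⁆)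
  · exact Submodule.mem_span_singleton_self _

variable [Fintype I]

theorem sum_map_eq_mulVec_wordWeight (i : I) (w : List I) :
    (w.map fun j => (A i j : ℂ)).sum = ((A.mulVec (wordWeight w) i : ℤ) : ℂ) := by
  induction w with
  | nil => simp [wordWeight]
  | cons j w ih =>
    rw [wordWeight_cons, Matrix.mulVec_add, List.map_cons, List.sum_cons, ih, simpleRoot,
      Matrix.mulVec_single_one]
    simp

theorem lie_h_of_mem_rootSpace {μ : I → ℤ} {x : KM A} (hx : x ∈ rootSpace A μ) (i : I) :
    ⁅h A i, x⁆ = ((A.mulVec μ i : ℤ) : ℂ) • x := by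
  suffices ∀ x ∈ monomials A μ, ⁅h A i, x⁆ = ((A.mulVec μ i : ℤ) : ℂ) • x by
    rw [rootSpace_eq_span_monomials] at hx
    exact LinearMap.eqOn_span (f := (LieAlgebra.ad ℂ (KM A) (h A i) : Module.End ℂ (KM A)))
      (g := ((A.mulVec μ i : ℤ) : ℂ) • LinearMap.id)
      (fun y hy => by simpa using this y hy) hx
  rintro _ (⟨w, hw, rfl, rfl⟩ | ⟨rfl, j, rfl⟩ | ⟨w, hw, rfl, rfl⟩)
  · rw [lie_iterBracket_of_lie_eq_smul (lie_h_e_eq_smul A i) hw, sum_map_eq_mulVec_wordWeight]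
  · simp [lie_h_h]
  · rw [lie_iterBracket_of_lie_eq_smul (lie_h_f_eq_smul A i) hw, Matrix.mulVec_neg, Pi.neg_apply,
      Int.cast_neg, ← sum_map_eq_mulVec_wordWeight, List.sum_neg, List.map_map]
    rfl

end Words

/-! ### Exponentials of locally nilpotent derivations -/

section Exp

open Finset.HasAntidiagonal (antidiagonal mem_antidiagonal)

theorem ad_pow_lie {R L : Type*} [CommRing R] [LieRing L] [LieAlgebra R L] (u x y : L) (n : ℕ) :
    (LieAlgebra.ad R L u ^ n) ⁅x, y⁆ = ∑ p ∈ antidiagonal n, n.choose p.1 •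
      ⁅(LieAlgebra.ad R L u ^ p.1) x, (LieAlgebra.ad R L u ^ p.2) y⁆ := by
  have hu : ⇑(LieDerivation.ad R L u) = ⇑(LieAlgebra.ad R L u) :=
    funext fun v => by simp
  simpa only [Module.End.pow_apply, hu] using LieDerivation.iterate_apply_lie
    (LieDerivation.ad R L u) n x y

section Apply

variable {V : Type*} [AddCommGroup V] [Module ℂ V] {D : Module.End ℂ V}
  (hD : ∀ x, ∃ n : ℕ, (D ^ n) x = 0)

theorem expLocNilp_apply {x : V} {n : ℕ} (hn : (D ^ n) x = 0) :
    expLocNilp D hD x = ∑ k ∈ Finset.range n, (k.factorial : ℂ)⁻¹ • (D ^ k) x := by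
  refine finsum_eq_sum_of_support_subset _ fun k hk => ?_
  by_contra hkn
  exact hk (by
    change (k.factorial : ℂ)⁻¹ • (D ^ k) x = 0
    rw [Module.End.pow_map_zero_of_le (by simpa using hkn) hn, smul_zero])

theorem expLocNilp_apply_eq_self {x : V} (hx : D x = 0) : expLocNilp D hD x = x := by
  rw [expLocNilp_apply hD (n := 1) (by rw [pow_one, hx])]
  simp

theorem expLocNilp_mem {U : Submodule ℂ V} (hU : ∀ x ∈ U, D x ∈ U) {x : V} (hx : x ∈ U) :
    expLocNilp D hD x ∈ U := by
  obtain ⟨n, hn⟩ := hD x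
  rw [expLocNilp_apply hD hn]
  refine U.sum_mem fun k _ => U.smul_mem _ ?_
  rw [Module.End.pow_apply]
  exact Set.MapsTo.iterate (s := (U : Set V)) hU k hx

end Apply

variable {L : Type*} [LieRing L] [LieAlgebra ℂ L]

theorem inv_factorial_smul_ad_pow_lie (u x y : L) (n : ℕ) :
    (n.factorial : ℂ)⁻¹ • (LieAlgebra.ad ℂ L u ^ n) ⁅x, y⁆ =
      ∑ p ∈ antidiagonal n,
        ⁅(p.1.factorial : ℂ)⁻¹ • (LieAlgebra.ad ℂ L u ^ p.1) x,
          (p.2.factorial : ℂ)⁻¹ • (LieAlgebra.ad ℂ L u ^ p.2) y⁆ := by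
  rw [ad_pow_lie, Finset.smul_sum]
  refine Finset.sum_congr rfl fun p hp => ?_
  rw [smul_lie, lie_smul, smul_smul, ← Nat.cast_smul_eq_nsmul ℂ, smul_smul,
    ← mem_antidiagonal.1 hp, Nat.cast_add_choose]
  have hfactorial (m : ℕ) : (m.factorial : ℂ) ≠ 0 := Nat.cast_ne_zero.2 m.factorial_ne_zero
  have := hfactorial (p.1 + p.2)
  congr 1
  field_simp

theorem expLocNilp_lie (u : L) (hu : ∀ x, ∃ n : ℕ, (LieAlgebra.ad ℂ L u ^ n) x = 0) (x y : L) :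
    expLocNilp _ hu ⁅x, y⁆ = ⁅expLocNilp _ hu x, expLocNilp _ hu y⁆ := by
  obtain ⟨a, ha⟩ := hu x
  obtain ⟨b, hb⟩ := hu y
  let F : ℕ × ℕ → L := fun p => ⁅(p.1.factorial : ℂ)⁻¹ • (LieAlgebra.ad ℂ L u ^ p.1) x,
    (p.2.factorial : ℂ)⁻¹ • (LieAlgebra.ad ℂ L u ^ p.2) y⁆
  have hF {p : ℕ × ℕ} (hp : a ≤ p.1 ∨ b ≤ p.2) : F p = 0 := by
    rcases hp with hp | hp
    · simp only [F, Module.End.pow_map_zero_of_le hp ha, smul_zero, zero_lie]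
    · simp only [F, Module.End.pow_map_zero_of_le hp hb, smul_zero, lie_zero]
  have hab : (LieAlgebra.ad ℂ L u ^ (a + b)) ⁅x, y⁆ = 0 := by
    rw [ad_pow_lie]
    refine Finset.sum_eq_zero fun p hp => ?_
    rcases (by have := mem_antidiagonal.1 hp; omega : a ≤ p.1 ∨ b ≤ p.2) with hp | hp
    · rw [Module.End.pow_map_zero_of_le hp ha, zero_lie, smul_zero]
    · rw [Module.End.pow_map_zero_of_le hp hb, lie_zero, smul_zero]
  calc expLocNilp _ hu ⁅x, y⁆
      = ∑ n ∈ Finset.range (a + b), ∑ p ∈ antidiagonal n, F p := by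
        rw [expLocNilp_apply hu hab]
        exact Finset.sum_congr rfl fun n _ => inv_factorial_smul_ad_pow_lie u x y n
    _ = ∑ n ∈ Finset.range (a + b),
          ∑ p ∈ Finset.range a ×ˢ Finset.range b with p.1 + p.2 = n, F p := by
        refine Finset.sum_congr rfl fun n _ => (Finset.sum_subset (fun p hp => ?_) ?_).symm
        · exact mem_antidiagonal.2 (Finset.mem_filter.1 hp).2
        · intro p hp hp'
          refine hF ?_
          by_contra! hlt
          exact hp' (Finset.mem_filter.2 ⟨by simpa using hlt, mem_antidiagonal.1 hp⟩)
    _ = ∑ p ∈ Finset.range a ×ˢ Finset.range b, F p :=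
        Finset.sum_fiberwise_of_maps_to (fun p hp => by
          simp only [Finset.mem_product, Finset.mem_range] at hp ⊢; omega) F
    _ = ⁅expLocNilp _ hu x, expLocNilp _ hu y⁆ := by
        rw [expLocNilp_apply hu ha, expLocNilp_apply hu hb, sum_lie_sum, Finset.sum_product]

end Exp

section AdM

variable {I : Type*} [DecidableEq I] {A : Matrix I I ℤ}

theorem AdM_lie (i : I) (x y : KM A) : AdM A i ⁅x, y⁆ = ⁅AdM A i x, AdM A i y⁆ := by
  simp only [AdM, Module.End.mul_apply, expLocNilp_lie]

theorem AdM_eq_self {i : I} {x : KM A} (he : ⁅e A i, x⁆ = 0) (hf : ⁅f A i, x⁆ = 0) :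
    AdM A i x = x := by
  have hexp_e := expLocNilp_apply_eq_self (ad_e_locNilp A i) he
  have hexp_f := expLocNilp_apply_eq_self (ad_neg_f_locNilp A i) (x := x)
    (by rw [LieAlgebra.ad_apply, neg_lie, hf, neg_zero])
  rw [AdM, Module.End.mul_apply, Module.End.mul_apply, hexp_e, hexp_f, hexp_e]

theorem AdM_mem {U : Submodule ℂ (KM A)} {i : I} (he : ∀ x ∈ U, ⁅e A i, x⁆ ∈ U)
    (hf : ∀ x ∈ U, ⁅f A i, x⁆ ∈ U) {x : KM A} (hx : x ∈ U) : AdM A i x ∈ U := by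
  have hf' (y : KM A) (hy : y ∈ U) : ⁅-f A i, y⁆ ∈ U := by
    rw [neg_lie]
    exact U.neg_mem (hf y hy)
  exact expLocNilp_mem (ad_e_locNilp A i) he (expLocNilp_mem (ad_neg_f_locNilp A i) hf'
    (expLocNilp_mem (ad_e_locNilp A i) he hx))

theorem AdM_h_self {i : I} (hi : A i i = 2) : AdM A i (h A i) = -h A i := by
  have heh : ⁅e A i, h A i⁆ = (-2 : ℂ) • e A i := by rw [lie_e_h_eq_smul, hi]; norm_num
  have hfh : ⁅f A i, h A i⁆ = (2 : ℂ) • f A i := by rw [lie_f_h_eq_smul, hi]; norm_num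
  have hfe : ⁅f A i, e A i⁆ = -h A i := by rw [lie_f_e, if_pos rfl]
  have exp_e_h : expLocNilp _ (ad_e_locNilp A i) (h A i) = h A i + (-2 : ℂ) • e A i := by
    rw [expLocNilp_apply _ (n := 2) (by simp [pow_two, heh])]
    simp [Finset.sum_range_succ, heh]
  have exp_e_e : expLocNilp _ (ad_e_locNilp A i) (e A i) = e A i :=
    expLocNilp_apply_eq_self _ (lie_self (e A i))
  have exp_f_h : expLocNilp _ (ad_neg_f_locNilp A i) (h A i) = h A i - (2 : ℂ) • f A i := by
    rw [expLocNilp_apply _ (n := 2) (by simp [pow_two, hfh])]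
    simp [Finset.sum_range_succ, hfh, sub_eq_add_neg]
  have exp_f_e : expLocNilp _ (ad_neg_f_locNilp A i) (e A i) = e A i + h A i - f A i := by
    rw [expLocNilp_apply _ (n := 3) (by simp [pow_succ, hfh, hfe])]
    simp [Finset.sum_range_succ, pow_two, hfh, hfe, sub_eq_add_neg, Nat.factorial]
  have collect : h A i - (2 : ℂ) • f A i + (-2 : ℂ) • (e A i + h A i - f A i) =
      -h A i + (-2 : ℂ) • e A i := by module
  rw [AdM, Module.End.mul_apply, Module.End.mul_apply, exp_e_h, map_add, map_smul, exp_f_h, exp_f_e,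
    collect, map_add, map_smul, map_neg, exp_e_h, exp_e_e]
  module

theorem AdM_h {i : I} (hi : A i i = 2) (j : I) :
    AdM A i (h A j) = h A j - (A j i : ℂ) • h A i := by
  -- `h_j - (a_{ji} / 2) h_i` is orthogonal to `α_i`, hence fixed.
  have hfix : AdM A i (h A j - ((A j i : ℂ) / 2) • h A i) = h A j - ((A j i : ℂ) / 2) • h A i := by
    apply AdM_eq_self
    · rw [lie_sub, lie_smul, lie_e_h_eq_smul, lie_e_h_eq_smul, hi]
      push_cast
      module
    · rw [lie_sub, lie_smul, lie_f_h_eq_smul, lie_f_h_eq_smul, hi]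
      push_cast
      module
  rw [map_sub, map_smul, AdM_h_self hi, sub_eq_iff_eq_add] at hfix
  rw [hfix]
  module

theorem AdM_mem_cartan {i : I} (hi : A i i = 2) {x : KM A} (hx : x ∈ cartan A) :
    AdM A i x ∈ cartan A := by
  suffices cartan A ≤ (cartan A).comap (AdM A i) from this hx
  refine Submodule.span_le.2 ?_
  rintro _ ⟨j, rfl⟩
  rw [SetLike.mem_coe, Submodule.mem_comap, AdM_h hi]
  exact sub_mem (h_mem_cartan A j) (Submodule.smul_mem _ _ (h_mem_cartan A i))

theorem AdM_AdM_of_mem_cartan {i : I} (hi : A i i = 2) {x : KM A} (hx : x ∈ cartan A) :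
    AdM A i (AdM A i x) = x := by
  refine LinearMap.eqOn_span (f := AdM A i * AdM A i) (g := 1) ?_ hx
  rintro _ ⟨j, rfl⟩
  rw [Module.End.mul_apply, AdM_h hi, map_sub, map_smul, AdM_h_self hi, AdM_h hi,
    Module.End.one_apply]
  module

theorem AdWord_cons (i : I) (l : List I) (x : KM A) :
    AdWord A (i :: l) x = AdM A i (AdWord A l x) := by
  simp only [AdWord, List.map_cons, List.prod_cons, Module.End.mul_apply]

theorem AdWord_lie (l : List I) (x y : KM A) :
    AdWord A l ⁅x, y⁆ = ⁅AdWord A l x, AdWord A l y⁆ := by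
  induction l with
  | nil => rfl
  | cons i l ih => simp only [AdWord_cons, ih, AdM_lie]

theorem AdWord_mem_cartan (hA : ∀ i, A i i = 2) (l : List I) {x : KM A} (hx : x ∈ cartan A) :
    AdWord A l x ∈ cartan A := by
  induction l with
  | nil => exact hx
  | cons i l ih => rw [AdWord_cons]; exact AdM_mem_cartan (hA i) ih

theorem eq_zero_of_AdWord_eq_zero (hA : ∀ i, A i i = 2) {l : List I} {x : KM A}
    (hx : x ∈ cartan A) (h0 : AdWord A l x = 0) : x = 0 := by
  induction l with
  | nil => exact h0
  | cons i l ih =>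
    rw [AdWord_cons] at h0
    refine ih ?_
    rw [← AdM_AdM_of_mem_cartan (hA i) (AdWord_mem_cartan hA l hx), h0, map_zero]

theorem lie_mem_iSup_rootSpace_add_smul {α β : I → ℤ} {u y : KM A} {s : ℤ}
    (hu : u ∈ rootSpace A (s • α)) (hy : y ∈ ⨆ k : ℤ, rootSpace A (β + k • α)) :
    ⁅u, y⁆ ∈ ⨆ k : ℤ, rootSpace A (β + k • α) := by
  suffices (⨆ k : ℤ, rootSpace A (β + k • α)) ≤
      (⨆ k : ℤ, rootSpace A (β + k • α)).comap (LieAlgebra.ad ℂ (KM A) u) from this hy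
  refine iSup_le fun k z hz => Submodule.mem_iSup_of_mem (k + s) ?_
  have hshift : β + (k + s) • α = s • α + (β + k • α) := by rw [add_smul]; abel
  rw [hshift]
  exact lie_mem_rootSpace hu hz

theorem iSupIndep_eigenspace_ad_h (i : I) (a : ℂ) :
    iSupIndep fun k : ℤ => Module.End.eigenspace (LieAlgebra.ad ℂ (KM A) (h A i)) (a + 2 * k) :=
  (Module.End.eigenspaces_iSupIndep (LieAlgebra.ad ℂ (KM A) (h A i))).comp fun k k' hk => by
    simpa using hk

variable [Fintype I]

theorem simpleReflection_apply (i : I) (β : I → ℤ) :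
    simpleReflection A i β = β - (A.mulVec β i) • simpleRoot i := by
  simp [simpleReflection]

theorem weylProd_cons (i : I) (l : List I) (β : I → ℤ) :
    weylProd A (i :: l) β = simpleReflection A i (weylProd A l β) := by
  simp only [weylProd, List.map_cons, List.prod_cons, Module.End.mul_apply]

theorem AdM_mem_rootSpace {i : I} (hi : A i i = 2) {β : I → ℤ} {x : KM A}
    (hx : x ∈ rootSpace A β) : AdM A i x ∈ rootSpace A (simpleReflection A i β) := by
  -- In the `α_i`-string through `β` the root spaces are told apart by the eigenvalues of `ad h_i`.
  let b : ℂ := (A.mulVec β i : ℤ)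
  have mem_string : AdM A i x ∈ ⨆ k : ℤ, rootSpace A (β + k • simpleRoot i) := by
    refine AdM_mem (fun y hy => ?_) (fun y hy => ?_)
      (Submodule.mem_iSup_of_mem 0 (by simpa using hx))
    · exact lie_mem_iSup_rootSpace_add_smul (s := 1) (by simpa using e_mem_rootSpace A i) hy
    · exact lie_mem_iSup_rootSpace_add_smul (s := -1) (by simpa using f_mem_rootSpace A i) hy
  have mem_eigenspace : AdM A i x ∈
      Module.End.eigenspace (LieAlgebra.ad ℂ (KM A) (h A i)) (b + 2 * (-A.mulVec β i : ℤ)) := by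
    have hlie : ⁅h A i, AdM A i x⁆ = -AdM A i ⁅h A i, x⁆ := by
      rw [AdM_lie, AdM_h_self hi, neg_lie, neg_neg]
    rw [Module.End.mem_eigenspace_iff, LieAlgebra.ad_apply, hlie, lie_h_of_mem_rootSpace hx,
      map_smul, ← neg_smul]
    congr 1
    simp only [b]
    push_cast
    ring
  have string_le : (fun k : ℤ => rootSpace A (β + k • simpleRoot i)) ≤
      fun k : ℤ => Module.End.eigenspace (LieAlgebra.ad ℂ (KM A) (h A i)) (b + 2 * k) := by
    intro k y hy
    rw [Module.End.mem_eigenspace_iff, LieAlgebra.ad_apply, lie_h_of_mem_rootSpace hy,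
      Matrix.mulVec_add, Matrix.mulVec_smul, simpleRoot, Matrix.mulVec_single_one]
    simp only [Pi.add_apply, Pi.smul_apply, Matrix.col_apply, hi, smul_eq_mul, b]
    push_cast
    rw [mul_comm]
  rw [simpleReflection_apply, sub_eq_add_neg, ← neg_smul,
    ← inf_iSup_eq_of_iSupIndep (iSupIndep_eigenspace_ad_h i b) string_le (-A.mulVec β i)]
  exact ⟨mem_eigenspace, mem_string⟩

theorem AdWord_mem_rootSpace (hA : ∀ i, A i i = 2) (l : List I) {β : I → ℤ} {x : KM A}
    (hx : x ∈ rootSpace A β) : AdWord A l x ∈ rootSpace A (weylProd A l β) := by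
  induction l with
  | nil => exact hx
  | cons i l ih =>
    rw [AdWord_cons, weylProd_cons]
    exact AdM_mem_rootSpace (hA i) ih

end AdM

section Theta

variable {I : Type*} [DecidableEq I] {A : Matrix I I ℤ}

theorem chevalley_eq_neg_of_mem_cartan {x : KM A} (hx : x ∈ cartan A) : chevalley A x = -x := by
  refine LinearMap.eqOn_span (f := (chevalley A : KM A →ₗ[ℂ] KM A)) (g := -1) ?_ hx
  rintro _ ⟨j, rfl⟩
  exact chevalley_h A j

theorem diagramHom_mem_cartan (τ : Equiv.Perm I) (hτ : IsDiagramAut A τ) {x : KM A}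
    (hx : x ∈ cartan A) : diagramHom A τ hτ x ∈ cartan A := by
  suffices cartan A ≤ (cartan A).comap (diagramHom A τ hτ : KM A →ₗ[ℂ] KM A) from this hx
  refine Submodule.span_le.2 ?_
  rintro _ ⟨j, rfl⟩
  change diagramHom A τ hτ (h A j) ∈ cartan A
  rw [diagramHom_h]
  exact h_mem_cartan A (τ j)

theorem diagramHom_injective (τ : Equiv.Perm I) (hτ : IsDiagramAut A τ) :
    Function.Injective (diagramHom A τ hτ) := by
  have hτ' : IsDiagramAut A τ.symm := fun i j => by simpa using (hτ (τ.symm i) (τ.symm j)).symm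
  have hcomp : (diagramHom A τ.symm hτ').comp (diagramHom A τ hτ) = LieHom.id :=
    hom_ext (fun i => by simp [LieHom.comp_apply, diagramHom_e])
      (fun i => by simp [LieHom.comp_apply, diagramHom_f])
      (fun i => by simp [LieHom.comp_apply, diagramHom_h])
  exact Function.LeftInverse.injective (g := diagramHom A τ.symm hτ') (DFunLike.congr_fun hcomp)

theorem theta_apply (τ : Equiv.Perm I) (hτ : IsDiagramAut A τ) (l : List I) (x : KM A) :
    theta A τ hτ l x = AdWord A l (diagramHom A τ hτ (chevalley A x)) := rfl

theorem theta_lie (τ : Equiv.Perm I) (hτ : IsDiagramAut A τ) (l : List I) (x y : KM A) :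
    theta A τ hτ l ⁅x, y⁆ = ⁅theta A τ hτ l x, theta A τ hτ l y⁆ := by
  simp only [theta_apply, LieHom.map_lie, AdWord_lie]

theorem theta_e (τ : Equiv.Perm I) (hτ : IsDiagramAut A τ) (l : List I) (j : I) :
    theta A τ hτ l (e A j) = -AdWord A l (f A (τ j)) := by
  rw [theta_apply, chevalley_e, map_neg, map_neg, diagramHom_f]

theorem theta_f (τ : Equiv.Perm I) (hτ : IsDiagramAut A τ) (l : List I) (j : I) :
    theta A τ hτ l (f A j) = -AdWord A l (e A (τ j)) := by
  rw [theta_apply, chevalley_f, map_neg, map_neg, diagramHom_e]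

theorem theta_mem_cartan (hA : ∀ i, A i i = 2) (τ : Equiv.Perm I) (hτ : IsDiagramAut A τ)
    (l : List I) {x : KM A} (hx : x ∈ cartan A) : theta A τ hτ l x ∈ cartan A := by
  rw [theta_apply, chevalley_eq_neg_of_mem_cartan hx]
  exact AdWord_mem_cartan hA l (diagramHom_mem_cartan τ hτ (neg_mem hx))

theorem eq_zero_of_theta_eq_zero (hA : ∀ i, A i i = 2) {τ : Equiv.Perm I} {hτ : IsDiagramAut A τ}
    {l : List I} {x : KM A} (hx : x ∈ cartan A) (h0 : theta A τ hτ l x = 0) : x = 0 := by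
  rw [theta_apply, chevalley_eq_neg_of_mem_cartan hx] at h0
  have hneg := eq_zero_of_AdWord_eq_zero hA (diagramHom_mem_cartan τ hτ (neg_mem hx)) h0
  exact neg_eq_zero.1 ((map_eq_zero_iff _ (diagramHom_injective τ hτ)).1 hneg)

theorem funLeft_simpleRoot (τ : Equiv.Perm I) (j : I) :
    LinearMap.funLeft ℤ ℤ τ.symm (simpleRoot j) = simpleRoot (τ j) := by
  funext k
  simp [LinearMap.funLeft_apply, simpleRoot, Pi.single_apply, Equiv.symm_apply_eq]

theorem diagramHom_mem_rootSpace (τ : Equiv.Perm I) (hτ : IsDiagramAut A τ) {β : I → ℤ} {x : KM A}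
    (hx : x ∈ rootSpace A β) :
    diagramHom A τ hτ x ∈ rootSpace A (LinearMap.funLeft ℤ ℤ τ.symm β) := by
  refine map_mem_rootSpace (diagramHom A τ hτ) (LinearMap.funLeft ℤ ℤ τ.symm).toAddMonoidHom
    (fun i => ?_) (fun i => ?_) (fun i => ?_) hx
  · change _ ∈ rootSpace A (LinearMap.funLeft ℤ ℤ τ.symm (simpleRoot i))
    rw [diagramHom_e, funLeft_simpleRoot]
    exact e_mem_rootSpace A (τ i)
  · change _ ∈ rootSpace A (-LinearMap.funLeft ℤ ℤ τ.symm (simpleRoot i))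
    rw [diagramHom_f, funLeft_simpleRoot]
    exact f_mem_rootSpace A (τ i)
  · rw [diagramHom_h]
    exact h_mem_rootSpace A (τ i)

variable [Fintype I]

theorem thetaRoot_apply (τ : Equiv.Perm I) (l : List I) (β : I → ℤ) :
    thetaRoot A τ l β = -weylProd A l (LinearMap.funLeft ℤ ℤ τ.symm β) := rfl

theorem thetaRoot_simpleRoot (τ : Equiv.Perm I) (l : List I) (j : I) :
    thetaRoot A τ l (simpleRoot j) = -weylProd A l (simpleRoot (τ j)) := by
  rw [thetaRoot_apply, funLeft_simpleRoot]

theorem theta_mem_rootSpace (hA : ∀ i, A i i = 2) (τ : Equiv.Perm I) (hτ : IsDiagramAut A τ)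
    (l : List I) {β : I → ℤ} {x : KM A} (hx : x ∈ rootSpace A β) :
    theta A τ hτ l x ∈ rootSpace A (thetaRoot A τ l β) := by
  rw [theta_apply, thetaRoot_apply, ← map_neg, ← map_neg]
  exact AdWord_mem_rootSpace hA l (diagramHom_mem_rootSpace τ hτ (chevalley_mem_rootSpace hx))

end Theta

/-! ### Serre elements -/

section SerreElements

section Commutators

variable {R L : Type*} [CommRing R] [LieRing L] [LieAlgebra R L]

theorem lie_ad_pow_of_lie_eq_zero {t x y : L} (h : ⁅t, x⁆ = 0) (n : ℕ) :
    ⁅t, (LieAlgebra.ad R L x ^ n) y⁆ = (LieAlgebra.ad R L x ^ n) ⁅t, y⁆ := by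
  induction n with
  | zero => rfl
  | succ n ih =>
    rw [pow_succ', Module.End.mul_apply, Module.End.mul_apply, LieAlgebra.ad_apply,
      LieAlgebra.ad_apply, leibniz_lie, h, zero_lie, zero_add, ih]

theorem lie_ad_pow_of_lie_eq_smul {t x y : L} {a b : R} (hx : ⁅t, x⁆ = a • x) (hy : ⁅t, y⁆ = b • y)
    (n : ℕ) : ⁅t, (LieAlgebra.ad R L x ^ n) y⁆ = (n * a + b) • (LieAlgebra.ad R L x ^ n) y := by
  induction n with
  | zero => simpa using hy
  | succ n ih =>
    rw [pow_succ', Module.End.mul_apply, LieAlgebra.ad_apply, leibniz_lie, hx, ih, smul_lie,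
      lie_smul, ← add_smul]
    congr 1
    push_cast
    ring

theorem lie_ad_pow_of_highestWeight {e f h v : L} {a : R} (hef : ⁅e, f⁆ = h)
    (hhf : ⁅h, f⁆ = (-2 : R) • f) (hhv : ⁅h, v⁆ = a • v) (hev : ⁅e, v⁆ = 0) (n : ℕ) :
    ⁅e, (LieAlgebra.ad R L f ^ (n + 1)) v⁆ =
      ((n + 1) * (a - n)) • (LieAlgebra.ad R L f ^ n) v := by
  induction n with
  | zero => simp [leibniz_lie e f v, hef, hev, hhv]
  | succ n ih =>
    rw [pow_succ', Module.End.mul_apply, LieAlgebra.ad_apply, leibniz_lie, hef, ih,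
      lie_ad_pow_of_lie_eq_smul hhf hhv, lie_smul, ← LieAlgebra.ad_apply R L f,
      ← Module.End.mul_apply, ← pow_succ', ← add_smul]
    congr 1
    push_cast
    ring

end Commutators

variable {I L : Type*} {A : Matrix I I ℤ} [LieRing L] [LieAlgebra ℂ L]

variable (A) in
/-- The Serre element `ad(x_i)^{1 - a_{ij}}(x_j)` of a family `x`. The innermost bracket is split
off so that the exponent is the one of the presentation; the element vanishes for `i = j`. -/
def serreElt (x : I → L) (i j : I) : L :=
  (LieAlgebra.ad ℂ L (x i) ^ (-A i j).toNat) ⁅x i, x j⁆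

theorem serreElt_self (x : I → L) (i : I) : serreElt A x i i = 0 := by
  rw [serreElt, lie_self, map_zero]

theorem serreElt_eq_ad_pow_succ (x : I → L) (i j : I) :
    serreElt A x i j = (LieAlgebra.ad ℂ L (x i) ^ ((-A i j).toNat + 1)) (x j) := by
  rw [serreElt, pow_succ, Module.End.mul_apply, LieAlgebra.ad_apply]

variable [DecidableEq I] {e' f' h' : I → L}

theorem lie_serreElt_same (hA : ∀ i, A i i = 2) {i j : I} (hij : i ≠ j) (hAij : A i j ≤ 0)
    (hef : ∀ i j, ⁅e' i, f' j⁆ = if i = j then h' i else 0)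
    (hhf : ∀ i j, ⁅h' i, f' j⁆ = (-A i j : ℂ) • f' j) : ⁅e' i, serreElt A f' i j⁆ = 0 := by
  have hcast : ((-A i j).toNat : ℂ) = -A i j := by
    exact_mod_cast congrArg (Int.cast : ℤ → ℂ) (Int.toNat_of_nonneg (neg_nonneg.2 hAij))
  have hhf_self : ⁅h' i, f' i⁆ = (-2 : ℂ) • f' i := by rw [hhf, hA]; norm_num
  rw [serreElt_eq_ad_pow_succ, lie_ad_pow_of_highestWeight (h := h' i) (a := (-A i j : ℂ))
    (by rw [hef, if_pos rfl]) hhf_self (hhf i j) (by rw [hef, if_neg hij]), hcast, sub_self,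
    mul_zero, zero_smul]

theorem lie_serreElt_swap {i j : I} (hij : i ≠ j) (hAij : A i j ≤ 0) (hAz : A i j = 0 → A j i = 0)
    (hef : ∀ i j, ⁅e' i, f' j⁆ = if i = j then h' i else 0)
    (hhf : ∀ i j, ⁅h' i, f' j⁆ = (-A i j : ℂ) • f' j) : ⁅e' j, serreElt A f' i j⁆ = 0 := by
  have hfh : ⁅f' i, h' j⁆ = (A j i : ℂ) • f' i := by rw [← lie_skew, hhf]; module
  rw [serreElt_eq_ad_pow_succ, lie_ad_pow_of_lie_eq_zero (by rw [hef, if_neg hij.symm]), hef,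
    if_pos rfl, pow_succ, Module.End.mul_apply, LieAlgebra.ad_apply, hfh]
  rcases eq_or_ne (A j i) 0 with hji | hji
  · rw [hji, Int.cast_zero, zero_smul, map_zero]
  · have hpos : (-A i j).toNat ≠ 0 := fun h0 => hji (hAz (by omega))
    obtain ⟨n, hn⟩ := Nat.exists_eq_succ_of_ne_zero hpos
    rw [hn, pow_succ, Module.End.mul_apply, map_smul, LieAlgebra.ad_apply, lie_self, smul_zero,
      map_zero]

theorem lie_serreElt (hA : ∀ i, A i i = 2) (hA0 : ∀ i j, i ≠ j → A i j ≤ 0)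
    (hAz : ∀ i j, A i j = 0 → A j i = 0) (hef : ∀ i j, ⁅e' i, f' j⁆ = if i = j then h' i else 0)
    (hhf : ∀ i j, ⁅h' i, f' j⁆ = (-A i j : ℂ) • f' j) (k i j : I) :
    ⁅e' k, serreElt A f' i j⁆ = 0 := by
  rcases eq_or_ne i j with rfl | hij
  · rw [serreElt_self, lie_zero]
  rcases eq_or_ne k i with rfl | hki
  · exact lie_serreElt_same hA hij (hA0 k j hij) hef hhf
  rcases eq_or_ne k j with rfl | hkj
  · exact lie_serreElt_swap hij (hA0 i k hij) (hAz i k) hef hhf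
  · rw [serreElt_eq_ad_pow_succ, lie_ad_pow_of_lie_eq_zero (by rw [hef, if_neg hki]), hef,
      if_neg hkj, map_zero]

end SerreElements

section Intertwine

attribute [local instance] LieRing.ofAssociativeRing

variable {I V V' : Type*} {A : Matrix I I ℤ} [AddCommGroup V] [Module ℂ V] [AddCommGroup V']
  [Module ℂ V'] {q : V →ₗ[ℂ] V'}

theorem intertwine_lie {a b : Module.End ℂ V} {a' b' : Module.End ℂ V'}
    (ha : ∀ v, q (a v) = a' (q v)) (hb : ∀ v, q (b v) = b' (q v)) (v : V) :
    q (⁅a, b⁆ v) = ⁅a', b'⁆ (q v) := by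
  simp [LieRing.of_associative_ring_bracket, ha, hb]

theorem intertwine_serreElt {x : I → Module.End ℂ V} {x' : I → Module.End ℂ V'}
    (hx : ∀ i v, q (x i v) = x' i (q v)) (i j : I) (v : V) :
    q (serreElt A x i j v) = serreElt A x' i j (q v) := by
  have intertwine_ad_pow (n : ℕ) (v : V) :
      q ((LieAlgebra.ad ℂ _ (x i) ^ n) ⁅x i, x j⁆ v) =
        (LieAlgebra.ad ℂ _ (x' i) ^ n) ⁅x' i, x' j⁆ (q v) := by
    induction n generalizing v with
    | zero => exact intertwine_lie (hx i) (hx j) v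
    | succ n ih =>
      rw [pow_succ', pow_succ', Module.End.mul_apply, Module.End.mul_apply, LieAlgebra.ad_apply,
        LieAlgebra.ad_apply]
      exact intertwine_lie (hx i) ih v
  exact intertwine_ad_pow _ v

theorem intertwine_iterBracket {x : I → Module.End ℂ V} {x' : I → Module.End ℂ V'}
    (hx : ∀ i v, q (x i v) = x' i (q v)) (w : List I) (v : V) :
    q (iterBracket x w v) = iterBracket x' w (q v) := by
  rcases eq_or_ne w [] with rfl | hw
  · exact map_zero q
  induction w, hw using List.recNeNil generalizing v with
  | singleton i => exact hx i v
  | cons i w hw ih =>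
    rw [iterBracket_cons _ _ hw, iterBracket_cons _ _ hw]
    exact intertwine_lie (hx i) ih v

end Intertwine

/-! ### A module on which the `f_i` act freely up to Serre relations -/

section WordModule

attribute [local instance] LieRing.ofAssociativeRing

theorem end_apply_apply {R V : Type*} [CommRing R] [AddCommGroup V] [Module R V]
    (a b : Module.End R V) (v : V) : a (b v) = b (a v) + ⁅a, b⁆ v := by
  simp [LieRing.of_associative_ring_bracket]

variable {I : Type*} (A : Matrix I I ℤ) {V : Type*} [AddCommGroup V] [Module ℂ V]
  (b : Module.Basis (List I) ℂ V)

/-- The action of `f_j` on the Verma-type module with basis indexed by words: prepending the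
letter `j`. -/
def wordF (j : I) : Module.End ℂ V := b.constr ℂ fun w => b (j :: w)

/-- The action of `h_i` on the word module, diagonal with the weights of a Verma module of highest
weight `0`. -/
def wordH (i : I) : Module.End ℂ V :=
  b.constr ℂ fun w => (-(w.map fun j => (A i j : ℂ)).sum) • b w

theorem wordF_basis (j : I) (w : List I) : wordF b j (b w) = b (j :: w) :=
  b.constr_basis ℂ _ w

theorem wordH_basis (i : I) (w : List I) :
    wordH A b i (b w) = (-(w.map fun j => (A i j : ℂ)).sum) • b w :=
  b.constr_basis ℂ _ w

theorem wordH_basis_nil (i : I) : wordH A b i (b []) = 0 := by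
  rw [wordH_basis, List.map_nil, List.sum_nil, neg_zero, zero_smul]

theorem lie_wordH_wordF (i j : I) : ⁅wordH A b i, wordF b j⁆ = (-A i j : ℂ) • wordF b j := by
  refine b.ext fun w => ?_
  rw [LieRing.of_associative_ring_bracket, LinearMap.sub_apply, Module.End.mul_apply,
    Module.End.mul_apply, wordF_basis, wordH_basis, wordH_basis, map_smul, LinearMap.smul_apply,
    wordF_basis, ← sub_smul]
  simp

theorem lie_wordH_wordH (i j : I) : ⁅wordH A b i, wordH A b j⁆ = 0 := by
  refine b.ext fun w => ?_
  rw [LieRing.of_associative_ring_bracket, LinearMap.sub_apply, Module.End.mul_apply,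
    Module.End.mul_apply, wordH_basis, wordH_basis, map_smul, map_smul, wordH_basis, wordH_basis,
    smul_comm, sub_self, LinearMap.zero_apply]

theorem eq_zero_of_lie_wordF_eq_zero {C : Module.End ℂ V} (hC : ∀ k, ⁅C, wordF b k⁆ = 0)
    (h0 : C (b []) = 0) : C = 0 := by
  refine b.ext fun w => ?_
  induction w with
  | nil => exact h0
  | cons k w ih =>
    rw [← wordF_basis, end_apply_apply, hC, ih]
    simp

/-- The span of the elements `f_{u_1} ⋯ f_{u_n} s t` of the word module, for Serre elements `s`
in the `f_i` and arbitrary vectors `t`. -/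
def serreSubmodule : Submodule ℂ V :=
  Submodule.span ℂ {x | ∃ (u : List I) (i j : I) (t : V),
    x = (u.map (wordF b)).prod (serreElt A (wordF b) i j t)}

theorem mem_serreSubmodule (u : List I) (i j : I) (t : V) :
    (u.map (wordF b)).prod (serreElt A (wordF b) i j t) ∈ serreSubmodule A b :=
  Submodule.subset_span ⟨u, i, j, t, rfl⟩

theorem serreElt_wordF_mem (i j : I) (t : V) :
    serreElt A (wordF b) i j t ∈ serreSubmodule A b :=
  mem_serreSubmodule A b [] i j t

theorem wordF_stable (k : I) : serreSubmodule A b ≤ (serreSubmodule A b).comap (wordF b k) := by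
  refine Submodule.span_le.2 ?_
  rintro _ ⟨u, i, j, t, rfl⟩
  exact mem_serreSubmodule A b (k :: u) i j t

theorem serreSubmodule_le_comap {C : Module.End ℂ V}
    (hserre : ∀ i j t, ⁅C, serreElt A (wordF b) i j⁆ t ∈ serreSubmodule A b)
    (hF : ∀ k, serreSubmodule A b ≤ (serreSubmodule A b).comap ⁅C, wordF b k⁆) :
    serreSubmodule A b ≤ (serreSubmodule A b).comap C := by
  refine Submodule.span_le.2 ?_
  rintro _ ⟨u, i, j, t, rfl⟩
  rw [SetLike.mem_coe, Submodule.mem_comap]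
  induction u with
  | nil =>
    rw [List.map_nil, List.prod_nil, Module.End.one_apply, end_apply_apply]
    exact add_mem (serreElt_wordF_mem A b i j _) (hserre i j t)
  | cons k u ih =>
    rw [List.map_cons, List.prod_cons, Module.End.mul_apply, end_apply_apply]
    exact add_mem (wordF_stable A b k ih) (hF k (mem_serreSubmodule A b u i j t))

theorem wordH_stable (k : I) : serreSubmodule A b ≤ (serreSubmodule A b).comap (wordH A b k) := by
  refine serreSubmodule_le_comap A b (fun i j t => ?_) fun m x hx => ?_
  · rw [serreElt_eq_ad_pow_succ, lie_ad_pow_of_lie_eq_smul (lie_wordH_wordF A b k i)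
      (lie_wordH_wordF A b k j), ← serreElt_eq_ad_pow_succ]
    exact Submodule.smul_mem _ _ (serreElt_wordF_mem A b i j t)
  · rw [Submodule.mem_comap, lie_wordH_wordF, LinearMap.smul_apply]
    exact Submodule.smul_mem _ _ (wordF_stable A b m hx)

variable [DecidableEq I]

/-- The action of `e_i` on a basis vector of the word module; the empty word is a vacuum vector,
and the recursion expresses `[e_i, f_j] = δ_{ij} h_i`. -/
def wordEAux (i : I) : List I → V
  | [] => 0
  | j :: w => wordF b j (wordEAux i w) + if i = j then wordH A b i (b w) else 0

/-- The action of `e_i` on the word module. -/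
def wordE (i : I) : Module.End ℂ V := b.constr ℂ (wordEAux A b i)

theorem wordE_basis_nil (i : I) : wordE A b i (b []) = 0 :=
  b.constr_basis ℂ _ []

theorem wordE_basis_cons (i j : I) (w : List I) : wordE A b i (b (j :: w)) =
    wordF b j (wordE A b i (b w)) + if i = j then wordH A b i (b w) else 0 := by
  rw [wordE, Module.Basis.constr_basis, Module.Basis.constr_basis, wordEAux]

theorem lie_wordE_wordF (i j : I) :
    ⁅wordE A b i, wordF b j⁆ = if i = j then wordH A b i else 0 := by
  refine b.ext fun w => ?_
  rw [LieRing.of_associative_ring_bracket, LinearMap.sub_apply, Module.End.mul_apply,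
    Module.End.mul_apply, wordF_basis, wordE_basis_cons, add_sub_cancel_left]
  split_ifs <;> rfl

theorem lie_wordH_wordE (i j : I) : ⁅wordH A b i, wordE A b j⁆ = (A i j : ℂ) • wordE A b j := by
  rw [← sub_eq_zero]
  refine eq_zero_of_lie_wordF_eq_zero b (fun k => ?_) ?_
  · rw [sub_lie, lie_lie, smul_lie, lie_wordE_wordF, lie_wordH_wordF, lie_smul, lie_wordE_wordF]
    split_ifs with hjk
    · rw [lie_wordH_wordH, hjk]
      module
    · simp
  · simp [LieRing.of_associative_ring_bracket, wordE_basis_nil, wordH_basis_nil]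

variable {A}

theorem wordE_stable (hA : ∀ i, A i i = 2) (hA0 : ∀ i j, i ≠ j → A i j ≤ 0)
    (hAz : ∀ i j, A i j = 0 → A j i = 0) (k : I) :
    serreSubmodule A b ≤ (serreSubmodule A b).comap (wordE A b k) := by
  refine serreSubmodule_le_comap A b (fun i j t => ?_) fun m x hx => ?_
  · rw [lie_serreElt hA hA0 hAz (lie_wordE_wordF A b) (lie_wordH_wordF A b)]
    exact Submodule.zero_mem (serreSubmodule A b)
  · rw [Submodule.mem_comap, lie_wordE_wordF]
    split_ifs
    · exact wordH_stable A b k hx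
    · exact Submodule.zero_mem (serreSubmodule A b)

theorem serreElt_wordE_basis_nil (i j : I) : serreElt A (wordE A b) i j (b []) = 0 := by
  have ad_pow_basis_nil (n : ℕ) :
      (LieAlgebra.ad ℂ _ (wordE A b i) ^ n) ⁅wordE A b i, wordE A b j⁆ (b []) = 0 := by
    induction n with
    | zero => simp [LieRing.of_associative_ring_bracket, wordE_basis_nil]
    | succ n ih =>
      rw [pow_succ', Module.End.mul_apply, LieAlgebra.ad_apply,
        LieRing.of_associative_ring_bracket, LinearMap.sub_apply, Module.End.mul_apply,
        Module.End.mul_apply, ih, wordE_basis_nil, map_zero, map_zero, sub_zero]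
  exact ad_pow_basis_nil _

theorem serreElt_wordE (hA : ∀ i, A i i = 2) (hA0 : ∀ i j, i ≠ j → A i j ≤ 0)
    (hAz : ∀ i j, A i j = 0 → A j i = 0) (i j : I) : serreElt A (wordE A b) i j = 0 := by
  have lie_wordF_wordE (i j : I) :
      ⁅wordF b i, wordE A b j⁆ = if i = j then -wordH A b i else 0 := by
    rw [← lie_skew, lie_wordE_wordF]
    rcases eq_or_ne i j with rfl | hij
    · rw [if_pos rfl, if_pos rfl]
    · rw [if_neg hij, if_neg hij.symm, neg_zero]
  refine eq_zero_of_lie_wordF_eq_zero b (fun k => ?_) (serreElt_wordE_basis_nil b i j)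
  rw [← lie_skew, neg_eq_zero]
  exact lie_serreElt hA hA0 hAz lie_wordF_wordE
    (fun i j => by rw [neg_lie, lie_wordH_wordE, neg_smul]) k i j

theorem quotient_end_ext {R V : Type*} [Ring R] [AddCommGroup V] [Module R V] {Q : Submodule R V}
    {C D : Module.End R (V ⧸ Q)} {C' D' : Module.End R V}
    (hC : ∀ t, Q.mkQ (C' t) = C (Q.mkQ t)) (hD : ∀ t, Q.mkQ (D' t) = D (Q.mkQ t))
    (h : C' = D') : C = D :=
  Submodule.linearMap_qext _ (LinearMap.ext fun t => by
    rw [LinearMap.comp_apply, LinearMap.comp_apply, ← hC, ← hD, h])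

/-- The representation of the Kac-Moody algebra on the quotient of the word module by its Serre
relations. -/
def wordRep (hA : ∀ i, A i i = 2) (hA0 : ∀ i j, i ≠ j → A i j ≤ 0)
    (hAz : ∀ i j, A i j = 0 → A j i = 0) : KM A →ₗ⁅ℂ⁆ Module.End ℂ (V ⧸ serreSubmodule A b) :=
  let Q := serreSubmodule A b
  let E : I → Module.End ℂ (V ⧸ Q) := fun i => Q.mapQ Q _ (wordE_stable b hA hA0 hAz i)
  let F : I → Module.End ℂ (V ⧸ Q) := fun i => Q.mapQ Q _ (wordF_stable A b i)
  let H : I → Module.End ℂ (V ⧸ Q) := fun i => Q.mapQ Q _ (wordH_stable A b i)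
  have hE (i : I) (t : V) : Q.mkQ (wordE A b i t) = E i (Q.mkQ t) := rfl
  have hF (i : I) (t : V) : Q.mkQ (wordF b i t) = F i (Q.mkQ t) := rfl
  have hH (i : I) (t : V) : Q.mkQ (wordH A b i t) = H i (Q.mkQ t) := rfl
  have h0 (t : V) : Q.mkQ ((0 : Module.End ℂ V) t) = (0 : Module.End ℂ (V ⧸ Q)) (Q.mkQ t) := rfl
  lift A E F H
    (fun i j => quotient_end_ext (intertwine_lie (hH i) (hH j)) h0 (lie_wordH_wordH A b i j))
    (fun i => quotient_end_ext (intertwine_lie (hE i) (hF i)) (hH i)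
      ((lie_wordE_wordF A b i i).trans (if_pos rfl)))
    (fun i j hij => quotient_end_ext (intertwine_lie (hE i) (hF j)) h0
      ((lie_wordE_wordF A b i j).trans (if_neg hij)))
    (fun i j => quotient_end_ext (D' := A i j • wordE A b j) (intertwine_lie (hH i) (hE j))
      (fun t => map_zsmul Q.mkQ (A i j) (wordE A b j t))
      (by rw [lie_wordH_wordE, Int.cast_smul_eq_zsmul]))
    (fun i j => quotient_end_ext (D' := -(A i j • wordF b j)) (intertwine_lie (hH i) (hF j))
      (fun t => (map_neg Q.mkQ _).trans (congrArg _ (map_zsmul Q.mkQ (A i j) (wordF b j t))))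
      (by rw [lie_wordH_wordF, neg_smul, Int.cast_smul_eq_zsmul]))
    (fun i j => quotient_end_ext (intertwine_serreElt hE i j) h0 (serreElt_wordE b hA hA0 hAz i j))
    (fun i j => Submodule.linearMap_qext _ (LinearMap.ext fun t =>
      (intertwine_serreElt (A := A) hF i j t).symm.trans
        ((Submodule.Quotient.mk_eq_zero Q).2 (serreElt_wordF_mem A b i j t))))

theorem wordRep_iterBracket_f (hA : ∀ i, A i i = 2) (hA0 : ∀ i j, i ≠ j → A i j ≤ 0)
    (hAz : ∀ i j, A i j = 0 → A j i = 0) {w : List I} (hw : w ≠ []) (t : V) :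
    wordRep b hA hA0 hAz (iterBracket (f A) w) ((serreSubmodule A b).mkQ t) =
      (serreSubmodule A b).mkQ (iterBracket (wordF b) w t) := by
  have hf (i : I) (t : V) : (serreSubmodule A b).mkQ (wordF b i t) =
      wordRep b hA hA0 hAz (f A i) ((serreSubmodule A b).mkQ t) := by
    rw [wordRep, lift_f]
    rfl
  rw [intertwine_iterBracket hf, map_iterBracket (LieHom.map_lie _) _ hw]

/-- The linear map from the word module to a space with operators `x_i` sending the word `w` to
`x_{w_1} ⋯ x_{w_n} v`. -/
def wordEval {M : Type*} [AddCommGroup M] [Module ℂ M] (x : I → Module.End ℂ M) (v : M) :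
    V →ₗ[ℂ] M :=
  b.constr ℂ fun w => (w.map x).prod v

section WordEval

variable {M : Type*} [AddCommGroup M] [Module ℂ M] (x : I → Module.End ℂ M) (v : M)

omit [DecidableEq I]

theorem wordEval_basis (w : List I) : wordEval b x v (b w) = (w.map x).prod v :=
  b.constr_basis ℂ _ w

theorem wordEval_wordF (i : I) (t : V) : wordEval b x v (wordF b i t) = x i (wordEval b x v t) := by
  suffices wordEval b x v ∘ₗ wordF b i = x i ∘ₗ wordEval b x v from LinearMap.congr_fun this t
  refine b.ext fun w => ?_
  rw [LinearMap.comp_apply, LinearMap.comp_apply, wordF_basis, wordEval_basis, wordEval_basis,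
    List.map_cons, List.prod_cons, Module.End.mul_apply]

variable {x v}

theorem wordEval_mem {R : Submodule ℂ M} (hx : ∀ i, ∀ p ∈ R, x i p ∈ R) (hv : v ∈ R) (t : V) :
    wordEval b x v t ∈ R := by
  suffices LinearMap.range (wordEval b x v) ≤ R from this ⟨t, rfl⟩
  rw [wordEval, Module.Basis.constr_range, Submodule.span_le]
  rintro _ ⟨w, rfl⟩
  change (w.map x).prod v ∈ R
  induction w with
  | nil => exact hv
  | cons i w ih =>
    rw [List.map_cons, List.prod_cons, Module.End.mul_apply]
    exact hx i _ ih

theorem serreSubmodule_le_comap_wordEval {K : Submodule ℂ M} (hx : ∀ i, ∀ p ∈ K, x i p ∈ K)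
    (hserre : ∀ i j t, serreElt A x i j (wordEval b x v t) ∈ K) :
    serreSubmodule A b ≤ K.comap (wordEval b x v) := by
  refine Submodule.span_le.2 ?_
  rintro _ ⟨u, i, j, t, rfl⟩
  rw [SetLike.mem_coe, Submodule.mem_comap]
  induction u with
  | nil =>
    rw [List.map_nil, List.prod_nil, Module.End.one_apply,
      intertwine_serreElt (wordEval_wordF b x v)]
    exact hserre i j t
  | cons k u ih =>
    rw [List.map_cons, List.prod_cons, Module.End.mul_apply, wordEval_wordF]
    exact hx k _ ih

end WordEval

/-- Linear relations between the `[f_{w_1}, [f_{w_2}, …]]` are consequences of the Serre relations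
alone, also when the relations are read modulo a subspace `K`. -/
theorem sum_iterBracket_apply_mem (hA : ∀ i, A i i = 2) (hA0 : ∀ i j, i ≠ j → A i j ≤ 0)
    (hAz : ∀ i j, A i j = 0 → A j i = 0) {M : Type*} [AddCommGroup M] [Module ℂ M]
    {x : I → Module.End ℂ M} {v : M} {R K : Submodule ℂ M} (hv : v ∈ R)
    (hR : ∀ i, ∀ p ∈ R, x i p ∈ R) (hK : ∀ i, ∀ p ∈ K, x i p ∈ K)
    (hserre : ∀ i j, ∀ p ∈ R, serreElt A x i j p ∈ K) {s : Finset (List I)} {a : List I → ℂ}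
    (hne : ∀ w ∈ s, w ≠ []) (hs : ∑ w ∈ s, a w • iterBracket (f A) w = 0) :
    ∑ w ∈ s, a w • iterBracket x w v ∈ K := by
  let b : Module.Basis (List I) ℂ (List I →₀ ℂ) := Finsupp.basisSingleOne
  have hmem : ∑ w ∈ s, a w • iterBracket (wordF b) w (b []) ∈ serreSubmodule A b := by
    rw [← Submodule.Quotient.mk_eq_zero, ← Submodule.mkQ_apply, map_sum]
    have hrep := congrArg (wordRep b hA hA0 hAz · ((serreSubmodule A b).mkQ (b []))) hs
    simp only [map_sum, map_smul, LinearMap.sum_apply, LinearMap.smul_apply, map_zero,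
      LinearMap.zero_apply] at hrep
    rw [← hrep]
    refine Finset.sum_congr rfl fun w hw => ?_
    rw [map_smul, wordRep_iterBracket_f b hA hA0 hAz (hne w hw)]
  have hle := serreSubmodule_le_comap_wordEval b hK fun i j t =>
    hserre i j _ (wordEval_mem b hR hv t)
  have heval (w : List I) : wordEval b x v (a w • iterBracket (wordF b) w (b [])) =
      a w • iterBracket x w v := by
    rw [map_smul, intertwine_iterBracket (wordEval_wordF b x v), wordEval_basis, List.map_nil,
      List.prod_nil, Module.End.one_apply]
  simpa only [Submodule.mem_comap, map_sum, heval] using hle hmem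

end WordModule

/-! ### Relations up to lower order terms -/

section Rees

attribute [local instance] LieRing.ofAssociativeRing

variable {L : Type*} [LieRing L] [LieAlgebra ℂ L]

/-- The operator by which `v tⁿ` acts on `L[[t]] ⊕ ℂ δ`, where `[v tⁿ, δ] = n v tⁿ`. The summand
`δ` makes the action recover `v` from the operator for `n ≠ 0`. -/
def shiftOp (n : ℕ) (v : L) : Module.End ℂ ((ℕ → L) × ℂ) where
  toFun p :=
    (fun m => if n ≤ m then ⁅v, p.1 (m - n)⁆ + (if m = n then (p.2 * n) • v else 0) else 0, 0)
  map_add' p q := by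
    ext m
    · simp only [Prod.fst_add, Pi.add_apply, Prod.snd_add, lie_add]
      split_ifs <;> module
    · simp
  map_smul' a p := by
    ext m
    · simp only [Prod.smul_fst, Pi.smul_apply, Prod.smul_snd, lie_smul, smul_eq_mul,
        RingHom.id_apply]
      split_ifs <;> module
    · simp

theorem shiftOp_fst (n : ℕ) (v : L) (p : (ℕ → L) × ℂ) (m : ℕ) : (shiftOp n v p).1 m =
    if n ≤ m then ⁅v, p.1 (m - n)⁆ + (if m = n then (p.2 * n) • v else 0) else 0 := rfl

theorem shiftOp_snd (n : ℕ) (v : L) (p : (ℕ → L) × ℂ) : (shiftOp n v p).2 = 0 := rfl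

theorem shiftOp_fst_add (n : ℕ) (v : L) (p : (ℕ → L) × ℂ) (k : ℕ) :
    (shiftOp n v p).1 (n + k) = ⁅v, p.1 k⁆ + if k = 0 then (p.2 * n) • v else 0 := by
  simp [shiftOp_fst]

theorem shiftOp_fst_of_lt {n m : ℕ} (hm : m < n) (v : L) (p : (ℕ → L) × ℂ) :
    (shiftOp n v p).1 m = 0 := by
  rw [shiftOp_fst, if_neg (by omega)]

theorem shiftOp_delta (n : ℕ) (v : L) (m : ℕ) :
    (shiftOp n v (0, 1)).1 m = if m = n then (n : ℂ) • v else 0 := by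
  rw [shiftOp_fst]
  split_ifs <;> first | omega | simp

theorem shiftOp_shiftOp_fst_of_lt {n n' m : ℕ} (hm : m < n + n') (v v' : L) (p : (ℕ → L) × ℂ) :
    (shiftOp n v (shiftOp n' v' p)).1 m = 0 := by
  rcases lt_or_ge m n with hn | hn
  · exact shiftOp_fst_of_lt hn v _
  · obtain ⟨k, rfl⟩ := Nat.exists_eq_add_of_le hn
    rw [shiftOp_fst_add, shiftOp_fst_of_lt (by omega), shiftOp_snd]
    simp

theorem shiftOp_shiftOp_fst_add (n n' : ℕ) (v v' : L) (p : (ℕ → L) × ℂ) (k : ℕ) :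
    (shiftOp n v (shiftOp n' v' p)).1 (n + n' + k) =
      ⁅v, ⁅v', p.1 k⁆ + if k = 0 then (p.2 * n') • v' else 0⁆ := by
  rw [add_assoc, shiftOp_fst_add, shiftOp_fst_add, shiftOp_snd, zero_mul, zero_smul, ite_self,
    add_zero]

theorem lie_shiftOp (n n' : ℕ) (v v' : L) :
    ⁅shiftOp n v, shiftOp n' v'⁆ = shiftOp (n + n') ⁅v, v'⁆ := by
  refine LinearMap.ext fun p => Prod.ext (funext fun m => ?_) (sub_zero 0)
  change (shiftOp n v (shiftOp n' v' p)).1 m - (shiftOp n' v' (shiftOp n v p)).1 m = _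
  rcases lt_or_ge m (n + n') with hm | hm
  · rw [shiftOp_shiftOp_fst_of_lt hm, shiftOp_shiftOp_fst_of_lt (by omega), sub_zero,
      shiftOp_fst_of_lt hm]
  · obtain ⟨k, rfl⟩ := Nat.exists_eq_add_of_le hm
    rw [shiftOp_shiftOp_fst_add, add_comm n n', shiftOp_shiftOp_fst_add, add_comm n' n,
      shiftOp_fst_add, lie_lie]
    split_ifs with hk
    · simp only [lie_add, lie_smul]
      rw [← lie_skew v' v]
      push_cast
      module
    · simp

theorem iterBracket_shiftOp {I : Type*} (g : I → L) {w : List I} (hw : w ≠ []) :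
    iterBracket (fun i => shiftOp 1 (g i)) w = shiftOp w.length (iterBracket g w) := by
  induction w, hw using List.recNeNil with
  | singleton i => rfl
  | cons i w hw ih =>
    rw [iterBracket_cons _ _ hw, iterBracket_cons _ _ hw, ih, lie_shiftOp, List.length_cons,
      add_comm]

theorem serreElt_shiftOp {I : Type*} {A : Matrix I I ℤ} (g : I → L) (i j : I) :
    serreElt A (fun i => shiftOp 1 (g i)) i j =
      shiftOp ((-A i j).toNat + 2) (serreElt A g i j) := by
  have ad_pow_shiftOp (n : ℕ) :
      (LieAlgebra.ad ℂ _ (shiftOp 1 (g i)) ^ n) ⁅shiftOp 1 (g i), shiftOp 1 (g j)⁆ =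
        shiftOp (n + 2) ((LieAlgebra.ad ℂ L (g i) ^ n) ⁅g i, g j⁆) := by
    induction n with
    | zero => exact lie_shiftOp 1 1 (g i) (g j)
    | succ n ih =>
      rw [pow_succ', pow_succ', Module.End.mul_apply, Module.End.mul_apply, ih,
        LieAlgebra.ad_apply, LieAlgebra.ad_apply, lie_shiftOp]
      congr 1
      omega
  exact ad_pow_shiftOp _

variable (U : ℕ → Submodule ℂ L)

/-- The Rees module `∏ U_m t^m ⊕ ℂ δ` of a filtration `U`. -/
def reesSubmodule : Submodule ℂ ((ℕ → L) × ℂ) where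
  carrier := {p | ∀ m, p.1 m ∈ U m}
  add_mem' hp hq m := (U m).add_mem (hp m) (hq m)
  zero_mem' m := (U m).zero_mem
  smul_mem' c _ hp m := (U m).smul_mem c (hp m)

/-- The submodule `∏ U_m t^(m+1)` of the Rees module of a filtration `U`, on which the leading terms
vanish. -/
def lowerReesSubmodule : Submodule ℂ ((ℕ → L) × ℂ) where
  carrier := {p | p.2 = 0 ∧ p.1 0 = 0 ∧ ∀ m, p.1 (m + 1) ∈ U m}
  add_mem' := fun {p q} hp hq => ⟨by simp [hp.1, hq.1], by simp [hp.2.1, hq.2.1],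
    fun m => (U m).add_mem (hp.2.2 m) (hq.2.2 m)⟩
  zero_mem' := ⟨rfl, rfl, fun m => (U m).zero_mem⟩
  smul_mem' c p hp := ⟨by simp [hp.1], by simp [hp.2.1], fun m => (U m).smul_mem c (hp.2.2 m)⟩

variable {U} (hU : ∀ a b, ∀ x ∈ U a, ∀ y ∈ U b, ⁅x, y⁆ ∈ U (a + b))
include hU

theorem shiftOp_fst_add_mem {n : ℕ} {v : L} (hv : v ∈ U n) {p : (ℕ → L) × ℂ} {n' k : ℕ}
    (hp : p.1 k ∈ U k) : (shiftOp n' v p).1 (n' + k) ∈ U (n + k) := by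
  rw [shiftOp_fst_add]
  refine add_mem (hU n k v hv _ hp) ?_
  split_ifs with hk
  · subst hk
    exact (U n).smul_mem _ hv
  · exact zero_mem _

theorem shiftOp_mem_reesSubmodule {n : ℕ} {v : L} (hv : v ∈ U n) {p : (ℕ → L) × ℂ}
    (hp : p ∈ reesSubmodule U) : shiftOp n v p ∈ reesSubmodule U := by
  intro m
  rcases lt_or_ge m n with hm | hm
  · rw [shiftOp_fst_of_lt hm]
    exact zero_mem _
  · obtain ⟨k, rfl⟩ := Nat.exists_eq_add_of_le hm
    exact shiftOp_fst_add_mem hU hv (hp k)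

theorem shiftOp_succ_mem_lowerReesSubmodule {n : ℕ} {v : L} (hv : v ∈ U n) {p : (ℕ → L) × ℂ}
    (hp : p ∈ reesSubmodule U) : shiftOp (n + 1) v p ∈ lowerReesSubmodule U := by
  refine ⟨rfl, shiftOp_fst_of_lt n.succ_pos v p, fun m => ?_⟩
  rcases lt_or_ge m n with hm | hm
  · rw [shiftOp_fst_of_lt (by omega)]
    exact zero_mem _
  · obtain ⟨k, rfl⟩ := Nat.exists_eq_add_of_le hm
    rw [add_right_comm]
    exact shiftOp_fst_add_mem hU hv (hp k)

theorem shiftOp_mem_lowerReesSubmodule {n : ℕ} {v : L} (hv : v ∈ U n) {p : (ℕ → L) × ℂ}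
    (hp : p ∈ lowerReesSubmodule U) : shiftOp n v p ∈ lowerReesSubmodule U := by
  obtain ⟨hδ, h0, hp⟩ := hp
  have hcoeff (k : ℕ) : (shiftOp n v p).1 (n + k) = ⁅v, p.1 k⁆ := by
    rw [shiftOp_fst_add, hδ, zero_mul, zero_smul, ite_self, add_zero]
  refine ⟨rfl, ?_, fun m => ?_⟩
  · rw [shiftOp_fst, hδ, Nat.zero_sub, h0]
    simp
  rcases lt_trichotomy (m + 1) n with hm | rfl | hm
  · rw [shiftOp_fst_of_lt hm]
    exact zero_mem _
  · have h1 := hcoeff 0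
    rw [add_zero, h0, lie_zero] at h1
    rw [h1]
    exact zero_mem _
  · obtain ⟨k, rfl⟩ : ∃ k, m = n + k := Nat.exists_eq_add_of_le (by omega)
    rw [add_assoc, hcoeff]
    exact hU n k v hv _ (hp k)

variable {I : Type*} [DecidableEq I] {A : Matrix I I ℤ}

/-- The operators `g_i t` satisfy the Serre relations modulo `∏ U_m t^(m+1)`, hence so do their
iterated brackets satisfy the relations of the `f_i`; now compare coefficients. -/
theorem sum_iterBracket_mem (hA : ∀ i, A i i = 2) (hA0 : ∀ i j, i ≠ j → A i j ≤ 0)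
    (hAz : ∀ i j, A i j = 0 → A j i = 0) {g : I → L} (hg : ∀ i, g i ∈ U 1)
    (hserre : ∀ i j, serreElt A g i j ∈ U ((-A i j).toNat + 1)) {s : Finset (List I)}
    {a : List I → ℂ} (hne : ∀ w ∈ s, w ≠ []) (hs : ∑ w ∈ s, a w • iterBracket (f A) w = 0)
    (m : ℕ) : ∑ w ∈ s with w.length = m + 1, a w • iterBracket g w ∈ U m := by
  have hrel := sum_iterBracket_apply_mem hA hA0 hAz (v := (0, 1))
    (x := fun i => shiftOp 1 (g i)) (R := reesSubmodule U) (K := lowerReesSubmodule U)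
    (fun m => (U m).zero_mem) (fun i _ hp => shiftOp_mem_reesSubmodule hU (hg i) hp)
    (fun i _ hp => shiftOp_mem_lowerReesSubmodule hU (hg i) hp)
    (fun i j p hp => by
      rw [serreElt_shiftOp]
      exact shiftOp_succ_mem_lowerReesSubmodule hU (hserre i j) hp) hne hs
  have hcoeff := hrel.2.2 m
  have hterm (w : List I) (hw : w ∈ s) :
      (a w • iterBracket (fun i => shiftOp 1 (g i)) w (0, 1)).1 (m + 1) =
        if w.length = m + 1 then ((m + 1 : ℕ) : ℂ) • a w • iterBracket g w else 0 := by
    rw [iterBracket_shiftOp g (hne w hw), Prod.smul_fst, Pi.smul_apply, shiftOp_delta]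
    by_cases hlen : w.length = m + 1
    · rw [if_pos hlen.symm, if_pos hlen, hlen, smul_comm]
    · rw [if_neg (Ne.symm hlen), if_neg hlen, smul_zero]
  rw [Prod.fst_sum, Finset.sum_apply, Finset.sum_congr rfl hterm, ← Finset.sum_filter,
    ← Finset.smul_sum] at hcoeff
  exact ((U m).smul_mem_iff (Nat.cast_ne_zero.2 m.succ_ne_zero)).1 hcoeff

omit hU

theorem f_ne_zero (hA : ∀ i, A i i = 2) (hA0 : ∀ i j, i ≠ j → A i j ≤ 0)
    (hAz : ∀ i j, A i j = 0 → A j i = 0) (j : I) : f A j ≠ 0 := by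
  intro hj
  have hlie (x y : ℂ) : ⁅x, y⁆ = 0 := by
    rw [LieRing.of_associative_ring_bracket, mul_comm, sub_self]
  -- In the abelian Lie algebra `ℂ` all `g_i = 1` satisfy the Serre relations.
  have := sum_iterBracket_mem (L := ℂ) (U := fun m => if m = 0 then ⊥ else ⊤) (g := fun _ => 1)
    (fun a b x _ y _ => by rw [hlie]; exact zero_mem _) hA hA0 hAz (fun _ => by simp)
    (fun _ _ => by simp) (s := {[j]}) (a := fun _ => 1) (by simp)
    (by simpa [iterBracket] using hj) 0
  simp [iterBracket, Finset.filter_singleton] at this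

theorem h_ne_zero (hA : ∀ i, A i i = 2) (hA0 : ∀ i j, i ≠ j → A i j ≤ 0)
    (hAz : ∀ i j, A i j = 0 → A j i = 0) (j : I) : h A j ≠ 0 := by
  intro hj
  have hf := lie_h_f_eq_smul A j j
  rw [hj, zero_lie, hA] at hf
  exact f_ne_zero hA hA0 hAz j ((smul_eq_zero.1 hf.symm).resolve_left (by norm_num))

end Rees

/-! ### The invariant form on the root lattice -/

section Form

variable {I : Type*} [Fintype I] {A : Matrix I I ℤ}

variable (A) in
/-- The bilinear form `(α_i, α_j) = d_i a_ij` on the root lattice, symmetric and invariant under the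
Weyl group if `d` symmetrizes `A`. -/
def rootForm (d : I → ℚ) (β γ : I → ℤ) : ℚ := ∑ i, d i * β i * (A.mulVec γ i : ℤ)

theorem rootForm_comm {d : I → ℚ} (hd : ∀ i j, d i * A i j = d j * A j i) (β γ : I → ℤ) :
    rootForm A d β γ = rootForm A d γ β := by
  simp only [rootForm, Matrix.mulVec, dotProduct, Int.cast_sum, Finset.mul_sum, Int.cast_mul]
  rw [Finset.sum_comm]
  refine Finset.sum_congr rfl fun i _ => Finset.sum_congr rfl fun j _ => ?_
  linear_combination (β j : ℚ) * (γ i : ℚ) * hd j i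

variable [DecidableEq I]

theorem rootForm_simpleRoot_left (d : I → ℚ) (i : I) (γ : I → ℤ) :
    rootForm A d (simpleRoot i) γ = d i * (A.mulVec γ i : ℤ) := by
  simp [rootForm, simpleRoot, Pi.single_apply]

theorem mulVec_simpleRoot (i j : I) : A.mulVec (simpleRoot j) i = A i j := by
  rw [simpleRoot, Matrix.mulVec_single_one, Matrix.col_apply]

theorem rootForm_simpleRoot (d : I → ℚ) (i j : I) :
    rootForm A d (simpleRoot i) (simpleRoot j) = d i * A i j := by
  rw [rootForm_simpleRoot_left, mulVec_simpleRoot]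

theorem rootForm_sub_smul_left (d : I → ℚ) (β γ : I → ℤ) (n : ℤ) (i : I) :
    rootForm A d (β - n • simpleRoot i) γ =
      rootForm A d β γ - n * rootForm A d (simpleRoot i) γ := by
  simp only [rootForm, Finset.mul_sum, ← Finset.sum_sub_distrib]
  refine Finset.sum_congr rfl fun k _ => ?_
  simp only [Pi.sub_apply, Pi.smul_apply, smul_eq_mul, Int.cast_sub, Int.cast_mul]
  ring

theorem rootForm_simpleReflection {d : I → ℚ} (hd : ∀ i j, d i * A i j = d j * A j i)
    (hA : ∀ i, A i i = 2) (i : I) (β γ : I → ℤ) :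
    rootForm A d (simpleReflection A i β) (simpleReflection A i γ) = rootForm A d β γ := by
  rw [simpleReflection_apply, simpleReflection_apply, rootForm_sub_smul_left,
    rootForm_comm hd β, rootForm_comm hd (simpleRoot i) (γ - _), rootForm_sub_smul_left,
    rootForm_sub_smul_left, rootForm_comm hd γ β, rootForm_comm hd γ (simpleRoot i),
    rootForm_simpleRoot, rootForm_simpleRoot_left, rootForm_simpleRoot_left, hA]
  push_cast
  ring

theorem rootForm_weylProd {d : I → ℚ} (hd : ∀ i j, d i * A i j = d j * A j i)
    (hA : ∀ i, A i i = 2) (l : List I) (β γ : I → ℤ) :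
    rootForm A d (weylProd A l β) (weylProd A l γ) = rootForm A d β γ := by
  induction l with
  | nil => rfl
  | cons i l ih => rw [weylProd_cons, weylProd_cons, rootForm_simpleReflection hd hA, ih]

theorem weylProd_apply_of_notMem {l : List I} (β : I → ℤ) {k : I} (hk : k ∉ l) :
    weylProd A l β k = β k := by
  induction l with
  | nil => rfl
  | cons i l ih =>
    rw [weylProd_cons, simpleReflection_apply, Pi.sub_apply, ih fun h => hk (by simp [h])]
    simp [simpleRoot, List.ne_of_not_mem_cons hk]

theorem weylProd_simpleRoot_eq_self {l : List I} {j : I} (hj : ∀ k ∈ l, A k j = 0) :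
    weylProd A l (simpleRoot j) = simpleRoot j := by
  induction l with
  | nil => rfl
  | cons k l ih =>
    rw [weylProd_cons, ih fun m hm => hj m (by simp [hm]), simpleReflection_apply,
      mulVec_simpleRoot, hj k (by simp), zero_smul, sub_zero]

end Form

/-! ### The automorphism `θ` of a generalized Satake diagram -/

section SatakeTheta

variable {I : Type*} {A : Matrix I I ℤ}

theorem IsSymmetrizableGCM.eq_zero_comm (hA : IsSymmetrizableGCM A) (i j : I) (hij : A i j = 0) :
    A j i = 0 := by
  obtain ⟨d, hd0, hd⟩ := hA.symmetrizable
  have hji := hd i j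
  rw [hij, Int.cast_zero, mul_zero] at hji
  exact_mod_cast (mul_eq_zero.1 hji.symm).resolve_left (hd0 j).ne'

variable [DecidableEq I]

/-- The properties of `θ` on which the structure of `𝔨_c` depends; the weight of `θ(f_j)` is
`α_{τ(j)} + γ j`. -/
structure IsSatakeTheta (A : Matrix I I ℤ) (X : Finset I) (τ : Equiv.Perm I) (γ : I → I → ℤ)
    (θ : KM A →ₗ[ℂ] KM A) : Prop where
  map_lie : ∀ x y, θ ⁅x, y⁆ = ⁅θ x, θ y⁆
  eigen : ∀ k ∈ X, ∃ s : ℂ, s ≠ 0 ∧ θ (e A k) = s • e A k ∧ θ (f A k) = s⁻¹ • f A k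
  diagramAut : ∀ i j, A (τ i) (τ j) = A i j
  involutive : ∀ i, τ (τ i) = i
  tau_notMem : ∀ i ∉ X, τ i ∉ X
  f_mem : ∀ j, θ (f A j) ∈ rootSpace A (simpleRoot (τ j) + γ j)
  nonneg : ∀ j ∉ X, ∀ k, 0 ≤ γ j k
  support : ∀ j, ∀ k ∉ X, γ j k = 0
  of_eq_zero : ∀ j ∉ X, γ j = 0 →
    (∀ k ∈ X, A k j = 0) ∧ θ (f A j) = -e A (τ j) ∧ θ (e A j) = -f A (τ j)
  tau_eq_zero : ∀ j ∉ X, γ j = 0 → γ (τ j) = 0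
  theta_theta_f : ∀ i ∉ X, τ i = i → ∃ κ : ℂ, κ ≠ 0 ∧ θ (θ (f A i)) = κ • f A i
  of_eq_simpleRoot : ∀ i ∉ X, τ i = i → ∀ j ∈ X, γ i = simpleRoot j → A j i = -1 ∧ A i j ≠ -1

theorem AdWord_eq_self {l : List I} {x : KM A} (he : ∀ k ∈ l, ⁅e A k, x⁆ = 0)
    (hf : ∀ k ∈ l, ⁅f A k, x⁆ = 0) : AdWord A l x = x := by
  induction l with
  | nil => rfl
  | cons i l ih =>
    rw [AdWord_cons, ih (fun k hk => he k (by simp [hk])) (fun k hk => hf k (by simp [hk])),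
      AdM_eq_self (he i (by simp)) (hf i (by simp))]

theorem AdWord_e_eq_self {l : List I} {j : I} (hj : ∀ k ∈ l, k ≠ j ∧ A k j = 0) :
    AdWord A l (e A j) = e A j := by
  refine AdWord_eq_self (fun k hk => ?_) fun k hk => ?_
  · simpa [(hj k hk).2] using serre_e A k j
  · rw [lie_f_e, if_neg (hj k hk).1]

theorem AdWord_f_eq_self {l : List I} {j : I} (hj : ∀ k ∈ l, k ≠ j ∧ A k j = 0) :
    AdWord A l (f A j) = f A j := by
  refine AdWord_eq_self (fun k hk => lie_e_f_ne A (hj k hk).1) fun k hk => ?_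
  simpa [(hj k hk).2] using serre_f A k j

namespace IsSymmetrizableGCM

theorem theta_h_ne_zero (hA : IsSymmetrizableGCM A) (τ : Equiv.Perm I) (hτ : IsDiagramAut A τ)
    (l : List I) (j : I) : theta A τ hτ l (h A j) ≠ 0 := fun h0 =>
  h_ne_zero hA.diag hA.offDiag hA.eq_zero_comm j
    (eq_zero_of_theta_eq_zero hA.diag (h_mem_cartan A j) h0)

theorem theta_theta_h_ne_zero (hA : IsSymmetrizableGCM A) (τ : Equiv.Perm I)
    (hτ : IsDiagramAut A τ) (l : List I) (j : I) :
    theta A τ hτ l (theta A τ hτ l (h A j)) ≠ 0 := fun h0 =>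
  hA.theta_h_ne_zero τ hτ l j
    (eq_zero_of_theta_eq_zero hA.diag (theta_mem_cartan hA.diag τ hτ l (h_mem_cartan A j)) h0)

end IsSymmetrizableGCM

variable [Fintype I]

/-- The difference `w_X(α_{τ(j)}) - α_{τ(j)}`, an element of `∑_{k ∈ X} ℤ α_k`, where `l` is an
expression of `w_X`. -/
def thetaShift (A : Matrix I I ℤ) (τ : Equiv.Perm I) (l : List I) (j : I) : I → ℤ :=
  weylProd A l (simpleRoot (τ j)) - simpleRoot (τ j)

theorem thetaShift_eq_zero_of_notMem {l : List I} (τ : Equiv.Perm I) (j : I) {k : I}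
    (hk : k ∉ l) : thetaShift A τ l j k = 0 := by
  rw [thetaShift, Pi.sub_apply, weylProd_apply_of_notMem _ hk, sub_self]

theorem theta_f_mem_rootSpace (hA : ∀ i, A i i = 2) (τ : Equiv.Perm I) (hτ : IsDiagramAut A τ)
    (l : List I) (j : I) :
    theta A τ hτ l (f A j) ∈ rootSpace A (simpleRoot (τ j) + thetaShift A τ l j) := by
  have hmem := theta_mem_rootSpace hA τ hτ l (f_mem_rootSpace A j)
  rw [map_neg, thetaRoot_simpleRoot, neg_neg] at hmem
  rwa [thetaShift, add_sub_cancel]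

namespace IsGeneralizedSatake

variable {X : Finset I} {τ : Equiv.Perm I} {l : List I}

theorem tau_mem (hXτ : IsGeneralizedSatake A X τ) (hl : IsLongestWord A X l) {k : I} (hk : k ∈ X) :
    τ k ∈ X := by
  by_contra hτk
  have hcoord := congrFun (hXτ.neg_longest l hl k hk) (τ k)
  have hne : τ k ≠ k := fun h => hτk (h.symm ▸ hk)
  rw [Pi.neg_apply, weylProd_apply_of_notMem _ fun h => hτk (hl.1 _ h)] at hcoord
  simp [simpleRoot, hne] at hcoord

theorem tau_notMem (hXτ : IsGeneralizedSatake A X τ) (hl : IsLongestWord A X l) {k : I}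
    (hk : k ∉ X) : τ k ∉ X := fun h => hk (hXτ.involutive k ▸ hXτ.tau_mem hl h)

theorem thetaShift_eq_zero (hl : IsLongestWord A X l) (j : I) {k : I} (hk : k ∉ X) :
    thetaShift A τ l j k = 0 :=
  thetaShift_eq_zero_of_notMem τ j fun h => hk (hl.1 k h)

theorem thetaRoot_simpleRoot_of_mem (hXτ : IsGeneralizedSatake A X τ) (hl : IsLongestWord A X l)
    {k : I} (hk : k ∈ X) : thetaRoot A τ l (simpleRoot k) = simpleRoot k := by
  rw [thetaRoot_simpleRoot, hXτ.neg_longest l hl _ (hXτ.tau_mem hl hk), hXτ.involutive]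

theorem thetaRoot_eq_self (hXτ : IsGeneralizedSatake A X τ) (hl : IsLongestWord A X l)
    {β : I → ℤ} (hβ : ∀ k ∉ X, β k = 0) : thetaRoot A τ l β = β := by
  rw [← Finset.univ_sum_single β, map_sum]
  refine Finset.sum_congr rfl fun k _ => ?_
  by_cases hk : k ∈ X
  · rw [← mul_one (β k), ← smul_eq_mul, Pi.single_smul, map_smul]
    exact congrArg _ (hXτ.thetaRoot_simpleRoot_of_mem hl hk)
  · rw [hβ k hk, Pi.single_zero, map_zero]

theorem exists_theta_e_eq_smul (hA : IsSymmetrizableGCM A) (hXτ : IsGeneralizedSatake A X τ)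
    (hl : IsLongestWord A X l) {k : I} (hk : k ∈ X) :
    ∃ s : ℂ, s ≠ 0 ∧ theta A τ hXτ.diagramAut l (e A k) = s • e A k ∧
      theta A τ hXτ.diagramAut l (f A k) = s⁻¹ • f A k := by
  have he := theta_mem_rootSpace hA.diag τ hXτ.diagramAut l (e_mem_rootSpace A k)
  have hf := theta_mem_rootSpace hA.diag τ hXτ.diagramAut l (f_mem_rootSpace A k)
  rw [map_neg] at hf
  rw [hXτ.thetaRoot_simpleRoot_of_mem hl hk] at he hf
  obtain ⟨s, hs⟩ := mem_rootSpace_simpleRoot he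
  obtain ⟨s', hs'⟩ := mem_rootSpace_neg_simpleRoot hf
  have hh : theta A τ hXτ.diagramAut l (h A k) = (s * s') • h A k := by
    rw [← lie_e_f_same, theta_lie, ← hs, ← hs', smul_lie, lie_smul, smul_smul]
  have hss' : s * s' ≠ 0 := fun h0 =>
    hA.theta_h_ne_zero τ hXτ.diagramAut l k (by rw [hh, h0, zero_smul])
  have hs0 : s ≠ 0 := left_ne_zero_of_mul hss'
  have he0 : e A k ≠ 0 := fun h0 =>
    h_ne_zero hA.diag hA.offDiag hA.eq_zero_comm k (by rw [← lie_e_f_same, h0, zero_lie])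
  -- Apply `θ` to `[h_k, e_k] = 2 e_k`.
  have hlie := theta_lie τ hXτ.diagramAut l (h A k) (e A k)
  rw [lie_h_e_eq_smul, map_smul, hh, ← hs, hA.diag, smul_lie, lie_smul, lie_h_e_eq_smul, hA.diag,
    smul_smul, smul_smul, smul_smul] at hlie
  have hcoeff : ((2 : ℤ) : ℂ) * s * 1 = ((2 : ℤ) : ℂ) * s * (s * s') := by
    linear_combination smul_left_injective ℂ he0 hlie
  have hone := mul_left_cancel₀ (mul_ne_zero (by norm_num) hs0) hcoeff
  exact ⟨s, hs0, hs.symm, by rw [← hs', eq_inv_of_mul_eq_one_right hone.symm]⟩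

theorem thetaShift_nonneg (hA : IsSymmetrizableGCM A) (hXτ : IsGeneralizedSatake A X τ)
    (hl : IsLongestWord A X l) {j : I} (hj : j ∉ X) (k : I) : 0 ≤ thetaShift A τ l j k := by
  by_contra! hneg
  have hkX : k ∈ X := by
    by_contra hk
    exact hneg.ne (thetaShift_eq_zero hl j hk)
  have hτj := hXτ.tau_notMem hl hj
  have hkj : k ≠ τ j := fun h => hτj (h ▸ hkX)
  have hθf : theta A τ hXτ.diagramAut l (f A j) = 0 := by
    refine eq_zero_of_mem_rootSpace_of_pos_of_neg
      (theta_f_mem_rootSpace hA.diag τ hXτ.diagramAut l j) (i := τ j) (j := k) ?_ ?_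
    · rw [Pi.add_apply, thetaShift_eq_zero hl j hτj]
      simp [simpleRoot]
    · rw [Pi.add_apply, simpleRoot, Pi.single_eq_of_ne hkj, zero_add]
      exact hneg
  exact hA.theta_h_ne_zero τ hXτ.diagramAut l j
    (by rw [← lie_e_f_same, theta_lie, hθf, lie_zero])

/-- With `d` symmetrizing `A`, invariance gives `(α_k, α_{τ(j)}) = -(α_{τ(k)}, α_{τ(j)})`, and
neither form value is positive. -/
theorem apply_tau_eq_zero_of_thetaShift_eq_zero (hA : IsSymmetrizableGCM A)
    (hXτ : IsGeneralizedSatake A X τ) (hl : IsLongestWord A X l) {j : I} (hj : j ∉ X)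
    (hγ : thetaShift A τ l j = 0) {k : I} (hk : k ∈ X) : A k (τ j) = 0 := by
  obtain ⟨d, hd0, hd⟩ := hA.symmetrizable
  have hnonpos (m : I) (hm : m ∈ X) : d m * (A m (τ j) : ℚ) ≤ 0 := by
    refine mul_nonpos_of_nonneg_of_nonpos (hd0 m).le ?_
    exact_mod_cast hA.offDiag m (τ j) fun h => hXτ.tau_notMem hl hj (h ▸ hm)
  have hinv := rootForm_weylProd hd hA.diag l (simpleRoot k) (simpleRoot (τ j))
  have hw : weylProd A l (simpleRoot k) = 0 - (1 : ℤ) • simpleRoot (τ k) := by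
    rw [← hXτ.neg_longest l hl k hk, one_smul, zero_sub, neg_neg]
  have hzero : rootForm A d 0 (simpleRoot (τ j)) = 0 := by simp [rootForm]
  rw [sub_eq_zero.1 hγ, hw, rootForm_sub_smul_left, hzero, rootForm_simpleRoot,
    rootForm_simpleRoot, Int.cast_one] at hinv
  have hk0 : d k * (A k (τ j) : ℚ) = 0 := by
    linarith [hnonpos k hk, hnonpos (τ k) (hXτ.tau_mem hl hk)]
  exact_mod_cast (mul_eq_zero.1 hk0).resolve_left (hd0 k).ne'

theorem apply_eq_zero_of_thetaShift_eq_zero (hA : IsSymmetrizableGCM A)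
    (hXτ : IsGeneralizedSatake A X τ) (hl : IsLongestWord A X l) {j : I} (hj : j ∉ X)
    (hγ : thetaShift A τ l j = 0) {k : I} (hk : k ∈ X) : A k j = 0 := by
  rw [← hXτ.diagramAut]
  exact hXτ.apply_tau_eq_zero_of_thetaShift_eq_zero hA hl hj hγ (hXτ.tau_mem hl hk)

theorem theta_f_of_thetaShift_eq_zero (hA : IsSymmetrizableGCM A)
    (hXτ : IsGeneralizedSatake A X τ) (hl : IsLongestWord A X l) {j : I} (hj : j ∉ X)
    (hγ : thetaShift A τ l j = 0) : theta A τ hXτ.diagramAut l (f A j) = -e A (τ j) := by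
  rw [theta_f, AdWord_e_eq_self fun k hk =>
    ⟨ne_of_mem_of_not_mem (hl.1 k hk) (hXτ.tau_notMem hl hj),
      hXτ.apply_tau_eq_zero_of_thetaShift_eq_zero hA hl hj hγ (hl.1 k hk)⟩]

theorem theta_e_of_thetaShift_eq_zero (hA : IsSymmetrizableGCM A)
    (hXτ : IsGeneralizedSatake A X τ) (hl : IsLongestWord A X l) {j : I} (hj : j ∉ X)
    (hγ : thetaShift A τ l j = 0) : theta A τ hXτ.diagramAut l (e A j) = -f A (τ j) := by
  rw [theta_e, AdWord_f_eq_self fun k hk =>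
    ⟨ne_of_mem_of_not_mem (hl.1 k hk) (hXτ.tau_notMem hl hj),
      hXτ.apply_tau_eq_zero_of_thetaShift_eq_zero hA hl hj hγ (hl.1 k hk)⟩]

theorem thetaShift_tau_eq_zero (hA : IsSymmetrizableGCM A) (hXτ : IsGeneralizedSatake A X τ)
    (hl : IsLongestWord A X l) {j : I} (hj : j ∉ X) (hγ : thetaShift A τ l j = 0) :
    thetaShift A τ l (τ j) = 0 := by
  rw [thetaShift, hXτ.involutive, sub_eq_zero]
  exact weylProd_simpleRoot_eq_self fun k hk =>
    hXτ.apply_eq_zero_of_thetaShift_eq_zero hA hl hj hγ (hl.1 k hk)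

theorem exists_theta_theta_f_eq_smul (hA : IsSymmetrizableGCM A)
    (hXτ : IsGeneralizedSatake A X τ) (hl : IsLongestWord A X l) {i : I} (hi : τ i = i) :
    ∃ κ : ℂ, κ ≠ 0 ∧
      theta A τ hXτ.diagramAut l (theta A τ hXτ.diagramAut l (f A i)) = κ • f A i := by
  have hmem := theta_mem_rootSpace hA.diag τ hXτ.diagramAut l
    (theta_f_mem_rootSpace hA.diag τ hXτ.diagramAut l i)
  have hroot : thetaRoot A τ l (simpleRoot (τ i) + thetaShift A τ l i) = -simpleRoot i := by
    rw [map_add, hXτ.thetaRoot_eq_self hl fun k hk => thetaShift_eq_zero hl i hk, hi,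
      thetaRoot_simpleRoot, thetaShift, hi, neg_add_eq_sub, sub_sub_cancel_left]
  rw [hroot] at hmem
  obtain ⟨κ, hκ⟩ := mem_rootSpace_neg_simpleRoot hmem
  refine ⟨κ, ?_, hκ.symm⟩
  rintro rfl
  apply hA.theta_theta_h_ne_zero τ hXτ.diagramAut l i
  rw [← lie_e_f_same, theta_lie, theta_lie, ← hκ, zero_smul, lie_zero]

theorem weylProd_of_thetaShift_eq_simpleRoot {i j : I} (hi : τ i = i)
    (hγ : thetaShift A τ l i = simpleRoot j) :
    weylProd A l (simpleRoot i) = simpleRoot i - (-1 : ℤ) • simpleRoot j := by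
  rw [thetaShift, hi, sub_eq_iff_eq_add] at hγ
  rw [hγ]
  module

/-- Compare `(α_i + α_j, α_i + α_j) = (α_i, α_i)`. -/
theorem apply_eq_neg_one_of_thetaShift_eq_simpleRoot (hA : IsSymmetrizableGCM A) {i j : I}
    (hi : τ i = i) (hγ : thetaShift A τ l i = simpleRoot j) : A j i = -1 := by
  obtain ⟨d, hd0, hd⟩ := hA.symmetrizable
  have hinv := rootForm_weylProd hd hA.diag l (simpleRoot i) (simpleRoot i)
  rw [weylProd_of_thetaShift_eq_simpleRoot hi hγ, rootForm_sub_smul_left, rootForm_comm hd,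
    rootForm_comm hd (simpleRoot j), rootForm_sub_smul_left, rootForm_sub_smul_left] at hinv
  simp only [rootForm_simpleRoot, hA.diag] at hinv
  push_cast at hinv
  have hji : d j * ((A j i : ℚ) + 1) = 0 := by linear_combination hinv / 2 - hd i j / 2
  have hji' := (mul_eq_zero.1 hji).resolve_left (hd0 j).ne'
  exact_mod_cast eq_neg_of_add_eq_zero_left hji'

theorem apply_ne_neg_one_of_thetaShift_eq_simpleRoot (hXτ : IsGeneralizedSatake A X τ)
    (hl : IsLongestWord A X l) {i j : I} (hi : i ∉ X) (hτi : τ i = i) (hj : j ∈ X)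
    (hγ : thetaShift A τ l i = simpleRoot j) : A i j ≠ -1 := by
  refine hXτ.no_obstruction l hl j hj i hi ?_
  rw [thetaRoot_simpleRoot, hτi, weylProd_of_thetaShift_eq_simpleRoot hτi hγ]
  module

theorem isSatakeTheta (hA : IsSymmetrizableGCM A) (hXτ : IsGeneralizedSatake A X τ)
    (hl : IsLongestWord A X l) :
    IsSatakeTheta A X τ (thetaShift A τ l) (theta A τ hXτ.diagramAut l) where
  map_lie := theta_lie τ _ l
  eigen _ hk := hXτ.exists_theta_e_eq_smul hA hl hk
  diagramAut := hXτ.diagramAut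
  involutive := hXτ.involutive
  tau_notMem _ hi := hXτ.tau_notMem hl hi
  f_mem := theta_f_mem_rootSpace hA.diag τ hXτ.diagramAut l
  nonneg _ hj k := hXτ.thetaShift_nonneg hA hl hj k
  support j _ hk := thetaShift_eq_zero hl j hk
  of_eq_zero _ hj hγ := ⟨fun _ hk => hXτ.apply_eq_zero_of_thetaShift_eq_zero hA hl hj hγ hk,
    hXτ.theta_f_of_thetaShift_eq_zero hA hl hj hγ, hXτ.theta_e_of_thetaShift_eq_zero hA hl hj hγ⟩
  tau_eq_zero _ hj hγ := hXτ.thetaShift_tau_eq_zero hA hl hj hγ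
  theta_theta_f _ _ hτi := hXτ.exists_theta_theta_f_eq_smul hA hl hτi
  of_eq_simpleRoot _ hi hτi _ hj hγ := ⟨apply_eq_neg_one_of_thetaShift_eq_simpleRoot hA hτi hγ,
    hXτ.apply_ne_neg_one_of_thetaShift_eq_simpleRoot hl hi hτi hj hγ⟩

end IsGeneralizedSatake

end SatakeTheta

/-! ### The filtration of `𝔨_c` by word length -/

section Filtration

variable {I : Type*} [DecidableEq I] {A : Matrix I I ℤ} {X : Finset I}
  {τ : Equiv.Perm I} {γ : I → I → ℤ} {θ : KM A →ₗ[ℂ] KM A} {c : I → ℂ}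

theorem exists_lie_f_eq_smul_of_mem_cartan {t : KM A} (ht : t ∈ cartan A) (j : I) :
    ∃ a : ℂ, a • f A j = ⁅t, f A j⁆ :=
  Submodule.mem_span_singleton.1 <| lie_mem_of_mem_cartan ht fun i =>
    Submodule.mem_span_singleton.2 ⟨_, (lie_h_f_eq_smul A i j).symm⟩

theorem lie_mem_nPlus_of_mem_cartan {t x : KM A} (ht : t ∈ cartan A) (hx : x ∈ nPlus A X) :
    ⁅t, x⁆ ∈ nPlus A X := by
  refine lie_mem_lieSpan ?_ hx
  rintro _ ⟨k, hk, rfl⟩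
  exact lie_e_mem_lieSpan_of_mem_cartan ht hk

theorem lie_nPlus_f {x : KM A} (hx : x ∈ nPlus A X) {j : I} (hj : j ∉ X) : ⁅x, f A j⁆ = 0 := by
  refine lie_eq_zero_of_mem_lieSpan ?_ hx
  rintro _ ⟨k, hk, rfl⟩
  exact lie_e_f_ne A (ne_of_mem_of_not_mem hk hj)

theorem gGen_of_mem {j : I} (hj : j ∈ X) : gGen A X θ c j = f A j := if_pos hj

theorem gGen_of_notMem {j : I} (hj : j ∉ X) : gGen A X θ c j = f A j + c j • θ (f A j) :=
  if_neg hj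

variable (A X θ c) in
/-- The filtration of `𝔨_c` by the length of words in the generators `g_i`. -/
def kFiltration (m : ℕ) : Submodule ℂ (KM A) :=
  ((nPlus A X).toSubmodule ⊔ fixedIn (cartan A) θ) ⊔
    Submodule.span ℂ (iterBracket (gGen A X θ c) '' {w | w ≠ [] ∧ w.length ≤ m})

theorem kFiltration_mono {m n : ℕ} (hmn : m ≤ n) :
    kFiltration A X θ c m ≤ kFiltration A X θ c n :=
  sup_le_sup_left (Submodule.span_mono (Set.image_mono fun _ => And.imp_right hmn.trans')) _

theorem nPlus_le_kFiltration (m : ℕ) : (nPlus A X).toSubmodule ≤ kFiltration A X θ c m :=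
  le_sup_of_le_left le_sup_left

theorem fixed_le_kFiltration (m : ℕ) : fixedIn (cartan A) θ ≤ kFiltration A X θ c m :=
  le_sup_of_le_left le_sup_right

theorem iterBracket_mem_kFiltration {w : List I} (hw : w ≠ []) {m : ℕ} (hm : w.length ≤ m) :
    iterBracket (gGen A X θ c) w ∈ kFiltration A X θ c m :=
  Submodule.mem_sup_right (Submodule.subset_span ⟨w, ⟨hw, hm⟩, rfl⟩)

theorem gGen_mem_kFiltration (j : I) : gGen A X θ c j ∈ kFiltration A X θ c 1 :=
  iterBracket_mem_kFiltration (w := [j]) (List.cons_ne_nil j []) le_rfl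

theorem lie_mem_of_mem_kFiltration {m : ℕ} {x : KM A} {V : Submodule ℂ (KM A)}
    (hn : ∀ y ∈ nPlus A X, ⁅x, y⁆ ∈ V) (hh : ∀ y ∈ fixedIn (cartan A) θ, ⁅x, y⁆ ∈ V)
    (hg : ∀ w, w ≠ [] → w.length ≤ m → ⁅x, iterBracket (gGen A X θ c) w⁆ ∈ V) {y : KM A}
    (hy : y ∈ kFiltration A X θ c m) : ⁅x, y⁆ ∈ V := by
  have hV : kFiltration A X θ c m ≤ V.comap (LieAlgebra.ad ℂ (KM A) x) := by
    refine sup_le (sup_le hn hh) (Submodule.span_le.2 ?_)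
    rintro _ ⟨w, ⟨hw, hwm⟩, rfl⟩
    exact hg w hw hwm
  exact hV hy

namespace IsSatakeTheta

variable (hθ : IsSatakeTheta A X τ γ θ)
include hθ

theorem theta_h {k : I} (hk : k ∈ X) : θ (h A k) = h A k := by
  obtain ⟨s, hs, he, hf⟩ := hθ.eigen k hk
  rw [← lie_e_f_same, hθ.map_lie, he, hf, smul_lie, lie_smul, smul_smul, mul_inv_cancel₀ hs,
    one_smul]

theorem h_mem_fixed {k : I} (hk : k ∈ X) : h A k ∈ fixedIn (cartan A) θ :=
  ⟨h_mem_cartan A k, hθ.theta_h hk⟩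

theorem lie_nPlus_theta_f {x : KM A} (hx : x ∈ nPlus A X) {j : I} (hj : j ∉ X) :
    ⁅x, θ (f A j)⁆ = 0 := by
  refine lie_eq_zero_of_mem_lieSpan ?_ hx
  rintro _ ⟨k, hk, rfl⟩
  obtain ⟨s, hs, he, -⟩ := hθ.eigen k hk
  have hθef : θ ⁅e A k, f A j⁆ = ⁅θ (e A k), θ (f A j)⁆ := hθ.map_lie _ _
  rw [lie_e_f_ne A (ne_of_mem_of_not_mem hk hj), map_zero, he, smul_lie] at hθef
  exact (smul_eq_zero.1 hθef.symm).resolve_left hs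

theorem lie_nPlus_gGen {x : KM A} (hx : x ∈ nPlus A X) {j : I} (hj : j ∉ X) :
    ⁅x, gGen A X θ c j⁆ = 0 := by
  rw [gGen_of_notMem hj, lie_add, lie_smul, lie_nPlus_f hx hj, hθ.lie_nPlus_theta_f hx hj,
    smul_zero, add_zero]

theorem lie_e_gGen {k : I} (hk : k ∈ X) (j : I) :
    ⁅e A k, gGen A X θ c j⁆ = if k = j then h A k else 0 := by
  by_cases hj : j ∈ X
  · rw [gGen_of_mem hj, lie_e_f]
  · rw [hθ.lie_nPlus_gGen (e_mem_nPlus hk) hj, if_neg (ne_of_mem_of_not_mem hk hj)]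

theorem lie_fixed_gGen {t : KM A} (ht : t ∈ fixedIn (cartan A) θ) (j : I) :
    ∃ a : ℂ, ⁅t, gGen A X θ c j⁆ = a • gGen A X θ c j := by
  obtain ⟨a, ha⟩ := exists_lie_f_eq_smul_of_mem_cartan ht.1 j
  refine ⟨a, ?_⟩
  by_cases hj : j ∈ X
  · rw [gGen_of_mem hj, ha]
  · have lie_theta_f : ⁅t, θ (f A j)⁆ = a • θ (f A j) := by
      have ht' : θ t = t := ht.2
      rw [← map_smul, ha, hθ.map_lie, ht']
    rw [gGen_of_notMem hj, lie_add, lie_smul, ← ha, lie_theta_f, smul_add, smul_comm]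

theorem lie_fixed_mem_kFiltration {t : KM A} (ht : t ∈ fixedIn (cartan A) θ) {m : ℕ} {y : KM A}
    (hy : y ∈ kFiltration A X θ c m) : ⁅t, y⁆ ∈ kFiltration A X θ c m := by
  refine lie_mem_of_mem_kFiltration (fun y hy => ?_) (fun y hy => ?_) (fun w hw hwm => ?_) hy
  · exact nPlus_le_kFiltration m (lie_mem_nPlus_of_mem_cartan ht.1 hy)
  · rw [lie_eq_zero_of_mem_cartan ht.1 hy.1]
    exact zero_mem _
  · choose a ha using hθ.lie_fixed_gGen (c := c) ht
    rw [lie_iterBracket_of_lie_eq_smul ha hw]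
    exact Submodule.smul_mem _ _ (iterBracket_mem_kFiltration hw hwm)

theorem lie_f_nPlus {j : I} {x : KM A} (hj : j ∈ X) (hx : x ∈ nPlus A X) :
    ⁅f A j, x⁆ ∈ fixedIn (cartan A) θ ⊔ (nPlus A X).toSubmodule := by
  refine lie_mem_sup_lieSpan ?_ ?_ hx
  · rintro t ht _ ⟨k, hk, rfl⟩
    exact lie_e_mem_lieSpan_of_mem_cartan ht.1 hk
  · rintro _ ⟨k, -, rfl⟩
    rw [lie_f_e]
    split_ifs
    exacts [neg_mem (hθ.h_mem_fixed hj), zero_mem _]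

theorem lie_gGen_mem_kFiltration (j : I) {m : ℕ} {y : KM A} (hy : y ∈ kFiltration A X θ c m) :
    ⁅gGen A X θ c j, y⁆ ∈ kFiltration A X θ c (m + 1) := by
  refine lie_mem_of_mem_kFiltration (fun y hy => ?_) (fun y hy => ?_) (fun w hw hwm => ?_) hy
  · by_cases hj : j ∈ X
    · rw [gGen_of_mem hj]
      exact sup_le (fixed_le_kFiltration _) (nPlus_le_kFiltration _) (hθ.lie_f_nPlus hj hy)
    · rw [lie_mem_comm, hθ.lie_nPlus_gGen hy hj]
      exact zero_mem _
  · obtain ⟨a, ha⟩ := hθ.lie_fixed_gGen (c := c) hy j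
    rw [lie_mem_comm, ha]
    exact Submodule.smul_mem _ _
      (kFiltration_mono (Nat.le_add_left 1 m) (gGen_mem_kFiltration j))
  · rw [← iterBracket_cons _ _ hw]
    exact iterBracket_mem_kFiltration (List.cons_ne_nil j w) (Nat.succ_le_succ hwm)

theorem lie_e_iterBracket_gGen_mem_kFiltration {k : I} (hk : k ∈ X) {w : List I} (hw : w ≠ []) :
    ⁅e A k, iterBracket (gGen A X θ c) w⁆ ∈ kFiltration A X θ c w.length := by
  induction w, hw using List.recNeNil with
  | singleton j =>
    change ⁅e A k, gGen A X θ c j⁆ ∈ _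
    rw [hθ.lie_e_gGen hk]
    split_ifs
    exacts [fixed_le_kFiltration _ (hθ.h_mem_fixed hk), zero_mem _]
  | cons j w hw ih =>
    rw [iterBracket_cons _ _ hw, leibniz_lie, hθ.lie_e_gGen hk]
    refine Submodule.add_mem _ ?_ (hθ.lie_gGen_mem_kFiltration j ih)
    split_ifs
    · exact hθ.lie_fixed_mem_kFiltration (hθ.h_mem_fixed hk)
        (iterBracket_mem_kFiltration hw (Nat.le_succ _))
    · rw [zero_lie]
      exact zero_mem _

theorem lie_e_mem_kFiltration {k : I} (hk : k ∈ X) {m : ℕ} {y : KM A}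
    (hy : y ∈ kFiltration A X θ c m) : ⁅e A k, y⁆ ∈ kFiltration A X θ c m := by
  refine lie_mem_of_mem_kFiltration (fun y hy => ?_) (fun y hy => ?_) (fun w hw hwm => ?_) hy
  · exact nPlus_le_kFiltration m ((nPlus A X).lie_mem (e_mem_nPlus hk) hy)
  · exact nPlus_le_kFiltration m
      (lie_mem_comm.1 (lie_mem_nPlus_of_mem_cartan hy.1 (e_mem_nPlus hk)))
  · exact kFiltration_mono hwm (hθ.lie_e_iterBracket_gGen_mem_kFiltration hk hw)

theorem lie_nPlus_mem_kFiltration {x : KM A} (hx : x ∈ nPlus A X) {m : ℕ} {y : KM A}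
    (hy : y ∈ kFiltration A X θ c m) : ⁅x, y⁆ ∈ kFiltration A X θ c m := by
  induction hx using LieSubalgebra.lieSpan_induction generalizing y with
  | mem x hx => obtain ⟨k, hk, rfl⟩ := hx; exact hθ.lie_e_mem_kFiltration hk hy
  | zero => rw [zero_lie]; exact zero_mem _
  | add x z _ _ hx hz => rw [add_lie]; exact add_mem (hx hy) (hz hy)
  | smul a x _ hx => rw [smul_lie]; exact Submodule.smul_mem _ _ (hx hy)
  | lie x z _ _ hx hz => rw [lie_lie]; exact sub_mem (hx (hz hy)) (hz (hx hy))

theorem lie_iterBracket_gGen_mem_kFiltration {w : List I} (hw : w ≠ []) {b : ℕ} {y : KM A}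
    (hy : y ∈ kFiltration A X θ c b) :
    ⁅iterBracket (gGen A X θ c) w, y⁆ ∈ kFiltration A X θ c (w.length + b) := by
  induction w, hw using List.recNeNil generalizing b y with
  | singleton i => exact kFiltration_mono (by simp [add_comm]) (hθ.lie_gGen_mem_kFiltration i hy)
  | cons i w hw ih =>
    rw [iterBracket_cons _ _ hw, lie_lie, List.length_cons]
    exact sub_mem (kFiltration_mono (by lia) (hθ.lie_gGen_mem_kFiltration i (ih hy)))
      (kFiltration_mono (by lia) (ih (hθ.lie_gGen_mem_kFiltration i hy)))

theorem lie_mem_kFiltration {a b : ℕ} {x y : KM A} (hx : x ∈ kFiltration A X θ c a)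
    (hy : y ∈ kFiltration A X θ c b) : ⁅x, y⁆ ∈ kFiltration A X θ c (a + b) := by
  rw [lie_mem_comm]
  refine lie_mem_of_mem_kFiltration (fun x hx => ?_) (fun x hx => ?_) (fun w hw hwa => ?_) hx <;>
    rw [lie_mem_comm]
  · exact kFiltration_mono (Nat.le_add_left b a) (hθ.lie_nPlus_mem_kFiltration hx hy)
  · exact kFiltration_mono (Nat.le_add_left b a) (hθ.lie_fixed_mem_kFiltration hx hy)
  · exact kFiltration_mono (by lia) (hθ.lie_iterBracket_gGen_mem_kFiltration hw hy)

end IsSatakeTheta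

end Filtration

/-! ### The Serre relations for the generators `g_i` -/

section LieAlgebra

variable {R L : Type*} [CommRing R] [LieRing L] [LieAlgebra R L]

theorem ad_pow_succ_apply (x y : L) (n : ℕ) :
    (LieAlgebra.ad R L x ^ (n + 1)) y = ⁅x, (LieAlgebra.ad R L x ^ n) y⁆ := by
  rw [pow_succ', Module.End.mul_apply, LieAlgebra.ad_apply]

theorem commute_ad {x y : L} (hxy : ⁅x, y⁆ = 0) :
    Commute (LieAlgebra.ad R L x) (LieAlgebra.ad R L y) :=
  LinearMap.ext fun z => by
    simp only [Module.End.mul_apply, LieAlgebra.ad_apply, leibniz_lie x y z, hxy, zero_lie,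
      zero_add]

theorem ad_add_smul_pow_mem {x y v : L} (hxy : ⁅x, y⁆ = 0) (a : R) {n : ℕ} {V : Submodule R L}
    (hV : ∀ m ≤ n, (LieAlgebra.ad R L x ^ m) ((LieAlgebra.ad R L y ^ (n - m)) v) ∈ V) :
    (LieAlgebra.ad R L (x + a • y) ^ n) v ∈ V := by
  have hcomm : Commute (LieAlgebra.ad R L x) (LieAlgebra.ad R L (a • y)) :=
    commute_ad (by rw [lie_smul, hxy, smul_zero])
  rw [map_add, hcomm.add_pow, LinearMap.sum_apply]
  refine V.sum_mem fun m hm => ?_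
  rw [← Nat.cast_comm, ← nsmul_eq_mul, LinearMap.smul_apply, Module.End.mul_apply,
    ad_smul_pow_apply, map_smul]
  exact V.smul_of_tower_mem _ (V.smul_mem _ (hV m (Finset.mem_range_succ_iff.1 hm)))

theorem ad_add_smul_pow_eq_zero {x y v : L} (hxy : ⁅x, y⁆ = 0) (a : R) {n : ℕ}
    (h0 : ∀ m ≤ n, (LieAlgebra.ad R L x ^ m) ((LieAlgebra.ad R L y ^ (n - m)) v) = 0) :
    (LieAlgebra.ad R L (x + a • y) ^ n) v = 0 :=
  (Submodule.mem_bot R).1 <| ad_add_smul_pow_mem hxy a fun m hm =>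
    (Submodule.mem_bot R).2 (h0 m hm)

theorem ad_add_pow_apply_of_lie_eq_zero {x y v : L}
    (h0 : ∀ k : ℕ, ⁅y, (LieAlgebra.ad R L x ^ k) v⁆ = 0) (n : ℕ) :
    (LieAlgebra.ad R L (x + y) ^ n) v = (LieAlgebra.ad R L x ^ n) v := by
  induction n with
  | zero => rfl
  | succ n ih => rw [ad_pow_succ_apply, ih, add_lie, h0, add_zero, ← ad_pow_succ_apply]

/-- Inductively `T ^ k (x 0)` agrees with `x k` up to `U k`. -/
theorem pow_apply_mem_of_three_term_recurrence {V : Type*} [AddCommGroup V] [Module R V]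
    {T : Module.End R V} {U : ℕ → Submodule R V} (hmono : Monotone U)
    (hT : ∀ m, ∀ u ∈ U m, T u ∈ U (m + 1)) {x : ℕ → V} {a : ℕ → R} (h0 : x 0 ∈ U 1)
    (h1 : T (x 0) = x 1) (hx : ∀ k, T (x (k + 1)) = x (k + 2) + a k • x k) {n : ℕ}
    (hn : x n = 0) : (T ^ n) (x 0) ∈ U n := by
  have pow_mem (k : ℕ) : (T ^ k) (x 0) ∈ U (k + 1) := by
    induction k with
    | zero => exact h0
    | succ k ih => rw [pow_succ']; exact hT _ _ ih
  have sub_pow_mem (k : ℕ) :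
      x k - (T ^ k) (x 0) ∈ U k ∧ x (k + 1) - (T ^ (k + 1)) (x 0) ∈ U (k + 1) := by
    induction k with
    | zero => simp [h1]
    | succ k ih =>
      refine ⟨ih.2, ?_⟩
      have hxk : x k ∈ U (k + 1) := by
        rw [← sub_add_cancel (x k) ((T ^ k) (x 0))]
        exact add_mem (hmono k.le_succ ih.1) (pow_mem k)
      have hstep : x (k + 2) - (T ^ (k + 2)) (x 0) =
          T (x (k + 1) - (T ^ (k + 1)) (x 0)) - a k • x k := by
        rw [map_sub, hx, pow_succ' T (k + 1), Module.End.mul_apply]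
        abel
      rw [hstep]
      exact sub_mem (hT _ _ ih.2) (Submodule.smul_mem _ _ (hmono (k + 1).le_succ hxk))
  simpa [hn] using (sub_pow_mem n).1

end LieAlgebra

section Serre

variable {I : Type*} [DecidableEq I] {A : Matrix I I ℤ} {X : Finset I}

theorem ad_pow_mem_rootSpace {β δ : I → ℤ} {x y : KM A} (hx : x ∈ rootSpace A β)
    (hy : y ∈ rootSpace A δ) (n : ℕ) :
    (LieAlgebra.ad ℂ (KM A) x ^ n) y ∈ rootSpace A ((n : ℤ) • β + δ) := by
  induction n with
  | zero => simpa using hy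
  | succ n ih =>
    rw [ad_pow_succ_apply, Nat.cast_succ, add_smul, one_smul, add_comm _ β, add_assoc]
    exact lie_mem_rootSpace hx ih

variable (A) in
theorem ad_f_pow_f (i j : I) :
    (LieAlgebra.ad ℂ (KM A) (f A i) ^ ((-A i j).toNat + 1)) (f A j) = 0 := by
  rw [← serreElt_eq_ad_pow_succ (A := A) (f A) i j]
  exact serre_f A i j

theorem lie_e_ad_f_pow_f {i j : I} (hij : i ≠ j) (hA : A i i = 2) (k : ℕ) :
    ⁅e A i, (LieAlgebra.ad ℂ (KM A) (f A i) ^ (k + 1)) (f A j)⁆ =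
      ((k + 1) * (-(A i j : ℂ) - k)) • (LieAlgebra.ad ℂ (KM A) (f A i) ^ k) (f A j) :=
  lie_ad_pow_of_highestWeight (lie_e_f_same A i) (by rw [lie_h_f_eq_smul, hA]; norm_num)
    (lie_h_f_eq_smul A i j) (lie_e_f_ne A hij) k

omit [DecidableEq I] in
theorem neighbourComponent_eq_empty {i : I} (hi : ∀ k ∈ X, A k i = 0) :
    neighbourComponent A X i = ∅ :=
  Set.eq_empty_of_forall_notMem fun _ hk =>
    Finset.notMem_empty _ (hk ∅
      ⟨Finset.empty_subset X, fun _ hm => absurd hm (Finset.notMem_empty _)⟩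
      fun m hm hmi => absurd (hi m hm) hmi)

theorem ad_f_pow_mem_nPlus {i : I} (hi : i ∉ X) {x : KM A} (hx : x ∈ nPlus A X) (n : ℕ) :
    (LieAlgebra.ad ℂ (KM A) (f A i) ^ n) x ∈ nPlus A X := by
  refine Module.End.pow_apply_mem_of_forall_mem (p := (nPlus A X).toSubmodule) n (fun y hy => ?_)
    x hx
  rw [LieAlgebra.ad_apply, lie_mem_comm, lie_nPlus_f hy hi]
  exact zero_mem _

variable {τ : Equiv.Perm I} {γ : I → I → ℤ} {θ : KM A →ₗ[ℂ] KM A} {c : I → ℂ}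

namespace IsSatakeTheta

variable (hθ : IsSatakeTheta A X τ γ θ)
include hθ

theorem map_ad_pow (x y : KM A) (n : ℕ) :
    θ ((LieAlgebra.ad ℂ (KM A) x ^ n) y) = (LieAlgebra.ad ℂ (KM A) (θ x) ^ n) (θ y) := by
  induction n with
  | zero => rfl
  | succ n ih => rw [ad_pow_succ_apply, ad_pow_succ_apply, hθ.map_lie, ih]

theorem ad_theta_f_pow_theta_f (i j : I) :
    (LieAlgebra.ad ℂ (KM A) (θ (f A i)) ^ ((-A i j).toNat + 1)) (θ (f A j)) = 0 := by
  rw [← hθ.map_ad_pow, ad_f_pow_f, map_zero]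

theorem exists_smul_theta_f_eq {k : I} (hk : k ∈ X) : ∃ s : ℂ, s • θ (f A k) = f A k := by
  obtain ⟨s, hs, -, hf⟩ := hθ.eigen k hk
  exact ⟨s, by rw [hf, smul_smul, mul_inv_cancel₀ hs, one_smul]⟩

theorem ad_theta_f_pow_f (i : I) {j : I} (hj : j ∈ X) :
    (LieAlgebra.ad ℂ (KM A) (θ (f A i)) ^ ((-A i j).toNat + 1)) (f A j) = 0 := by
  obtain ⟨s, hs⟩ := hθ.exists_smul_theta_f_eq hj
  rw [← hs, map_smul, hθ.ad_theta_f_pow_theta_f, smul_zero]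

theorem ad_f_pow_theta_f {i : I} (hi : i ∈ X) (j : I) :
    (LieAlgebra.ad ℂ (KM A) (f A i) ^ ((-A i j).toNat + 1)) (θ (f A j)) = 0 := by
  obtain ⟨s, hs⟩ := hθ.exists_smul_theta_f_eq hi
  rw [← hs, ad_smul_pow_apply, hθ.ad_theta_f_pow_theta_f, smul_zero]

theorem serreElt_gGen_of_mem {i : I} (hi : i ∈ X) (j : I) : serreElt A (gGen A X θ c) i j = 0 := by
  rw [serreElt_eq_ad_pow_succ, gGen_of_mem hi]
  by_cases hj : j ∈ X
  · rw [gGen_of_mem hj, ad_f_pow_f]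
  · rw [gGen_of_notMem hj, map_add, map_smul, ad_f_pow_f, hθ.ad_f_pow_theta_f hi, smul_zero,
      add_zero]

theorem ad_f_pow_ad_theta_f_pow_mem_rootSpace {δ : I → ℤ} {v : KM A} (hv : v ∈ rootSpace A δ)
    (i : I) (m p : ℕ) : (LieAlgebra.ad ℂ (KM A) (f A i) ^ m)
      ((LieAlgebra.ad ℂ (KM A) (θ (f A i)) ^ p) v) ∈
        rootSpace A ((m : ℤ) • -simpleRoot i + ((p : ℤ) • (simpleRoot (τ i) + γ i) + δ)) :=
  ad_pow_mem_rootSpace (f_mem_rootSpace A i) (ad_pow_mem_rootSpace (hθ.f_mem i) hv p) m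

theorem lie_f_theta_f {i : I} (hi : i ∉ X) (hτi : τ i ≠ i) : ⁅f A i, θ (f A i)⁆ = 0 := by
  refine eq_zero_of_mem_rootSpace_of_pos_of_neg
    (lie_mem_rootSpace (f_mem_rootSpace A i) (hθ.f_mem i)) (i := τ i) (j := i) ?_ ?_
  · simp [simpleRoot, hτi, hθ.support i _ (hθ.tau_notMem i hi)]
  · simp [simpleRoot, hτi.symm, hθ.support i _ hi]

theorem ad_gGen_pow_f_eq_zero {i j : I} (hi : i ∉ X) (hτi : τ i ≠ i) (hji : j ≠ i)
    (hjτ : j ≠ τ i) :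
    (LieAlgebra.ad ℂ (KM A) (gGen A X θ c i) ^ ((-A i j).toNat + 1)) (f A j) = 0 := by
  have hγτ := hθ.support i _ (hθ.tau_notMem i hi)
  rw [gGen_of_notMem hi]
  refine ad_add_smul_pow_eq_zero (hθ.lie_f_theta_f hi hτi) _ fun m hm => ?_
  rcases hm.eq_or_lt with rfl | hlt
  · rw [Nat.sub_self, pow_zero, Module.End.one_apply, ad_f_pow_f]
  have hwt := hθ.ad_f_pow_ad_theta_f_pow_mem_rootSpace (f_mem_rootSpace A j) i m
    ((-A i j).toNat + 1 - m)
  have hpos : (0 : ℤ) < (((-A i j).toNat + 1 - m : ℕ) : ℤ) := by lia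
  rcases m.eq_zero_or_pos with rfl | hm0
  · by_cases hj : j ∈ X
    · rw [pow_zero, Module.End.one_apply, Nat.sub_zero, hθ.ad_theta_f_pow_f i hj]
    · refine eq_zero_of_mem_rootSpace_of_pos_of_neg hwt (i := τ i) (j := j) ?_ ?_
      · simp [simpleRoot, hjτ.symm, hγτ]
      · simp [simpleRoot, hjτ, hθ.support i _ hj]
  · refine eq_zero_of_mem_rootSpace_of_pos_of_neg hwt (i := τ i) (j := i) ?_ ?_
    · simpa [simpleRoot, Pi.single_apply, hτi, hjτ.symm, hγτ] using hpos
    · simpa [simpleRoot, Pi.single_apply, hτi.symm, hji.symm, hθ.support i _ hi] using hm0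

theorem ad_gGen_pow_theta_f_eq_zero {i j : I} (hi : i ∉ X) (hτi : τ i ≠ i) (hji : j ≠ i)
    (hjτ : j ≠ τ i) (hj : j ∉ X) :
    (LieAlgebra.ad ℂ (KM A) (gGen A X θ c i) ^ ((-A i j).toNat + 1)) (θ (f A j)) = 0 := by
  rw [gGen_of_notMem hi]
  refine ad_add_smul_pow_eq_zero (hθ.lie_f_theta_f hi hτi) _ fun m hm => ?_
  rcases m.eq_zero_or_pos with rfl | hm0
  · rw [pow_zero, Module.End.one_apply, Nat.sub_zero, hθ.ad_theta_f_pow_theta_f]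
  have hτji : τ j ≠ i := fun h => hjτ (by rw [← h, hθ.involutive])
  have hτij : τ i ≠ τ j := τ.injective.ne hji.symm
  have hwt := hθ.ad_f_pow_ad_theta_f_pow_mem_rootSpace (hθ.f_mem j) i m
    ((-A i j).toNat + 1 - m)
  refine eq_zero_of_mem_rootSpace_of_pos_of_neg hwt (i := τ j) (j := i) ?_ ?_
  · simp [simpleRoot, hτji, hτij.symm, hθ.support i _ (hθ.tau_notMem j hj),
      hθ.support j _ (hθ.tau_notMem j hj)]
  · simpa [simpleRoot, Pi.single_apply, hτi.symm, hτji.symm, hθ.support i _ hi,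
      hθ.support j _ hi] using hm0

theorem serreElt_gGen_of_tau_ne {i j : I} (hi : i ∉ X) (hτi : τ i ≠ i) (hji : j ≠ i)
    (hjτ : j ≠ τ i) : serreElt A (gGen A X θ c) i j = 0 := by
  rw [serreElt_eq_ad_pow_succ]
  by_cases hj : j ∈ X
  · rw [gGen_of_mem hj, hθ.ad_gGen_pow_f_eq_zero hi hτi hji hjτ]
  · rw [gGen_of_notMem hj, map_add, map_smul, hθ.ad_gGen_pow_f_eq_zero hi hτi hji hjτ,
      hθ.ad_gGen_pow_theta_f_eq_zero hi hτi hji hjτ hj, smul_zero, add_zero]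

theorem exists_pos {i : I} (hi : i ∉ X) (hγ : γ i ≠ 0) : ∃ k ∈ X, 0 < γ i k := by
  by_contra! hle
  refine hγ (funext fun k => ?_)
  by_cases hk : k ∈ X
  · exact le_antisymm (hle k hk) (hθ.nonneg i hi k)
  · exact hθ.support i k hk

theorem mem_nPlus_of_mem_rootSpace {i : I} (hi : i ∉ X) (hγ : γ i ≠ 0) {x : KM A}
    (hx : x ∈ rootSpace A (γ i)) : x ∈ nPlus A X := by
  obtain ⟨k, -, hk⟩ := hθ.exists_pos hi hγ
  exact KacMoody.mem_nPlus_of_mem_rootSpace hx hk (hθ.support i)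

theorem ad_theta_f_pow_mem_nPlus {i : I} (hi : i ∉ X) {x : KM A} (hx : x ∈ nPlus A X) (n : ℕ) :
    (LieAlgebra.ad ℂ (KM A) (θ (f A i)) ^ n) x ∈ nPlus A X := by
  refine Module.End.pow_apply_mem_of_forall_mem (p := (nPlus A X).toSubmodule) n (fun y hy => ?_)
    x hx
  rw [LieAlgebra.ad_apply, lie_mem_comm, hθ.lie_nPlus_theta_f hy hi]
  exact zero_mem _

theorem ad_gGen_pow_f_tau_mem_nPlus {i : I} (hi : i ∉ X) (hτi : τ i ≠ i) (hγ : γ i ≠ 0) :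
    (LieAlgebra.ad ℂ (KM A) (gGen A X θ c i) ^ ((-A i (τ i)).toNat + 1)) (f A (τ i)) ∈
      nPlus A X := by
  rw [gGen_of_notMem hi]
  refine ad_add_smul_pow_mem (V := (nPlus A X).toSubmodule) (hθ.lie_f_theta_f hi hτi) _
    fun m hm => ?_
  rcases hm.eq_or_lt with rfl | hlt
  · rw [Nat.sub_self, pow_zero, Module.End.one_apply, ad_f_pow_f]
    exact zero_mem _
  have lie_mem : ⁅θ (f A i), f A (τ i)⁆ ∈ nPlus A X := by
    refine hθ.mem_nPlus_of_mem_rootSpace hi hγ ?_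
    simpa using lie_mem_rootSpace (hθ.f_mem i) (f_mem_rootSpace A (τ i))
  rw [Nat.sub_add_comm (Nat.lt_succ_iff.1 hlt), pow_succ _ (_ - m), Module.End.mul_apply,
    LieAlgebra.ad_apply]
  exact ad_f_pow_mem_nPlus hi (hθ.ad_theta_f_pow_mem_nPlus hi lie_mem _) m

theorem ad_gGen_pow_theta_f_tau_mem_nPlus {i : I} (hi : i ∉ X) (hτi : τ i ≠ i) (hγ : γ i ≠ 0) :
    (LieAlgebra.ad ℂ (KM A) (gGen A X θ c i) ^ ((-A i (τ i)).toNat + 1)) (θ (f A (τ i))) ∈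
      nPlus A X := by
  have hτiX := hθ.tau_notMem i hi
  have hγτ : γ (τ i) ≠ 0 := fun h => hγ (by simpa [hθ.involutive] using hθ.tau_eq_zero _ hτiX h)
  rw [gGen_of_notMem hi]
  refine ad_add_smul_pow_mem (V := (nPlus A X).toSubmodule) (hθ.lie_f_theta_f hi hτi) _
    fun m hm => ?_
  rcases m.eq_zero_or_pos with rfl | hm0
  · rw [pow_zero, Module.End.one_apply, Nat.sub_zero, hθ.ad_theta_f_pow_theta_f]
    exact zero_mem _
  have lie_mem : ⁅f A i, θ (f A (τ i))⁆ ∈ nPlus A X := by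
    refine hθ.mem_nPlus_of_mem_rootSpace hτiX hγτ ?_
    simpa [hθ.involutive] using lie_mem_rootSpace (f_mem_rootSpace A i) (hθ.f_mem (τ i))
  obtain ⟨p, rfl⟩ := Nat.exists_eq_add_one.2 hm0
  rw [← Module.End.mul_apply, ((commute_ad (hθ.lie_f_theta_f hi hτi)).pow_pow _ _).eq,
    Module.End.mul_apply, pow_succ, Module.End.mul_apply, LieAlgebra.ad_apply]
  exact hθ.ad_theta_f_pow_mem_nPlus hi (ad_f_pow_mem_nPlus hi lie_mem p) _

theorem serreElt_gGen_tau_mem_nPlus {i : I} (hi : i ∉ X) (hτi : τ i ≠ i) (hγ : γ i ≠ 0) :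
    serreElt A (gGen A X θ c) i (τ i) ∈ nPlus A X := by
  rw [serreElt_eq_ad_pow_succ, gGen_of_notMem (hθ.tau_notMem i hi), map_add, map_smul]
  exact add_mem (hθ.ad_gGen_pow_f_tau_mem_nPlus hi hτi hγ)
    ((nPlus A X).smul_mem _ (hθ.ad_gGen_pow_theta_f_tau_mem_nPlus hi hτi hγ))

theorem gGen_of_eq_zero {i : I} (hi : i ∉ X) (hγ : γ i = 0) :
    gGen A X θ c i = f A i + (-c i) • e A (τ i) := by
  rw [gGen_of_notMem hi, (hθ.of_eq_zero i hi hγ).2.1, smul_neg, neg_smul]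

theorem apply_tau_self (i : I) : A (τ i) i = A i (τ i) := by
  simpa only [hθ.involutive] using hθ.diagramAut i (τ i)

theorem theta_h_of_eq_zero {i : I} (hi : i ∉ X) (hγ : γ i = 0) : θ (h A i) = -h A (τ i) := by
  obtain ⟨-, hf, he⟩ := hθ.of_eq_zero i hi hγ
  rw [← lie_e_f_same A i, hθ.map_lie, hf, he, neg_lie, lie_neg, neg_neg, ← lie_skew, lie_e_f_same]

theorem lie_gGen_tau {i : I} (hi : i ∉ X) (hγ : γ i = 0) :
    ⁅gGen A X θ c i, gGen A X θ c (τ i)⁆ = ⁅f A i, f A (τ i)⁆ + c (τ i) • h A i -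
      c i • h A (τ i) + (c i * c (τ i)) • ⁅e A (τ i), e A i⁆ := by
  rw [hθ.gGen_of_eq_zero hi hγ, hθ.gGen_of_eq_zero (hθ.tau_notMem i hi) (hθ.tau_eq_zero i hi hγ),
    hθ.involutive]
  simp only [add_lie, lie_add, smul_lie, lie_smul, lie_e_f_same, lie_f_e, if_true]
  module

theorem serreElt_gGen_tau_mem_fixed {i : I} (hi : i ∉ X) (hγ : γ i = 0) (hAi : A i (τ i) = 0)
    (hc : c i = c (τ i)) : serreElt A (gGen A X θ c) i (τ i) ∈ fixedIn (cartan A) θ := by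
  have lie_f_f : ⁅f A i, f A (τ i)⁆ = 0 := by simpa [hAi] using serre_f A i (τ i)
  have lie_e_e : ⁅e A (τ i), e A i⁆ = 0 := by
    simpa [hθ.apply_tau_self, hAi] using serre_e A (τ i) i
  rw [serreElt, hAi, neg_zero, Int.toNat_zero, pow_zero, Module.End.one_apply,
    hθ.lie_gGen_tau hi hγ, lie_f_f, lie_e_e, ← hc, smul_zero, zero_add, add_zero, ← smul_sub]
  refine Submodule.smul_mem _ _ ⟨sub_mem (h_mem_cartan A i) (h_mem_cartan A (τ i)), ?_⟩
  change θ (h A i - h A (τ i)) = h A i - h A (τ i)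
  rw [map_sub, hθ.theta_h_of_eq_zero hi hγ,
    hθ.theta_h_of_eq_zero (hθ.tau_notMem i hi) (hθ.tau_eq_zero i hi hγ), hθ.involutive]
  abel

theorem serreElt_gGen_tau_of_eq_neg_one (hA : ∀ i, A i i = 2) {i : I} (hi : i ∉ X)
    (hτi : τ i ≠ i) (hγ : γ i = 0) (hAi : A i (τ i) = -1) :
    serreElt A (gGen A X θ c) i (τ i) = (2 * (c i + c (τ i))) • gGen A X θ c i := by
  have hAτi : A (τ i) i = -1 := by rw [hθ.apply_tau_self, hAi]
  have lie_f_f_f : ⁅f A i, ⁅f A i, f A (τ i)⁆⁆ = 0 := by simpa [hAi] using serre_f A i (τ i)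
  have lie_e_e_e : ⁅e A (τ i), ⁅e A (τ i), e A i⁆⁆ = 0 := by
    simpa [hAτi] using serre_e A (τ i) i
  have lie_f_e_e : ⁅f A i, ⁅e A (τ i), e A i⁆⁆ = -e A (τ i) := by
    rw [leibniz_lie, lie_f_e, if_neg hτi.symm, zero_lie, zero_add, lie_f_e, if_pos rfl, lie_neg,
      lie_e_h_eq_smul, hAi, Int.cast_neg, Int.cast_one, neg_neg, one_smul]
  have lie_e_f_f : ⁅e A (τ i), ⁅f A i, f A (τ i)⁆⁆ = -f A i := by
    rw [leibniz_lie, lie_e_f_ne A hτi, zero_lie, zero_add, lie_e_f_same, lie_f_h_eq_smul, hAτi,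
      Int.cast_neg, Int.cast_one, neg_one_smul]
  have htoNat : (-A i (τ i)).toNat = 1 := by rw [hAi]; rfl
  rw [serreElt, htoNat, pow_one, LieAlgebra.ad_apply, hθ.lie_gGen_tau hi hγ,
    hθ.gGen_of_eq_zero hi hγ]
  simp only [add_lie, lie_add, lie_sub, smul_lie, lie_smul, lie_f_f_f, lie_e_e_e, lie_f_e_e,
    lie_e_f_f, lie_f_h_eq_smul, lie_e_h_eq_smul, hA, hAi, hAτi]
  push_cast
  module

theorem ad_gGen_pow_f_tau_eq_zero {i : I} (hi : i ∉ X) (hτi : τ i ≠ i) (hγ : γ i = 0)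
    (hAi : A i (τ i) ≤ -2) :
    (LieAlgebra.ad ℂ (KM A) (gGen A X θ c i) ^ ((-A i (τ i)).toNat + 1)) (f A (τ i)) = 0 := by
  rw [gGen_of_notMem hi]
  refine ad_add_smul_pow_eq_zero (hθ.lie_f_theta_f hi hτi) _ fun m hm => ?_
  have hwt := hθ.ad_f_pow_ad_theta_f_pow_mem_rootSpace (f_mem_rootSpace A (τ i)) i m
    ((-A i (τ i)).toNat + 1 - m)
  rw [hγ, add_zero] at hwt
  rcases hm.eq_or_lt with rfl | hlt
  · rw [Nat.sub_self, pow_zero, Module.End.one_apply, ad_f_pow_f]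
  rcases m.eq_zero_or_pos with rfl | hm0
  · refine eq_zero_of_mem_rootSpace_of_two_le hwt (j := τ i) (fun k hk => ?_) ?_
    · simp [simpleRoot, hk]
    · simp [simpleRoot]; lia
  by_cases hm1 : m = (-A i (τ i)).toNat
  · have hsub : (-A i (τ i)).toNat + 1 - m = 1 := by lia
    refine eq_zero_of_mem_rootSpace_of_le_neg_two hwt (j := i) (fun k hk => ?_) ?_
    · simp [simpleRoot, hsub, hk]
    · simp [simpleRoot, hτi.symm]; lia
  · refine eq_zero_of_mem_rootSpace_of_pos_of_neg hwt (i := τ i) (j := i) ?_ ?_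
    · simp [simpleRoot, hτi]; lia
    · simp [simpleRoot, hτi.symm]; lia

theorem ad_gGen_pow_theta_f_tau_eq_zero {i : I} (hi : i ∉ X) (hτi : τ i ≠ i) (hγ : γ i = 0)
    (hAi : A i (τ i) ≤ -2) :
    (LieAlgebra.ad ℂ (KM A) (gGen A X θ c i) ^ ((-A i (τ i)).toNat + 1)) (θ (f A (τ i))) = 0 := by
  have hθfτ := (hθ.of_eq_zero _ (hθ.tau_notMem i hi) (hθ.tau_eq_zero i hi hγ)).2.1
  rw [hθ.involutive] at hθfτ
  rw [gGen_of_notMem hi]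
  refine ad_add_smul_pow_eq_zero (hθ.lie_f_theta_f hi hτi) _ fun m hm => ?_
  rcases m.eq_zero_or_pos with rfl | hm0
  · rw [pow_zero, Module.End.one_apply, Nat.sub_zero, hθ.ad_theta_f_pow_theta_f]
  have hwt := hθ.ad_f_pow_ad_theta_f_pow_mem_rootSpace (e_mem_rootSpace A i) i m
    ((-A i (τ i)).toNat + 1 - m)
  rw [hγ, add_zero] at hwt
  rw [hθfτ, map_neg, map_neg, neg_eq_zero]
  rcases hm.eq_or_lt with rfl | hlt
  · refine eq_zero_of_mem_rootSpace_of_le_neg_two hwt (j := i) (fun k hk => ?_) ?_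
    · simp [simpleRoot, hk]
    · simp [simpleRoot]; lia
  by_cases hm1 : m = 1
  · refine eq_zero_of_mem_rootSpace_of_two_le hwt (j := τ i) (fun k hk => ?_) ?_
    · simp [simpleRoot, hm1, hk]
    · simp [simpleRoot, hτi]; lia
  · refine eq_zero_of_mem_rootSpace_of_pos_of_neg hwt (i := τ i) (j := i) ?_ ?_
    · simp [simpleRoot, hτi]; lia
    · simp [simpleRoot, hτi.symm]; lia

theorem serreElt_gGen_tau_of_le_neg_two {i : I} (hi : i ∉ X) (hτi : τ i ≠ i) (hγ : γ i = 0)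
    (hAi : A i (τ i) ≤ -2) : serreElt A (gGen A X θ c) i (τ i) = 0 := by
  rw [serreElt_eq_ad_pow_succ, gGen_of_notMem (hθ.tau_notMem i hi), map_add, map_smul,
    hθ.ad_gGen_pow_f_tau_eq_zero hi hτi hγ hAi, hθ.ad_gGen_pow_theta_f_tau_eq_zero hi hτi hγ hAi,
    smul_zero, add_zero]

theorem lie_f_theta_f_of_tau_eq {i j : I} (hi : i ∉ X) (hτi : τ i = i) (hγ : γ i = 0)
    (hij : i ≠ j) : ⁅f A i, θ (f A j)⁆ = 0 := by
  have hθe := (hθ.of_eq_zero i hi hγ).2.2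
  rw [hτi] at hθe
  rw [← neg_eq_zero, ← neg_lie, ← hθe, ← hθ.map_lie, lie_e_f_ne A hij, map_zero]

theorem lie_f_ad_e_pow_theta_f (hA : ∀ i, A i i = 2) {i j : I} (hi : i ∉ X) (hτi : τ i = i)
    (hγ : γ i = 0) (hij : i ≠ j) (k : ℕ) :
    ⁅f A i, (LieAlgebra.ad ℂ (KM A) (e A i) ^ (k + 1)) (θ (f A j))⁆ =
      ((k + 1) * (-(A i j : ℂ) - k)) • (LieAlgebra.ad ℂ (KM A) (e A i) ^ k) (θ (f A j)) := by
  have hhi : θ (h A i) = -h A i := by rw [hθ.theta_h_of_eq_zero hi hγ, hτi]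
  refine lie_ad_pow_of_highestWeight (h := -h A i) (by rw [lie_f_e, if_pos rfl])
    (by rw [neg_lie, lie_h_e_eq_smul, hA, Int.cast_ofNat, neg_smul]) ?_
    (hθ.lie_f_theta_f_of_tau_eq hi hτi hγ hij) k
  rw [← hhi, ← hθ.map_lie, lie_h_f_eq_smul, map_smul]

theorem ad_e_pow_theta_f {i : I} (hi : i ∉ X) (hτi : τ i = i) (hγ : γ i = 0) (j : I) :
    (LieAlgebra.ad ℂ (KM A) (e A i) ^ ((-A i j).toNat + 1)) (θ (f A j)) = 0 := by
  have hserre := hθ.ad_theta_f_pow_theta_f i j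
  rw [(hθ.of_eq_zero i hi hγ).2.1, hτi, ← neg_one_smul ℂ, ad_smul_pow_apply] at hserre
  exact (smul_eq_zero.1 hserre).resolve_left (pow_ne_zero _ (neg_ne_zero.2 one_ne_zero))

/-- The elements `x k = ad(f_i)^k(f_j) + (-c_i)^k c_j ad(e_i)^k(θ(f_j))` satisfy a three term
recurrence under `ad(g_i) = ad(f_i) - c_i ad(e_i)`, since `e_i` lowers the `f_i`-string of `f_j` and
`f_i` lowers the `e_i`-string of `θ(f_j)`. -/
theorem serreElt_gGen_mem_of_eq_zero (hA : ∀ i, A i i = 2) {i j : I} (hi : i ∉ X)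
    (hτi : τ i = i) (hγ : γ i = 0) (hij : i ≠ j) (hj : j ∉ X) :
    serreElt A (gGen A X θ c) i j ∈ kFiltration A X θ c ((-A i j).toNat + 1) := by
  let x : ℕ → KM A := fun k => (LieAlgebra.ad ℂ (KM A) (f A i) ^ k) (f A j) +
    ((-c i) ^ k * c j) • (LieAlgebra.ad ℂ (KM A) (e A i) ^ k) (θ (f A j))
  have hx0 : x 0 = gGen A X θ c j := by simp [x, gGen_of_notMem hj]
  have hgi : gGen A X θ c i = f A i + (-c i) • e A i := by rw [hθ.gGen_of_eq_zero hi hγ, hτi]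
  rw [serreElt_eq_ad_pow_succ, ← hx0]
  refine pow_apply_mem_of_three_term_recurrence (x := x)
    (a := fun k => -c i * ((k + 1) * (-(A i j : ℂ) - k))) (fun _ _ => kFiltration_mono)
    (fun m u hu => hθ.lie_gGen_mem_kFiltration i hu) ?_ ?_ (fun k => ?_) ?_
  · rw [hx0]
    exact gGen_mem_kFiltration j
  · rw [LieAlgebra.ad_apply, hgi]
    simp only [x, pow_zero, pow_one, Module.End.one_apply, LieAlgebra.ad_apply, add_lie, lie_add,
      smul_lie, lie_smul, hθ.lie_f_theta_f_of_tau_eq hi hτi hγ hij, lie_e_f_ne A hij]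
    module
  · rw [LieAlgebra.ad_apply, hgi]
    simp only [x, add_lie, lie_add, smul_lie, lie_smul,
      hθ.lie_f_ad_e_pow_theta_f hA hi hτi hγ hij, lie_e_ad_f_pow_f hij (hA i), ← ad_pow_succ_apply]
    module
  · simp only [x, ad_f_pow_f, hθ.ad_e_pow_theta_f hi hτi hγ, smul_zero, add_zero]

theorem serreElt_gGen_eq_zero_of_mem {i j : I} (hi : i ∉ X) (hτi : τ i = i) (hγ : γ i = 0)
    (hj : j ∈ X) (hij : A i j = 0) : serreElt A (gGen A X θ c) i j = 0 := by
  have lie_f_f : ⁅f A i, f A j⁆ = 0 := by simpa [hij] using serre_f A i j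
  rw [serreElt, hθ.gGen_of_eq_zero hi hγ, gGen_of_mem hj, hτi, add_lie, lie_f_f, smul_lie,
    lie_e_f_ne A (ne_of_mem_of_not_mem hj hi).symm, smul_zero, add_zero, map_zero]

theorem lie_theta_f_ad_f_pow_f {i j : I} (hi : i ∉ X) (hτi : τ i = i) (hγ : γ i ≠ 0)
    (hij : i ≠ j) (hj : j ∉ X) (k : ℕ) :
    ⁅θ (f A i), (LieAlgebra.ad ℂ (KM A) (f A i) ^ k) (f A j)⁆ = 0 := by
  obtain ⟨m, hm, hpos⟩ := hθ.exists_pos hi hγ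
  have hmi : m ≠ i := ne_of_mem_of_not_mem hm hi
  have hmj : m ≠ j := ne_of_mem_of_not_mem hm hj
  refine eq_zero_of_mem_rootSpace_of_pos_of_neg (lie_mem_rootSpace (hθ.f_mem i)
    (ad_pow_mem_rootSpace (f_mem_rootSpace A i) (f_mem_rootSpace A j) k)) (i := m) (j := j) ?_ ?_
  · simpa [simpleRoot, hτi, hmi, hmj] using hpos
  · simp [simpleRoot, hτi, hij.symm, hθ.support i j hj]

theorem lie_f_ad_theta_f_pow_theta_f {i j : I} (hi : i ∉ X) (hτi : τ i = i) (hγ : γ i ≠ 0)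
    (hij : i ≠ j) (hj : j ∉ X) (k : ℕ) :
    ⁅f A i, (LieAlgebra.ad ℂ (KM A) (θ (f A i)) ^ k) (θ (f A j))⁆ = 0 := by
  obtain ⟨κ, hκ, hκf⟩ := hθ.theta_theta_f i hi hτi
  have hlie := congrArg θ (hθ.lie_theta_f_ad_f_pow_f hi hτi hγ hij hj k)
  rw [hθ.map_lie, hθ.map_ad_pow, hκf, smul_lie, map_zero] at hlie
  exact (smul_eq_zero.1 hlie).resolve_left hκ

theorem serreElt_gGen_eq_zero_of_notMem {i j : I} (hi : i ∉ X) (hτi : τ i = i) (hγ : γ i ≠ 0)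
    (hij : i ≠ j) (hj : j ∉ X) : serreElt A (gGen A X θ c) i j = 0 := by
  have hf (k : ℕ) : ⁅c i • θ (f A i), (LieAlgebra.ad ℂ (KM A) (f A i) ^ k) (f A j)⁆ = 0 := by
    rw [smul_lie, hθ.lie_theta_f_ad_f_pow_f hi hτi hγ hij hj, smul_zero]
  have hθf (k : ℕ) :
      ⁅f A i, (LieAlgebra.ad ℂ (KM A) (c i • θ (f A i)) ^ k) (θ (f A j))⁆ = 0 := by
    rw [ad_smul_pow_apply, lie_smul, hθ.lie_f_ad_theta_f_pow_theta_f hi hτi hγ hij hj, smul_zero]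
  rw [serreElt_eq_ad_pow_succ, gGen_of_notMem hi, gGen_of_notMem hj, map_add, map_smul,
    ad_add_pow_apply_of_lie_eq_zero hf, add_comm (f A i), ad_add_pow_apply_of_lie_eq_zero hθf,
    ad_smul_pow_apply, ad_f_pow_f, hθ.ad_theta_f_pow_theta_f, smul_zero, smul_zero, add_zero]

end IsSatakeTheta

end Serre

section MixedPow

variable {R L : Type*} [CommRing R] [LieRing L] [LieAlgebra R L]

/-- The part of `ad(y + z)^{p+q} v` of degree `p` in `y` and degree `q` in `z`, where `y` and `z`
need not commute; it is used to compare the terms of `ad(g_i)^n f_j` by their weights. -/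
def mixedPow (y z v : L) : ℕ → ℕ → L
  | 0, 0 => v
  | p + 1, 0 => ⁅y, mixedPow y z v p 0⁆
  | 0, q + 1 => ⁅z, mixedPow y z v 0 q⁆
  | p + 1, q + 1 => ⁅y, mixedPow y z v p (q + 1)⁆ + ⁅z, mixedPow y z v (p + 1) q⁆
termination_by p q => p + q

variable (R) in
theorem mixedPow_zero_right (y z v : L) (p : ℕ) :
    mixedPow y z v p 0 = (LieAlgebra.ad R L y ^ p) v := by
  induction p with
  | zero => simp [mixedPow]
  | succ p ih => rw [mixedPow, ih, ad_pow_succ_apply]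

variable (R) in
theorem ad_add_pow_eq_sum_mixedPow (y z v : L) (n : ℕ) :
    (LieAlgebra.ad R L (y + z) ^ n) v =
      ∑ p ∈ Finset.HasAntidiagonal.antidiagonal n, mixedPow y z v p.1 p.2 := by
  induction n with
  | zero => simp [mixedPow]
  | succ n ih =>
    rw [ad_pow_succ_apply, ih, add_lie, lie_sum, lie_sum]
    cases n with
    | zero => simp [Finset.Nat.antidiagonal_succ, mixedPow, add_comm]
    | succ n =>
      rw [Finset.Nat.antidiagonal_succ_succ', Finset.sum_cons, Finset.sum_cons, Finset.sum_map]
      conv_lhs => rw [Finset.Nat.sum_antidiagonal_succ', Finset.Nat.sum_antidiagonal_succ]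
      simp only [Function.Embedding.coe_prodMap, Function.Embedding.coeFn_mk, Prod.map_fst,
        Prod.map_snd, mixedPow, Finset.sum_add_distrib, Nat.succ_eq_add_one]
      abel

theorem map_mixedPow {ψ : L →ₗ[R] L} (hψ : ∀ x y, ψ ⁅x, y⁆ = ⁅ψ x, ψ y⁆) {y z v : L} {a b d : R}
    (hy : ψ y = a • z) (hz : ψ z = b • y) (hv : ψ v = d • v) (p q : ℕ) :
    ψ (mixedPow y z v p q) = (d * a ^ p * b ^ q) • mixedPow y z v q p := by
  induction p, q using mixedPow.induct with
  | case1 => simp [mixedPow, hv]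
  | case2 p ih =>
    simp only [mixedPow, Nat.succ_eq_add_one, hψ, ih, hy, smul_lie, lie_smul]
    module
  | case3 q ih =>
    simp only [mixedPow, Nat.succ_eq_add_one, hψ, ih, hz, smul_lie, lie_smul]
    module
  | case4 p q ihy ihz =>
    simp only [mixedPow, Nat.succ_eq_add_one, map_add, hψ, ihy, ihz, hy, hz, smul_lie, lie_smul]
    module

end MixedPow

section Serre

variable {I : Type*} [DecidableEq I] {A : Matrix I I ℤ} {X : Finset I}
  {τ : Equiv.Perm I} {γ : I → I → ℤ} {θ : KM A →ₗ[ℂ] KM A} {c : I → ℂ}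

theorem mixedPow_mem_rootSpace {β δ ε : I → ℤ} {y z v : KM A} (hy : y ∈ rootSpace A β)
    (hz : z ∈ rootSpace A δ) (hv : v ∈ rootSpace A ε) (p q : ℕ) :
    mixedPow y z v p q ∈ rootSpace A ((p : ℤ) • β + (q : ℤ) • δ + ε) := by
  have lie_y {p q : ℕ} {x : KM A} (hx : x ∈ rootSpace A ((p : ℤ) • β + (q : ℤ) • δ + ε)) :
      ⁅y, x⁆ ∈ rootSpace A (((p + 1 : ℕ) : ℤ) • β + (q : ℤ) • δ + ε) := by
    convert lie_mem_rootSpace hy hx using 2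
    push_cast
    module
  have lie_z {p q : ℕ} {x : KM A} (hx : x ∈ rootSpace A ((p : ℤ) • β + (q : ℤ) • δ + ε)) :
      ⁅z, x⁆ ∈ rootSpace A ((p : ℤ) • β + ((q + 1 : ℕ) : ℤ) • δ + ε) := by
    convert lie_mem_rootSpace hz hx using 2
    push_cast
    module
  induction p, q using mixedPow.induct with
  | case1 => simpa [mixedPow] using hv
  | case2 p ih => rw [mixedPow]; exact lie_y ih
  | case3 q ih => rw [mixedPow]; exact lie_z ih
  | case4 p q ihy ihz => rw [mixedPow]; exact add_mem (lie_y ihy) (lie_z ihz)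

theorem mixedPow_two_one_eq_zero {i j : I} (hne : i ≠ j) (hii : A i i = 2) (hij : A i j = -2)
    (hji : A j i = -1) {z : KM A} (hz : z ∈ rootSpace A (simpleRoot i + simpleRoot j)) :
    mixedPow (f A i) z (f A j) 2 1 = 0 := by
  obtain ⟨κ, rfl⟩ := mem_rootSpace_simpleRoot_add_simpleRoot hne hz
  have lie_ee_fj : ⁅⁅e A j, e A i⁆, f A j⁆ = -e A i := by
    rw [lie_lie, lie_e_f_ne A hne, lie_zero, lie_e_f_same, lie_e_h_eq_smul, hji]
    push_cast
    module
  have lie_ee_fi : ⁅⁅e A j, e A i⁆, f A i⁆ = (2 : ℂ) • e A j := by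
    rw [lie_lie, lie_e_f_ne A hne.symm, lie_zero, lie_e_f_same, lie_e_h_eq_smul, hij]
    push_cast
    module
  have lie_e_ff : ⁅e A j, ⁅f A i, f A j⁆⁆ = -f A i := by
    rw [leibniz_lie, lie_e_f_ne A hne.symm, zero_lie, zero_add, lie_e_f_same, lie_f_h_eq_smul, hji]
    push_cast
    module
  have lie_ee_ff : ⁅⁅e A j, e A i⁆, ⁅f A i, f A j⁆⁆ = (2 : ℂ) • h A j + h A i := by
    rw [leibniz_lie, lie_ee_fj, lie_ee_fi, smul_lie, lie_e_f_same, lie_neg, lie_f_e, if_pos rfl,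
      neg_neg]
  have lie_f_hh : ⁅f A i, (2 : ℂ) • h A j + h A i⁆ = 0 := by
    rw [lie_add, lie_smul, lie_f_h_eq_smul, lie_f_h_eq_smul, hji, hii]
    push_cast
    module
  have lie_ee_fff : ⁅⁅e A j, e A i⁆, ⁅f A i, ⁅f A i, f A j⁆⁆⁆ = (-2 : ℂ) • f A i := by
    rw [leibniz_lie, lie_ee_fi, lie_ee_ff, lie_f_hh, smul_lie, lie_e_ff]
    module
  simp only [mixedPow, smul_lie, lie_add, lie_smul, lie_ee_fj, lie_ee_ff, lie_f_hh, lie_ee_fff,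
    lie_neg, lie_f_e, if_true, lie_f_h_eq_smul, hii]
  push_cast
  module

namespace IsSatakeTheta

theorem exists_pos_or_eq (hθ : IsSatakeTheta A X τ γ θ) {i j : I} (hi : i ∉ X) (hγ : γ i ≠ 0)
    {q : ℕ} (hq : 0 < q) : (∃ k ∈ X, 0 < (q : ℤ) * γ i k - simpleRoot j k) ∨
      q = 1 ∧ γ i = simpleRoot j := by
  have hq' : (0 : ℤ) < q := Nat.cast_pos.2 hq
  obtain ⟨k, hk, hkpos⟩ := hθ.exists_pos hi hγ
  by_cases hother : ∃ m ∈ X, m ≠ j ∧ 0 < γ i m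
  · obtain ⟨m, hm, hmj, hpos⟩ := hother
    exact .inl ⟨m, hm, by simpa [simpleRoot, hmj] using mul_pos hq' hpos⟩
  have hzero (m : I) (hmj : m ≠ j) : γ i m = 0 := by
    by_cases hm : m ∈ X
    · exact le_antisymm (not_lt.1 fun hpos => hother ⟨m, hm, hmj, hpos⟩) (hθ.nonneg i hi m)
    · exact hθ.support i m hm
  obtain rfl : k = j := by_contra fun hkj => hkpos.ne' (hzero k hkj)
  rcases lt_or_ge 1 ((q : ℤ) * γ i k) with hlt | hle
  · exact .inl ⟨k, hk, by simpa [simpleRoot] using hlt⟩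
  · have hq1 : (q : ℤ) = 1 := by nlinarith
    have hγ1 : γ i k = 1 := by nlinarith
    refine .inr ⟨Nat.cast_eq_one.1 hq1, funext fun m => ?_⟩
    by_cases hm : m = k
    · simp [hm, hγ1, simpleRoot]
    · simp [hzero m hm, hm, simpleRoot]

theorem mixedPow_mem_rootSpace (hθ : IsSatakeTheta A X τ γ θ) {i : I} (hτi : τ i = i) (j : I)
    (a : ℂ) (p q : ℕ) : mixedPow (f A i) (a • θ (f A i)) (f A j) p q ∈
      rootSpace A ((p : ℤ) • -simpleRoot i + (q : ℤ) • (simpleRoot i + γ i) + -simpleRoot j) := by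
  have hz := hθ.f_mem i
  rw [hτi] at hz
  exact KacMoody.mixedPow_mem_rootSpace (f_mem_rootSpace A i) (Submodule.smul_mem _ a hz)
    (f_mem_rootSpace A j) p q

theorem mixedPow_eq_zero (hA : ∀ i, A i i = 2) (hθ : IsSatakeTheta A X τ γ θ) {i j : I}
    (hi : i ∉ X) (hτi : τ i = i) (hγ : γ i ≠ 0) (hj : j ∈ X) (a : ℂ) {p q : ℕ} (hqp : q < p)
    (hpq : p + q = (-A i j).toNat + 1) :
    mixedPow (f A i) (a • θ (f A i)) (f A j) p q = 0 := by
  have hne : i ≠ j := (ne_of_mem_of_not_mem hj hi).symm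
  rcases Nat.eq_zero_or_pos q with rfl | hq
  · rw [mixedPow_zero_right ℂ, show p = (-A i j).toNat + 1 by lia, ad_f_pow_f]
  have hwt := hθ.mixedPow_mem_rootSpace hτi j a p q
  have hwi : ((p : ℤ) • -simpleRoot i + (q : ℤ) • (simpleRoot i + γ i) + -simpleRoot j) i =
      (q : ℤ) - p := by
    simp [simpleRoot, hne, hθ.support i i hi]
    ring
  rcases hθ.exists_pos_or_eq (j := j) hi hγ hq with ⟨k, hk, hpos⟩ | ⟨rfl, hγj⟩
  · have hki : k ≠ i := ne_of_mem_of_not_mem hk hi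
    refine eq_zero_of_mem_rootSpace_of_pos_of_neg hwt (i := k) (j := i) ?_ ?_
    · simpa [simpleRoot, Pi.single_apply, hki, sub_eq_add_neg] using hpos
    · rw [hwi]; lia
  by_cases hp : p = 2
  · subst hp
    have hz := hθ.f_mem i
    rw [hτi, hγj] at hz
    exact mixedPow_two_one_eq_zero hne (hA i) (by lia) (hθ.of_eq_simpleRoot i hi hτi j hj hγj).1
      (Submodule.smul_mem _ a hz)
  · refine eq_zero_of_mem_rootSpace_of_le_neg_two hwt (j := i) (fun k hk => ?_) ?_
    · simp [hγj, simpleRoot, hk]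
    · rw [hwi]; push_cast; lia

theorem mixedPow_eq_zero_swap (hA : ∀ i, A i i = 2) (hθ : IsSatakeTheta A X τ γ θ) {i j : I}
    (hi : i ∉ X) (hτi : τ i = i) (hγ : γ i ≠ 0) (hj : j ∈ X) {a : ℂ} (ha : a ≠ 0) {p q : ℕ}
    (hpq : p < q) (hsum : p + q = (-A i j).toNat + 1) :
    mixedPow (f A i) (a • θ (f A i)) (f A j) p q = 0 := by
  obtain ⟨κ, hκ, hκf⟩ := hθ.theta_theta_f i hi hτi
  obtain ⟨s, hs, -, hsf⟩ := hθ.eigen j hj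
  have hmap := map_mixedPow hθ.map_lie (y := f A i) (z := a • θ (f A i)) (v := f A j)
    (a := a⁻¹) (b := a * κ) (by rw [smul_smul, inv_mul_cancel₀ ha, one_smul])
    (by rw [map_smul, hκf, smul_smul]) hsf q p
  rw [hθ.mixedPow_eq_zero hA hi hτi hγ hj _ hpq (by lia), map_zero] at hmap
  exact (smul_eq_zero.1 hmap.symm).resolve_left (by positivity)

theorem mixedPow_self_mem_nPlus (hθ : IsSatakeTheta A X τ γ θ) {i j : I} (hi : i ∉ X)
    (hτi : τ i = i) (hγ : γ i ≠ 0) (hj : j ∈ X) (a : ℂ) {q : ℕ}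
    (hq : q + q = (-A i j).toNat + 1) :
    mixedPow (f A i) (a • θ (f A i)) (f A j) q q ∈ nPlus A X := by
  have hwt := hθ.mixedPow_mem_rootSpace hτi j a q q
  rcases hθ.exists_pos_or_eq (j := j) hi hγ (q := q) (by lia) with ⟨k, hk, hpos⟩ | ⟨rfl, hγj⟩
  · refine KacMoody.mem_nPlus_of_mem_rootSpace hwt (i := k) ?_ fun m hm => ?_
    · have hki : k ≠ i := ne_of_mem_of_not_mem hk hi
      simpa [simpleRoot, Pi.single_apply, hki, sub_eq_add_neg] using hpos
    · simp [hθ.support i m hm, simpleRoot, (ne_of_mem_of_not_mem hj hm).symm]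
  · exact absurd (by lia) (hθ.of_eq_simpleRoot i hi hτi j hj hγj).2

theorem serreElt_gGen_mem_nPlus (hA : ∀ i, A i i = 2) (hθ : IsSatakeTheta A X τ γ θ) {i j : I}
    (hi : i ∉ X) (hτi : τ i = i) (hγ : γ i ≠ 0) (hj : j ∈ X) (hc : c i ≠ 0) :
    serreElt A (gGen A X θ c) i j ∈ nPlus A X := by
  rw [serreElt_eq_ad_pow_succ, gGen_of_notMem hi, gGen_of_mem hj, ad_add_pow_eq_sum_mixedPow]
  refine Submodule.sum_mem (nPlus A X).toSubmodule fun ⟨p, q⟩ hpq => ?_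
  rw [Finset.HasAntidiagonal.mem_antidiagonal] at hpq
  rcases lt_trichotomy q p with hlt | rfl | hlt
  · rw [hθ.mixedPow_eq_zero hA hi hτi hγ hj _ hlt hpq]
    exact zero_mem _
  · exact hθ.mixedPow_self_mem_nPlus hi hτi hγ hj _ hpq
  · rw [hθ.mixedPow_eq_zero_swap hA hi hτi hγ hj hc hlt hpq]
    exact zero_mem _

theorem serreElt_gGen_tau_mem_kFiltration (hA : ∀ i, A i i = 2) (hθ : IsSatakeTheta A X τ γ θ)
    {i : I} (hi : i ∉ X) (hτi : τ i ≠ i) (hA0 : A i (τ i) ≤ 0)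
    (hdiff : A i (τ i) = 0 → neighbourComponent A X i = ∅ → c i = c (τ i)) (m : ℕ) :
    serreElt A (gGen A X θ c) i (τ i) ∈ kFiltration A X θ c (m + 1) := by
  by_cases hγ : γ i = 0
  · by_cases h0 : A i (τ i) = 0
    · exact fixed_le_kFiltration _ (hθ.serreElt_gGen_tau_mem_fixed hi hγ h0
        (hdiff h0 (neighbourComponent_eq_empty (hθ.of_eq_zero i hi hγ).1)))
    by_cases h1 : A i (τ i) = -1
    · rw [hθ.serreElt_gGen_tau_of_eq_neg_one hA hi hτi hγ h1]
      exact Submodule.smul_mem _ _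
        (kFiltration_mono (Nat.le_add_left 1 m) (gGen_mem_kFiltration i))
    · rw [hθ.serreElt_gGen_tau_of_le_neg_two hi hτi hγ (by lia)]
      exact zero_mem _
  · exact nPlus_le_kFiltration _ (hθ.serreElt_gGen_tau_mem_nPlus hi hτi hγ)

theorem serreElt_gGen_mem_kFiltration_of_tau_eq (hA : IsSymmetrizableGCM A)
    (hθ : IsSatakeTheta A X τ γ θ) {i j : I} (hi : i ∉ X) (hτi : τ i = i) (hij : i ≠ j)
    (hc : c i ≠ 0) :
    serreElt A (gGen A X θ c) i j ∈ kFiltration A X θ c ((-A i j).toNat + 1) := by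
  by_cases hγ : γ i = 0
  · by_cases hj : j ∈ X
    · rw [hθ.serreElt_gGen_eq_zero_of_mem hi hτi hγ hj
        (hA.eq_zero_comm _ _ ((hθ.of_eq_zero i hi hγ).1 j hj))]
      exact zero_mem _
    · exact hθ.serreElt_gGen_mem_of_eq_zero hA.diag hi hτi hγ hij hj
  · by_cases hj : j ∈ X
    · exact nPlus_le_kFiltration _ (hθ.serreElt_gGen_mem_nPlus hA.diag hi hτi hγ hj hc)
    · rw [hθ.serreElt_gGen_eq_zero_of_notMem hi hτi hγ hij hj]
      exact zero_mem _

theorem serreElt_gGen_mem_kFiltration (hA : IsSymmetrizableGCM A) (hθ : IsSatakeTheta A X τ γ θ)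
    (hc : ∀ i ∉ X, c i ≠ 0)
    (hdiff : ∀ j ∉ X, A j (τ j) = 0 → neighbourComponent A X j = ∅ → c j = c (τ j)) (i j : I) :
    serreElt A (gGen A X θ c) i j ∈ kFiltration A X θ c ((-A i j).toNat + 1) := by
  rcases eq_or_ne i j with rfl | hij
  · rw [serreElt_self]
    exact zero_mem _
  by_cases hi : i ∈ X
  · rw [hθ.serreElt_gGen_of_mem hi]
    exact zero_mem _
  by_cases hτi : τ i = i
  · exact hθ.serreElt_gGen_mem_kFiltration_of_tau_eq hA hi hτi hij (hc i hi)
  rcases eq_or_ne j (τ i) with rfl | hj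
  · exact hθ.serreElt_gGen_tau_mem_kFiltration hA.diag hi hτi (hA.offDiag _ _ hij) (hdiff i hi) _
  · rw [hθ.serreElt_gGen_of_tau_ne hi hτi hij.symm hj]
    exact zero_mem _

end IsSatakeTheta

end Serre

/-! ### Leading terms -/

section LeadingTerms

theorem iSupIndep_sumElim {ι κ α : Type*} [CompleteLattice α] [IsModularLattice α] {s : ι → α}
    {t : κ → α} (hs : iSupIndep s) (ht : iSupIndep t) (hst : Disjoint (⨆ i, s i) (⨆ k, t k)) :
    iSupIndep (Sum.elim s t) := by
  rintro (i | k)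
  · refine ((hs i).disjoint_sup_right_of_disjoint_sup_left (hst.mono_left (sup_le (le_iSup s i)
      (iSup₂_le_iSup _ s)))).mono_right (iSup₂_le ?_)
    rintro (j | k) hj
    · exact le_sup_of_le_left (le_iSup₂_of_le j (fun h => hj (congrArg _ h)) le_rfl)
    · exact le_sup_of_le_right (le_iSup t k)
  · refine ((ht k).disjoint_sup_right_of_disjoint_sup_left (hst.symm.mono_left (sup_le (le_iSup t k)
      (iSup₂_le_iSup _ t)))).mono_right (iSup₂_le ?_)
    rintro (j | l) hl
    · exact le_sup_of_le_right (le_iSup s j)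
    · exact le_sup_of_le_left (le_iSup₂_of_le l (fun h => hl (congrArg _ h)) le_rfl)

theorem linearIndependent_mkQ_of_sub_mem {R V ι : Type*} [Ring R] [AddCommGroup V] [Module R V]
    {F : ℕ → Submodule R V} (hF : Monotone F) {d : ι → ℕ} {f g : ι → V}
    (hf : LinearIndependent R f) (hfF : ∀ i, f i ∈ F (d i + 1)) (hgf : ∀ i, g i - f i ∈ F (d i))
    (hdisj : ∀ n, Disjoint (Submodule.span R (f '' {i | d i = n})) (F n)) :
    LinearIndependent R ((F 0).mkQ ∘ g) := by
  have hg (i : ι) : g i ∈ F (d i + 1) := by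
    rw [← sub_add_cancel (g i) (f i)]
    exact add_mem (hF (Nat.le_succ _) (hgf i)) (hfF i)
  rw [linearIndependent_iff']
  intro s a h0
  have hsum : ∑ i ∈ s, a i • g i ∈ F 0 := by
    rw [← Submodule.Quotient.mk_eq_zero, ← Submodule.mkQ_apply, map_sum, ← h0]
    simp only [map_smul, Function.comp_apply]
  suffices key : ∀ N, (∀ i ∈ s, a i ≠ 0 → d i < N) → ∀ i ∈ s, a i = 0 from
    key (s.sup d + 1) fun i hi _ => Nat.lt_succ_of_le (Finset.le_sup hi)
  intro N
  induction N with
  | zero => exact fun hN i hi => by_contra fun hai => Nat.not_lt_zero _ (hN i hi hai)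
  | succ N ih =>
    intro hN
    have hdiff : ∑ i ∈ s, a i • g i - ∑ i ∈ s with d i = N, a i • f i ∈ F N := by
      rw [Finset.sum_filter, ← Finset.sum_sub_distrib]
      refine sum_mem fun i hi => ?_
      by_cases hai : a i = 0
      · simp [hai]
      split_ifs with hd
      · rw [← smul_sub, ← hd]
        exact Submodule.smul_mem _ _ (hgf i)
      · rw [sub_zero]
        exact Submodule.smul_mem _ _ (hF (by have := hN i hi hai; lia) (hg i))
    have htop : ∑ i ∈ s with d i = N, a i • f i = 0 :=
      Submodule.disjoint_def.1 (hdisj N) _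
        (sum_mem fun i hi => Submodule.smul_mem _ _
          (Submodule.subset_span ⟨i, (Finset.mem_filter.1 hi).2, rfl⟩))
        (((F N).sub_mem_iff_right (hF N.zero_le hsum)).1 hdiff)
    exact ih fun i hi hai => (Nat.lt_succ_iff.1 (hN i hi hai)).lt_of_ne fun hd =>
      hai (linearIndependent_iff'.1 hf _ a htop i (Finset.mem_filter.2 ⟨hi, hd⟩))

end LeadingTerms

section Height

variable {I : Type*} [Fintype I] [DecidableEq I] {A : Matrix I I ℤ} {X : Finset I}
  {τ : Equiv.Perm I} {γ : I → I → ℤ} {θ : KM A →ₗ[ℂ] KM A} {c : I → ℂ}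

/-- The height `∑ k, μ k` of a weight `μ = ∑ k, μ k • α_k`. -/
def height : (I → ℤ) →+ ℤ where
  toFun μ := ∑ k, μ k
  map_zero' := Finset.sum_const_zero
  map_add' _ _ := Finset.sum_add_distrib

theorem height_simpleRoot (i : I) : height (simpleRoot i) = 1 := by
  simp [height, simpleRoot]

omit [DecidableEq I] in
theorem height_nonneg {μ : I → ℤ} (hμ : 0 ≤ μ) : 0 ≤ height μ :=
  Finset.sum_nonneg fun k _ => hμ k

theorem height_wordWeight (w : List I) : height (wordWeight w) = w.length := by
  induction w with
  | nil => simp [wordWeight]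
  | cons i w ih =>
    rw [wordWeight_cons, map_add, height_simpleRoot, ih, List.length_cons]
    push_cast
    ring

variable (A) in
/-- The sum of the root spaces of height at least `-n`, so that `f_i` lies in degree `1`; the
increasing filtration for which `f_w` is the leading term of `g_w`. -/
def heightFiltration (n : ℕ) : Submodule ℂ (KM A) :=
  ⨆ μ ∈ {μ | -(n : ℤ) ≤ height μ}, rootSpace A μ

theorem mem_heightFiltration {μ : I → ℤ} {x : KM A} (hx : x ∈ rootSpace A μ) {n : ℕ}
    (hn : -(n : ℤ) ≤ height μ) : x ∈ heightFiltration A n :=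
  le_iSup₂_of_le (f := fun μ (_ : μ ∈ {μ | -(n : ℤ) ≤ height μ}) => rootSpace A μ) μ hn le_rfl hx

theorem heightFiltration_mono : Monotone (heightFiltration A) := fun _ _ hmn =>
  biSup_mono fun μ hμ => by
    rw [Set.mem_ofPred_eq] at hμ ⊢
    exact (neg_le_neg (Nat.cast_le.2 hmn)).trans hμ

theorem lie_mem_heightFiltration {m n : ℕ} {x y : KM A} (hx : x ∈ heightFiltration A m)
    (hy : y ∈ heightFiltration A n) : ⁅x, y⁆ ∈ heightFiltration A (m + n) := by
  have lie_rootSpace {μ : I → ℤ} (hμ : -(m : ℤ) ≤ height μ) {z : KM A} (hz : z ∈ rootSpace A μ) :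
      ⁅z, y⁆ ∈ heightFiltration A (m + n) := by
    have hle : heightFiltration A n ≤
        (heightFiltration A (m + n)).comap (LieAlgebra.ad ℂ (KM A) z) :=
      iSup₂_le fun ν hν u hu => mem_heightFiltration (lie_mem_rootSpace hz hu) (by
        rw [Set.mem_ofPred_eq] at hν
        rw [map_add, Nat.cast_add, neg_add]
        exact add_le_add hμ hν)
    exact hle hy
  have hle : heightFiltration A m ≤
      (heightFiltration A (m + n)).comap (LieAlgebra.ad ℂ (KM A) y) :=
    iSup₂_le fun μ hμ z hz => lie_mem_comm.1 (lie_rootSpace hμ hz)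
  exact lie_mem_comm.1 (hle hx)

theorem iterBracket_f_mem_heightFiltration {w : List I} (hw : w ≠ []) :
    iterBracket (f A) w ∈ heightFiltration A w.length :=
  mem_heightFiltration (iterBracket_f_mem_rootSpace hw) (by rw [map_neg, height_wordWeight])

theorem disjoint_span_iterBracket_f_heightFiltration {J : Set (List I)} {n : ℕ}
    (hJ : ∀ w ∈ J, w.length = n + 1) :
    Disjoint (Submodule.span ℂ (iterBracket (f A) '' J)) (heightFiltration A n) := by
  refine ((iSupIndep_rootSpace A).disjoint_biSup_biSup
    (s := {μ | height μ = -(n + 1 : ℤ)}) ?_).mono_left (Submodule.span_le.2 ?_)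
  · refine Set.disjoint_left.2 fun μ hμ hμn => ?_
    rw [Set.mem_ofPred_eq] at hμ hμn
    lia
  · rintro _ ⟨w, hw, rfl⟩
    refine le_iSup₂_of_le (f := fun μ (_ : μ ∈ {μ | height μ = -(n + 1 : ℤ)}) => rootSpace A μ)
      (-wordWeight w) ?_ le_rfl
      (iterBracket_f_mem_rootSpace (List.ne_nil_of_length_eq_add_one (hJ w hw)))
    rw [Set.mem_ofPred_eq, map_neg, height_wordWeight, hJ w hw, Nat.cast_succ]

theorem nPlus_le_heightFiltration : (nPlus A X).toSubmodule ≤ heightFiltration A 0 := by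
  rw [nPlus_eq_span_iterBracket, Submodule.span_le]
  rintro _ ⟨w, ⟨hw, -⟩, rfl⟩
  exact mem_heightFiltration (iterBracket_e_mem_rootSpace hw)
    (by simpa using height_nonneg (wordWeight_nonneg w))

theorem cartan_le_heightFiltration : cartan A ≤ heightFiltration A 0 := fun _ hx =>
  mem_heightFiltration (cartan_le_rootSpace_zero A hx) (by simp)

omit [Fintype I] in
theorem disjoint_nPlus_cartan : Disjoint (nPlus A X).toSubmodule (cartan A) := by
  refine ((iSupIndep_rootSpace A 0).mono (cartan_le_rootSpace_zero A) ?_).symm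
  rw [nPlus_eq_span_iterBracket, Submodule.span_le]
  rintro _ ⟨w, ⟨hw, -⟩, rfl⟩
  exact le_iSup₂_of_le (f := fun μ (_ : μ ≠ 0) => rootSpace A μ) (wordWeight w)
    (wordWeight_ne_zero hw) le_rfl (iterBracket_e_mem_rootSpace hw)

namespace IsSatakeTheta

variable (hθ : IsSatakeTheta A X τ γ θ)
include hθ

theorem gGen_sub_f_mem_heightFiltration (i : I) :
    gGen A X θ c i - f A i ∈ heightFiltration A 0 := by
  by_cases hi : i ∈ X
  · rw [gGen_of_mem hi, sub_self]
    exact zero_mem _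
  · rw [gGen_of_notMem hi, add_sub_cancel_left]
    refine Submodule.smul_mem _ _ (mem_heightFiltration (hθ.f_mem i) ?_)
    rw [map_add, height_simpleRoot]
    have := height_nonneg (hθ.nonneg i hi)
    lia

theorem iterBracket_gGen_sub_mem_heightFiltration {w : List I} (hw : w ≠ []) :
    iterBracket (gGen A X θ c) w - iterBracket (f A) w ∈ heightFiltration A (w.length - 1) := by
  induction w, hw using List.recNeNil with
  | singleton i => exact hθ.gGen_sub_f_mem_heightFiltration i
  | cons i w hw ih =>
    have hlen : 1 + (w.length - 1) = w.length := Nat.add_sub_cancel' (List.length_pos_of_ne_nil hw)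
    have hg : iterBracket (gGen A X θ c) w ∈ heightFiltration A w.length := by
      rw [← sub_add_cancel (iterBracket (gGen A X θ c) w) (iterBracket (f A) w)]
      exact add_mem (heightFiltration_mono (Nat.sub_le _ _) ih)
        (iterBracket_f_mem_heightFiltration hw)
    have hf : f A i ∈ heightFiltration A 1 :=
      mem_heightFiltration (f_mem_rootSpace A i) (by rw [map_neg, height_simpleRoot, Nat.cast_one])
    have hsplit : iterBracket (gGen A X θ c) (i :: w) - iterBracket (f A) (i :: w) =
        ⁅gGen A X θ c i - f A i, iterBracket (gGen A X θ c) w⁆ +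
          ⁅f A i, iterBracket (gGen A X θ c) w - iterBracket (f A) w⁆ := by
      rw [iterBracket_cons _ _ hw, iterBracket_cons _ _ hw, sub_lie, lie_sub]
      abel
    have hlie := lie_mem_heightFiltration (hθ.gGen_sub_f_mem_heightFiltration (c := c) i) hg
    have hlie' := lie_mem_heightFiltration hf ih
    rw [zero_add] at hlie
    rw [hlen] at hlie'
    rw [hsplit]
    exact add_mem hlie hlie'

theorem linearIndependent_mkQ_iterBracket_gGen {J : Set (List I)} (hJ : ∀ w ∈ J, w ≠ [])
    (hJind : LinearIndependent ℂ fun w : J => iterBracket (f A) w) :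
    LinearIndependent ℂ ((heightFiltration A 0).mkQ ∘
      fun w : J => iterBracket (gGen A X θ c) w) := by
  have hlen (w : J) : (w : List I).length - 1 + 1 = (w : List I).length :=
    Nat.sub_add_cancel (List.length_pos_of_ne_nil (hJ w w.2))
  refine linearIndependent_mkQ_of_sub_mem heightFiltration_mono
    (d := fun w : J => (w : List I).length - 1) hJind (fun w => ?_)
    (fun w => hθ.iterBracket_gGen_sub_mem_heightFiltration (hJ w w.2)) fun n => ?_
  · rw [hlen]
    exact iterBracket_f_mem_heightFiltration (hJ w w.2)
  · rw [show (fun w : J => iterBracket (f A) w) = iterBracket (f A) ∘ Subtype.val from rfl,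
      Set.image_comp]
    refine disjoint_span_iterBracket_f_heightFiltration ?_
    rintro _ ⟨w, rfl, rfl⟩
    exact (hlen w).symm

omit [Fintype I]
variable [Finite I]

theorem linearIndependent_iterBracket_gGen {J : Set (List I)} (hJ : ∀ w ∈ J, w ≠ [])
    (hJind : LinearIndependent ℂ fun w : J => iterBracket (f A) w) :
    LinearIndependent ℂ fun w : J => iterBracket (gGen A X θ c) w := by
  have := Fintype.ofFinite I
  exact (hθ.linearIndependent_mkQ_iterBracket_gGen hJ hJind).of_comp _

theorem iSupIndep_summand {J : Set (List I)} (hJ : ∀ w ∈ J, w ≠ [])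
    (hJind : LinearIndependent ℂ fun w : J => iterBracket (f A) w) :
    iSupIndep (summand A X θ c J) := by
  have := Fintype.ofFinite I
  refine iSupIndep_sumElim ?_
    (hθ.linearIndependent_iterBracket_gGen hJ hJind).iSupIndep_span_singleton ?_
  · exact (iSupIndep_pair (Fin.zero_ne_one) fun k => by fin_cases k <;> simp).2
      (disjoint_nPlus_cartan.mono_right inf_le_left)
  · have hker := Submodule.range_ker_disjoint
      (hθ.linearIndependent_mkQ_iterBracket_gGen (c := c) hJ hJind)
    rw [Submodule.ker_mkQ, Submodule.span_range_eq_iSup] at hker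
    refine hker.symm.mono_left (iSup_le fun k => ?_)
    fin_cases k
    exacts [nPlus_le_heightFiltration, inf_le_left.trans cartan_le_heightFiltration]

end IsSatakeTheta

end Height

section Generation

variable {I : Type*} [DecidableEq I] {A : Matrix I I ℤ} {X : Finset I}
  {τ : Equiv.Perm I} {γ : I → I → ℤ} {θ : KM A →ₗ[ℂ] KM A} {c : I → ℂ}

theorem iterBracket_mem_sup_span {L : Type*} [LieRing L] [LieAlgebra ℂ L] {U : ℕ → Submodule ℂ L}
    (hU : ∀ a b, ∀ x ∈ U a, ∀ y ∈ U b, ⁅x, y⁆ ∈ U (a + b)) (hA : IsSymmetrizableGCM A)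
    {g : I → L} (hg : ∀ i, g i ∈ U 1)
    (hserre : ∀ i j, serreElt A g i j ∈ U ((-A i j).toNat + 1)) {J : Set (List I)}
    (hJ : ∀ w ∈ J, w ≠ []) {w : List I} (hw : w ≠ [])
    (hwJ : iterBracket (f A) w ∈ Submodule.span ℂ (iterBracket (f A) '' J)) {m : ℕ}
    (hlen : w.length = m + 1) :
    iterBracket g w ∈ U m ⊔ Submodule.span ℂ (iterBracket g '' J) := by
  obtain ⟨a, haJ, ha⟩ := (Finsupp.mem_span_image_iff_linearCombination ℂ).1 hwJ
  let b : List I →₀ ℂ := Finsupp.single w 1 - a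
  have hb0 : ∑ u ∈ b.support, b u • iterBracket (f A) u = 0 := by
    change Finsupp.linearCombination ℂ (iterBracket (f A)) b = 0
    rw [map_sub, ha, Finsupp.linearCombination_single, one_smul, sub_self]
  have hbne : ∀ u ∈ b.support, u ≠ [] := by
    rintro u hu rfl
    refine Finsupp.mem_support_iff.1 hu ?_
    have ha0 : a [] = 0 := Finsupp.notMem_support_iff.1 fun h => hJ [] (haJ h) rfl
    simp [b, ha0, Finsupp.single_eq_of_ne hw.symm]
  have htop := sum_iterBracket_mem hU hA.diag hA.offDiag hA.eq_zero_comm hg hserre hbne hb0 m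
  have hfilter : ∑ u ∈ b.support with u.length = m + 1, b u • iterBracket g u =
      Finsupp.linearCombination ℂ (iterBracket g) (b.filter fun u => u.length = m + 1) := by
    rw [Finsupp.linearCombination_apply, Finsupp.sum, Finsupp.support_filter]
    exact Finset.sum_congr rfl fun u hu => by
      rw [Finsupp.filter_apply_pos (fun u : List I => u.length = m + 1) _
        (Finset.mem_filter.1 hu).2]
  rw [hfilter, Finsupp.filter_sub,
    Finsupp.filter_single_of_pos (fun u : List I => u.length = m + 1) hlen, map_sub,
    Finsupp.linearCombination_single, one_smul] at htop
  rw [← sub_add_cancel (iterBracket g w) (Finsupp.linearCombination ℂ (iterBracket g)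
    (a.filter fun u => u.length = m + 1))]
  refine Submodule.add_mem_sup htop ((Finsupp.mem_span_image_iff_linearCombination ℂ).2
    ⟨_, fun u hu => haJ ?_, rfl⟩)
  rw [Finsupp.support_filter] at hu
  exact (Finset.mem_filter.1 hu).1

namespace IsSatakeTheta

theorem kFiltration_le (hA : IsSymmetrizableGCM A) (hθ : IsSatakeTheta A X τ γ θ)
    (hc : ∀ i ∉ X, c i ≠ 0)
    (hdiff : ∀ j ∉ X, A j (τ j) = 0 → neighbourComponent A X j = ∅ → c j = c (τ j))
    {J : Set (List I)} (hJ : ∀ w ∈ J, w ≠ [])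
    (hJspan : (nMinus A).toSubmodule ≤ Submodule.span ℂ (iterBracket (f A) '' J)) (m : ℕ) :
    kFiltration A X θ c m ≤ ((nPlus A X).toSubmodule ⊔ fixedIn (cartan A) θ) ⊔
      Submodule.span ℂ (iterBracket (gGen A X θ c) '' J) := by
  induction m with
  | zero =>
    refine sup_le_sup_left (Submodule.span_le.2 ?_) _
    rintro _ ⟨w, ⟨hw, hw0⟩, rfl⟩
    exact absurd (List.length_eq_zero_iff.1 (Nat.le_zero.1 hw0)) hw
  | succ m ih =>
    refine sup_le le_sup_left (Submodule.span_le.2 ?_)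
    rintro _ ⟨w, ⟨hw, hwm⟩, rfl⟩
    rcases hwm.lt_or_eq with hlt | heq
    · exact ih (iterBracket_mem_kFiltration hw (Nat.lt_succ_iff.1 hlt))
    have hfw : iterBracket (f A) w ∈ nMinus A :=
      iterBracket_mem_lieSubalgebra hw fun i _ => f_mem_nMinus A i
    exact sup_le ih le_sup_right <| iterBracket_mem_sup_span
      (fun _ _ _ hx _ hy => hθ.lie_mem_kFiltration hx hy) hA gGen_mem_kFiltration
      (hθ.serreElt_gGen_mem_kFiltration hA hc hdiff) hJ hw (hJspan hfw) heq

theorem toSubmodule_kSub_le (hθ : IsSatakeTheta A X τ γ θ) :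
    (kSub A X θ c).toSubmodule ≤ ⨆ m, kFiltration A X θ c m := by
  have hdir : Directed (· ≤ ·) (kFiltration A X θ c) :=
    directed_of_isDirected_le fun _ _ => kFiltration_mono
  refine lieSpan_le_of_stable ?_ ?_
  · rintro x ((hx | hx) | ⟨i, rfl⟩)
    · exact Submodule.mem_iSup_of_mem 0 (nPlus_le_kFiltration 0 hx)
    · exact Submodule.mem_iSup_of_mem 0 (fixed_le_kFiltration 0 hx)
    · exact Submodule.mem_iSup_of_mem 1 (gGen_mem_kFiltration i)
  · intro x hx v hv
    obtain ⟨m, hm⟩ := (Submodule.mem_iSup_of_directed _ hdir).1 hv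
    rcases hx with (hx | hx) | ⟨i, rfl⟩
    · exact Submodule.mem_iSup_of_mem m (hθ.lie_nPlus_mem_kFiltration hx hm)
    · exact Submodule.mem_iSup_of_mem m (hθ.lie_fixed_mem_kFiltration hx hm)
    · exact Submodule.mem_iSup_of_mem (m + 1) (hθ.lie_gGen_mem_kFiltration i hm)

theorem iSup_summand (hA : IsSymmetrizableGCM A) (hθ : IsSatakeTheta A X τ γ θ)
    (hc : ∀ i ∉ X, c i ≠ 0)
    (hdiff : ∀ j ∉ X, A j (τ j) = 0 → neighbourComponent A X j = ∅ → c j = c (τ j))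
    {J : Set (List I)} (hJ : ∀ w ∈ J, w ≠ [])
    (hJspan : (nMinus A).toSubmodule ≤ Submodule.span ℂ (iterBracket (f A) '' J)) :
    (⨆ s, summand A X θ c J s) = (kSub A X θ c).toSubmodule := by
  apply le_antisymm
  · rw [iSup_le_iff]
    rintro (k | ⟨w, hw⟩)
    · fin_cases k
      · exact fun x hx => LieSubalgebra.subset_lieSpan (Or.inl (Or.inl hx))
      · exact fun x hx => LieSubalgebra.subset_lieSpan (Or.inl (Or.inr hx))
    · exact (Submodule.span_singleton_le_iff_mem _ _).2 <| iterBracket_mem_lieSubalgebra (hJ w hw)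
        fun i _ => LieSubalgebra.subset_lieSpan (Or.inr ⟨i, rfl⟩)
  · refine (hθ.toSubmodule_kSub_le.trans
      (iSup_le (hθ.kFiltration_le hA hc hdiff hJ hJspan))).trans ?_
    refine sup_le (sup_le (le_iSup (summand A X θ c J) (Sum.inl 0))
      (le_iSup (summand A X θ c J) (Sum.inl 1))) (Submodule.span_le.2 ?_)
    rintro _ ⟨w, hw, rfl⟩
    exact Submodule.mem_iSup_of_mem (Sum.inr ⟨w, hw⟩) (Submodule.mem_span_singleton_self _)

end IsSatakeTheta

end Generation

end KacMoody

end

open KacMoody in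
theorem mainTheorem2_general {I : Type*} [Fintype I] [DecidableEq I] (A : Matrix I I ℤ)
    (hA : IsSymmetrizableGCM A)
    (X : Finset I) (τ : Equiv.Perm I) (hXτ : IsGeneralizedSatake A X τ)
    (l : List I) (hl : IsLongestWord A X l)
    (θ : KM A →ₗ[ℂ] KM A) (hθ : θ = theta A τ hXτ.diagramAut l)
    (c : I → ℂ) (hc : ∀ i ∉ X, c i ≠ 0)
    (hdiff : ∀ j ∉ X, A j (τ j) = 0 → neighbourComponent A X j = ∅ → c j = c (τ j))
    (J : Set (List I)) (hJ : ∀ w ∈ J, w ≠ [])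
    (hJind : LinearIndependent ℂ fun w : J => iterBracket (f A) w)
    (hJspan : Submodule.span ℂ (Set.range fun w : J => iterBracket (f A) w) =
      (nMinus A).toSubmodule) :
    iSupIndep (summand A X θ c J) ∧
      (⨆ s, summand A X θ c J s) = (kSub A X θ c).toSubmodule ∧
      ∀ w ∈ J, iterBracket (gGen A X θ c) w ≠ 0 := by
  subst hθ
  have hS := hXτ.isSatakeTheta hA hl
  have hJspan' : (nMinus A).toSubmodule ≤ Submodule.span ℂ (iterBracket (f A) '' J) := by
    rw [← hJspan, Set.image_eq_range]
  exact ⟨hS.iSupIndep_summand hJ hJind, hS.iSup_summand hA hc hdiff hJ hJspan',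
    fun w hw => (hS.linearIndependent_iterBracket_gGen hJ hJind).ne_zero ⟨w, hw⟩⟩

open KacMoody in
/-- `c` is a family of nonzero scalars indexed by the complement of `X` (its values on `X` are never
used); `l` is any reduced expression of the longest element of `W_X`; `J` is any set of nonempty
words whose iterated brackets of the `f_i` form a basis of `𝔫⁻`. -/
theorem mainTheorem2 {I : Type*} [Fintype I] [DecidableEq I] (A : Matrix I I ℤ)
    (hA : IsSymmetrizableGCM A) (hind : IsIndecomposable A)
    (X : Finset I) (τ : Equiv.Perm I) (hXτ : IsGeneralizedSatake A X τ)
    (l : List I) (hl : IsLongestWord A X l)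
    (θ : KM A →ₗ[ℂ] KM A) (hθ : θ = theta A τ hXτ.diagramAut l)
    (c : I → ℂ) (hc : ∀ i ∉ X, c i ≠ 0)
    (hdiff : ∀ j ∉ X, A j (τ j) = 0 → neighbourComponent A X j = ∅ → c j = c (τ j))
    (J : Set (List I)) (hJ : ∀ w ∈ J, w ≠ [])
    (hJind : LinearIndependent ℂ fun w : J => iterBracket (f A) w)
    (hJspan : Submodule.span ℂ (Set.range fun w : J => iterBracket (f A) w) =
      (nMinus A).toSubmodule) :
    iSupIndep (summand A X θ c J) ∧
      (⨆ s, summand A X θ c J s) = (kSub A X θ c).toSubmodule ∧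
      ∀ w ∈ J, iterBracket (gGen A X θ c) w ≠ 0 :=
  mainTheorem2_general A hA X τ hXτ l hl θ hθ c hc hdiff J hJ hJind hJspan
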